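/- **Setting.** Let $N\ge 2$, $V=\{1,\dots,N\}$, let $\omega_{\{x,y\}}\ge 0$ be symmetric conductances with $\omega_{\{x,x\}}=0$ such that the graph with edges $\{x,y\}$, $\omega_{\{x,y\}}>0$, is connected, and let $\alpha_x\in\{1,2,\dots\}$ for $x\in V$. Let $\sigma=-1$ (symmetric partial exclusion, SEP) or $\sigma=1$ (symmetric inclusion, SIP), $\alpha_L,\alpha_R>0$, $\omega_L,\omega_R>0$ and $\theta_L\ne\theta_R$ in $\Theta$, where $\Theta=[0,1]$ if $\sigma=-1$ and $\Theta=[0,\infty)$ if $\sigma=1$. Let $\mathcal X=\prod_{x\in V}\{0,\dots,\alpha_x\}$ if $\sigma=-1$ and $\mathcal X=\mathbb N_0^V$ if $\sigma=1$. Let $(\eta_t)_{t\ge0}$ be the Markov jump process on $\mathcal X$ with generator $$\begin{aligned}\mathcal Lf(\eta)=&\sum_{x,y\in V}\omega_{\{x,y\}}\,\eta(x)(\alpha_y+\sigma\eta(y))\big(f(\eta-\delta_x+\delta_y)-f(\eta)\big)\\ &+\omega_L\Big\{\eta(1)\alpha_L(1+\sigma\theta_L)\big(f(\eta-\delta_1)-f(\eta)\big)+\alpha_L\theta_L(\alpha_1+\sigma\eta(1))\big(f(\eta+\delta_1)-f(\eta)\big)\Big\}\\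 &+\omega_R\Big\{\eta(N)\alpha_R(1+\sigma\theta_R)\big(f(\eta-\delta_N)-f(\eta)\big)+\alpha_R\theta_R(\alpha_N+\sigma\eta(N))\big(f(\eta+\delta_N)-f(\eta)\big)\Big\}.\end{aligned}$$ For $\xi\in\widehat{\mathcal X}=\mathcal X\times\mathbb N_0^{\{L,R\}}$ and $\eta\in\mathcal X$ put $$D^{c\ell}(\xi,\eta)=\theta_L^{\xi(L)}\Big(\prod_{x\in V}\frac{\eta(x)!}{(\eta(x)-\xi(x))!}\,\frac{\mathbf 1_{\{\xi(x)\le\eta(x)\}}}{w_x(\xi(x))}\Big)\theta_R^{\xi(R)},$$ with $0^0=1$, where $w_x(k)=\alpha_x(\alpha_x-1)\cdots(\alpha_x-k+1)$ if $\sigma=-1$ and $w_x(k)=\alpha_x(\alpha_x+1)\cdots(\alpha_x+k-1)$ if $\sigma=1$. For $\theta\in\Theta$ let $\nu_{x,\theta}$ be the Binomial$(\alpha_x,\theta)$ law if $\sigma=-1$, and the Negative-Binomial law $\nu_{x,\theta}(n)=\frac{w_x(n)}{n!}\,(1+\theta)^{-\alpha_x}\big(\tfrac{\theta}{1+\theta}\big)^n$,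 $n\in\mathbb N_0$, if $\sigma=1$. **Theorem (sign of two-point correlations).** The process $(\eta_t)$ has a unique stationary probability measure $\mu_{\theta_L,\theta_R}$, and $\bar\theta_x:=\mathbb E_{\mu_{\theta_L,\theta_R}}[\eta(x)/\alpha_x]$ is finite for all $x\in V$. Let $\mu_{\bar{\boldsymbol\theta}}=\bigotimes_{x\in V}\nu_{x,\bar\theta_x}$ be the local equilibrium product measure. Let $\xi\in\widehat{\mathcal X}$ satisfy $\sum_{x\in V}\xi(x)\ge2$ and $\theta_L^{\xi(L)}\theta_R^{\xi(R)}\neq0$ (that is, $\xi(L)=0$ if $\theta_L=0$, and $\xi(R)=0$ if $\theta_R=0$). Then $D^{c\ell}(\xi,\eta_t)$ is integrable for all $t\ge0$ when $\eta_0$ has law $\mu_{\bar{\boldsymbol\theta}}$, its expectation is differentiable in $t>0$, and for all $t>0$ $$\frac{\mathrm d}{\mathrm dt}\,\mathbb E_{\mu_{\bar{\boldsymbol\theta}}}\big[D^{c\ell}(\xi,\eta_t)\big]\ \begin{cases}<0&\text{if }\sigma=-1,\\>0&\text{if }\sigma=1.\end{cases}$$ Moreover, for all $x,y\in V$ with $x\neq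 y$, the following expectation exists and $$\mathbb E_{\mu_{\theta_L,\theta_R}}\Big[\Big(\frac{\eta(x)}{\alpha_x}-\bar\theta_x\Big)\Big(\frac{\eta(y)}{\alpha_y}-\bar\theta_y\Big)\Big]\ \begin{cases}<0&\text{if }\sigma=-1,\\>0&\text{if }\sigma=1.\end{cases}$$ -/

import Mathlib

open MeasureTheory

open scoped ENNReal

noncomputable section

/-! ## Continuous-time Markov chains on a countable set -/

open Classical in
/-- The iterates of the integrated Kolmogorov backward equation of a rate matrix `Q`
(`Q x y` is the jump rate from `x` to `y ≠ x`, and `-Q x x` is the total jump rate out of `x`):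
`fellerIter Q k t x y` is the probability that the chain started from `x` is at `y` at time `t`
after fewer than `k` jumps. -/
def fellerIter {S : Type*} (Q : S → S → ℝ) : ℕ → ℝ → S → S → ℝ≥0∞
  | 0, _, _, _ => 0
  | k + 1, t, x, y =>
      (if x = y then ENNReal.ofReal (Real.exp (Q x x * t)) else 0) +
        ∫⁻ s in Set.Ioc 0 t, ∑' z,
          if z = x then 0
          else ENNReal.ofReal (Real.exp (Q x x * s)) * ENNReal.ofReal (Q x z) *
            fellerIter Q k (t - s) z y

/-- The transition function `p_t(x,y) = P_x(X_t = y)` of the Markov jump process with rate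
matrix `Q` (the minimal solution of the backward equation, in the construction of Feller). -/
def transitionProb {S : Type*} (Q : S → S → ℝ) (t : ℝ) (x y : S) : ℝ≥0∞ :=
  ⨆ k, fellerIter Q k t x y

/-- The law at time `t` of the Markov jump process with rate matrix `Q`
started from the probability measure `μ`. -/
def lawAt {S : Type*} [MeasurableSpace S] (Q : S → S → ℝ) (μ : Measure S) (t : ℝ) : Measure S :=
  μ.bind fun x => Measure.sum fun y => transitionProb Q t x y • Measure.dirac y

/-! ## The boundary driven particle systems -/

/-- The parameters of a boundary driven particle system. The bulk is `V = {1, …, N}`, modelled as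
`Fin N`; `σ = -1` is exclusion (SEP), `σ = 0` independent walkers (IRW), `σ = 1` inclusion (SIP). -/
structure BoundaryDriven where
  /-- number of bulk sites -/
  N : ℕ
  N_pos : 0 < N
  /-- type of interaction, an element of `{-1, 0, 1}` -/
  σ : SignType
  /-- bulk conductances -/
  ω : Fin N → Fin N → ℝ
  ω_symm : ∀ x y, ω x y = ω y x
  ω_nonneg : ∀ x y, 0 ≤ ω x y
  ω_diag : ∀ x, ω x x = 0
  connected : (SimpleGraph.fromRel fun x y => ω x y ≠ 0).Connected
  /-- site parameters -/
  α : Fin N → ℕ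
  α_pos : ∀ x, 0 < α x
  /-- conductance between the left reservoir and the first site -/
  ωL : ℝ
  /-- conductance between the right reservoir and the last site -/
  ωR : ℝ
  ωL_nonneg : 0 ≤ ωL
  ωR_nonneg : 0 ≤ ωR
  /-- left reservoir parameter -/
  αL : ℝ
  /-- right reservoir parameter -/
  αR : ℝ
  αL_pos : 0 < αL
  αR_pos : 0 < αR
  /-- left scale parameter -/
  θL : ℝ
  /-- right scale parameter -/
  θR : ℝ
  θL_nonneg : 0 ≤ θL
  θR_nonneg : 0 ≤ θR
  θL_le_one : σ = -1 → θL ≤ 1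
  θR_le_one : σ = -1 → θR ≤ 1

namespace BoundaryDriven

variable (P : BoundaryDriven)

/-- The site `1`. -/
def first : Fin P.N := ⟨0, P.N_pos⟩

/-- The site `N`. -/
def last : Fin P.N := ⟨P.N - 1, Nat.sub_lt P.N_pos Nat.one_pos⟩

/-- The configuration space `𝒳`: `∏ₓ {0, …, αₓ}` for `σ = -1`, and `ℕ₀^V` otherwise. -/
def State : Type := {η : Fin P.N → ℕ // P.σ = -1 → ∀ x, η x ≤ P.α x}

instance : MeasurableSpace P.State := ⊤

/-- The configuration space of the dual system, `𝒳 × ℕ₀^{L,R}`. -/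
structure DualState where
  /-- the particles in the bulk -/
  bulk : P.State
  /-- the number of particles at `L` -/
  left : ℕ
  /-- the number of particles at `R` -/
  right : ℕ

/-- The configuration `η + δₓ`. -/
def add (η : Fin P.N → ℕ) (x : Fin P.N) : Fin P.N → ℕ := η + Pi.single x 1

/-- The configuration `η - δₓ` (only used where `η x ≥ 1`, since all rates contain `η x`). -/
def remove (η : Fin P.N → ℕ) (x : Fin P.N) : Fin P.N → ℕ := η - Pi.single x 1

/-- The infinitesimal generator. The bulk part is a sum over ordered pairs `(x, y)`, that is, over
both directions of each bond. Jumps leaving the configuration space have rate zero, so the values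
of `f` outside of it do not matter. -/
def generator (f : (Fin P.N → ℕ) → ℝ) (η : Fin P.N → ℕ) : ℝ :=
  (∑ x, ∑ y, P.ω x y * (η x * (P.α y + (P.σ : ℝ) * η y) *
      (f (P.add (P.remove η x) y) - f η))) +
  P.ωL * (η P.first * (P.αL + (P.σ : ℝ) * (P.αL * P.θL)) * (f (P.remove η P.first) - f η) +
    P.αL * P.θL * (P.α P.first + (P.σ : ℝ) * η P.first) * (f (P.add η P.first) - f η)) +
  P.ωR * (η P.last * (P.αR + (P.σ : ℝ) * (P.αR * P.θR)) * (f (P.remove η P.last) - f η) +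
    P.αR * P.θR * (P.α P.last + (P.σ : ℝ) * η P.last) * (f (P.add η P.last) - f η))

/-- The rate matrix of the process: the generator applied to the indicator of `η'`, at `η`. -/
def rate (η η' : P.State) : ℝ :=
  P.generator (fun ζ => if ζ = η'.1 then 1 else 0) η.1

/-- The law of `η_t` when `η_0` has law `μ`. -/
def law (μ : Measure P.State) (t : ℝ) : Measure P.State := lawAt P.rate μ t

/-- `μ` is a stationary measure. -/
def IsStationary (μ : Measure P.State) : Prop := ∀ t : ℝ, 0 ≤ t → P.law μ t = μ

/-- The weights `wₓ(k)`. -/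
def w (x : Fin P.N) (k : ℕ) : ℝ :=
  if P.σ = -1 then ((P.α x).descFactorial k : ℝ)
  else if P.σ = 0 then (P.α x : ℝ) ^ k
  else ((P.α x).ascFactorial k : ℝ)

/-- The classical duality function
`θ_L^{ξ(L)} (∏ₓ η(x)! / (η(x) - ξ(x))! · 1 / wₓ(ξ(x)) · 1_{ξ(x) ≤ η(x)}) θ_R^{ξ(R)}`. -/
def Dcl (ξ : P.DualState) (η : P.State) : ℝ :=
  P.θL ^ ξ.left * (∏ x, ((η.1 x).descFactorial (ξ.bulk.1 x) : ℝ) / P.w x (ξ.bulk.1 x)) *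
    P.θR ^ ξ.right

/-- The normalising constants `z_{x,θ}` (for `σ = -1`, used for `θ < 1` only). -/
def z (x : Fin P.N) (θ : ℝ) : ℝ :=
  if P.σ = -1 then ((1 - θ) ^ P.α x)⁻¹
  else if P.σ = 0 then Real.exp (P.α x * θ)
  else (1 + θ) ^ P.α x

/-- The mass function of the marginal `ν_{x,θ}`: Binomial `(αₓ, θ)` for `σ = -1`,
Poisson `(αₓ θ)` for `σ = 0`, Negative-Binomial `(αₓ, θ / (1 + θ))` for `σ = 1`. -/
def ν (x : Fin P.N) (θ : ℝ) (n : ℕ) : ℝ :=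
  if P.σ = -1 ∧ θ = 1 then (if n = P.α x then 1 else 0)
  else P.w x n / P.z x θ * ((θ / (1 + (P.σ : ℝ) * θ)) ^ n / (n.factorial : ℝ))

/-- The product measure `⊗ₓ ν_{x,θₓ}` on the configuration space. -/
def productMeasure (θ : Fin P.N → ℝ) : Measure P.State :=
  Measure.sum fun η : P.State =>
    ENNReal.ofReal (∏ x, P.ν x (θ x) (η.1 x)) • Measure.dirac η

/-- The profile `x ↦ E_μ[η(x) / αₓ]`. -/
def profile (μ : Measure P.State) (x : Fin P.N) : ℝ := ∫ η, (η.1 x : ℝ) / P.α x ∂μ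

/-- The expectation at time `t` of `D^{cl}(ξ, η_t)` when `η_0` is distributed according to the
local equilibrium product measure associated with the stationary measure `μ`. -/
def localEquilibriumExpectation (μ : Measure P.State) (ξ : P.DualState) (t : ℝ) : ℝ :=
  ∫ η, P.Dcl ξ η ∂(P.law (P.productMeasure (P.profile μ)) t)

/-- The two-point correlation
`E_μ[(η(x) / αₓ - E_μ[η(x) / αₓ]) (η(y) / α_y - E_μ[η(y) / α_y])]`. -/
def correlation (μ : Measure P.State) (x y : Fin P.N) : ℝ :=
  ∫ η, ((η.1 x : ℝ) / P.α x - P.profile μ x) * ((η.1 y : ℝ) / P.α y - P.profile μ y) ∂μ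

end BoundaryDriven

end

/-! Everything rests on duality. `Dcl` intertwines the particle generator with the generator A of a
dual system whose particles follow the same bulk interaction and are absorbed, and counted, at the
two reservoirs. The dual conserves its total number n, so on `DualLevel n` it is a finite chain, and
the moments of the particle system at time t are a matrix exponential applied to the initial
moments. Passing from generators to semigroups on an infinite configuration space (`semigroup_Dcl`)
uses that a solution of the backward equation controlled by a Lyapunov function is the minimal one
(`semigroup_eq_of_lyapunov`); powers of 1 + particle number serve as Lyapunov functions. Level 0
gives non-explosion. Level 1 gives tightness, hence a stationary law by Krylov-Bogoliubov; it is
unique because the empty configuration is reached from everywhere (`exists_stationary`).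

Level 1 also shows that the stationary profile θ solves a discrete Dirichlet problem with distinct
boundary values θ_L and θ_R. By the maximum principle θ > 0, and θ < 1 for exclusion; moreover θ
varies along some bond.

The moments of the local equilibrium measure are G(ξ) = θ_L^ξ(L) ∏ θ_x^ξ(x) θ_R^ξ(R). Harmonicity of
θ cancels the linear part of A G, and symmetrising over bonds leaves A G = σ G I, where I sums ω
ξ(x) ξ(y) (θ_y - θ_x)² / (2 θ_x θ_y) (`gen_equilibriumMoment`). Since A commutes with its semigroup,
the time derivative of the expectation is σ exp(tA)(G I). It is nonzero because the dual can bring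
two particles to the ends of a bond along which θ varies (`dualHeat_interaction_pos`).

For the correlations, put K = σ (E_μ[D] - G) on level 2. Stationarity makes the first term harmonic
for the dual, so A K = -G I, and K vanishes when fewer than two particles are in the bulk. A minimum
principle gives K > 0 (`pos_of_superharmonic`), and K at a pair of sites is σ times the correlation.
-/

open MeasureTheory

open scoped ENNReal

/-! ## The minimal solution of the backward equation -/

namespace FellerChain

variable {S : Type*} (Q : S → S → ℝ)

open Classical in
/-- The off-diagonal part of the rate matrix, acting on nonnegative functions. -/
noncomputable def jump (f : S → ℝ≥0∞) (x : S) : ℝ≥0∞ :=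
  ∑' z, if z = x then 0 else ENNReal.ofReal (Q x z) * f z

/-- The action of `fellerIter` on nonnegative functions. -/
noncomputable def iter (k : ℕ) (t : ℝ) (f : S → ℝ≥0∞) (x : S) : ℝ≥0∞ :=
  ∑' y, fellerIter Q k t x y * f y

/-- The transition semigroup, acting on nonnegative functions. -/
noncomputable def semigroup (t : ℝ) (f : S → ℝ≥0∞) (x : S) : ℝ≥0∞ :=
  ∑' y, transitionProb Q t x y * f y

lemma jump_mono {f g : S → ℝ≥0∞} (h : ∀ x, f x ≤ g x) (x : S) : jump Q f x ≤ jump Q g x := by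
  unfold jump
  refine ENNReal.tsum_le_tsum fun z => ?_
  split_ifs
  · exact le_rfl
  · gcongr; exact h z

lemma jump_add (f g : S → ℝ≥0∞) (x : S) :
    jump Q (fun z => f z + g z) x = jump Q f x + jump Q g x := by
  unfold jump
  rw [← ENNReal.tsum_add]
  refine tsum_congr fun z => ?_
  split_ifs
  · simp
  · ring

lemma jump_const_mul (c : ℝ≥0∞) (f : S → ℝ≥0∞) (x : S) :
    jump Q (fun z => c * f z) x = c * jump Q f x := by
  unfold jump
  rw [← ENNReal.tsum_mul_left]
  refine tsum_congr fun z => ?_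
  split_ifs
  · simp
  · ring

lemma measurable_jump [Countable S] {β : Type*} [MeasurableSpace β] {u : β → S → ℝ≥0∞}
    (hu : ∀ x, Measurable fun b => u b x) (x : S) : Measurable fun b => jump Q (u b) x := by
  unfold jump
  refine Measurable.tsum fun z => ?_
  split_ifs
  · exact measurable_const
  · exact (hu z).const_mul _

/-- Convolution of the jump part of the backward equation with the holding time. -/
noncomputable def conv (u : ℝ → S → ℝ≥0∞) (t : ℝ) (x : S) : ℝ≥0∞ :=
  ∫⁻ s in Set.Ioc 0 t, ENNReal.ofReal (Real.exp (Q x x * s)) * jump Q (u (t - s)) x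

lemma conv_mono {u v : ℝ → S → ℝ≥0∞} {t : ℝ} (h : ∀ s, 0 ≤ s → s ≤ t → ∀ x, u s x ≤ v s x)
    (x : S) : conv Q u t x ≤ conv Q v t x := by
  unfold conv
  refine setLIntegral_mono' measurableSet_Ioc fun s hs => ?_
  gcongr
  exact jump_mono Q (h _ (by linarith [hs.2]) (by linarith [hs.1])) x

lemma measurable_integrand [Countable S] {u : ℝ → S → ℝ≥0∞} (hu : ∀ x, Measurable fun t => u t x)
    (t : ℝ) (x : S) :
    Measurable fun s => ENNReal.ofReal (Real.exp (Q x x * s)) * jump Q (u (t - s)) x :=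
  (ENNReal.measurable_ofReal.comp (by fun_prop)).mul
    ((measurable_jump Q hu x).comp (measurable_const.sub measurable_id))

lemma conv_add [Countable S] {u v : ℝ → S → ℝ≥0∞} (hu : ∀ x, Measurable fun t => u t x)
    (t : ℝ) (x : S) :
    conv Q (fun s z => u s z + v s z) t x = conv Q u t x + conv Q v t x := by
  unfold conv
  rw [← lintegral_add_left (measurable_integrand Q hu t x)]
  refine lintegral_congr fun s => ?_
  rw [jump_add, mul_add]

lemma measurable_conv [Countable S] {u : ℝ → S → ℝ≥0∞} (hu : ∀ x, Measurable fun t => u t x)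
    (x : S) : Measurable fun t => conv Q u t x := by
  unfold conv
  -- The domain of integration depends on t; an indicator on the plane turns it into a section of
  -- one jointly measurable function.
  have h : ∀ t : ℝ, (∫⁻ s in Set.Ioc 0 t,
      ENNReal.ofReal (Real.exp (Q x x * s)) * jump Q (u (t - s)) x) =
      ∫⁻ s, {p : ℝ × ℝ | 0 < p.2 ∧ p.2 ≤ p.1}.indicator
        (fun p => ENNReal.ofReal (Real.exp (Q x x * p.2)) * jump Q (u (p.1 - p.2)) x) (t, s) := by
    intro t
    rw [← lintegral_indicator measurableSet_Ioc]
    rfl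
  simp_rw [h]
  refine Measurable.lintegral_prod_right' ?_
  refine Measurable.indicator ?_ ?_
  · exact (ENNReal.measurable_ofReal.comp (by fun_prop)).mul
      ((measurable_jump Q hu x).comp (measurable_fst.sub measurable_snd))
  · exact (measurableSet_lt measurable_const measurable_snd).inter
      (measurableSet_le measurable_snd measurable_fst)

open Classical in
lemma fellerIter_succ (k : ℕ) (t : ℝ) (x y : S) :
    fellerIter Q (k + 1) t x y =
      (if x = y then ENNReal.ofReal (Real.exp (Q x x * t)) else 0) +
        conv Q (fun s z => fellerIter Q k s z y) t x := by
  rw [fellerIter]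
  congr 1
  unfold conv
  refine lintegral_congr fun s => ?_
  unfold jump
  rw [← ENNReal.tsum_mul_left]
  refine tsum_congr fun z => ?_
  split_ifs <;> ring

lemma measurable_fellerIter [Countable S] (k : ℕ) (x y : S) :
    Measurable fun t => fellerIter Q k t x y := by
  classical
  induction k generalizing x with
  | zero => exact measurable_const
  | succ k ih =>
    simp_rw [fellerIter_succ]
    refine Measurable.add ?_ (measurable_conv Q (fun z => ih z) x)
    split_ifs
    · exact ENNReal.measurable_ofReal.comp (by fun_prop)
    · exact measurable_const

lemma fellerIter_le_succ (k : ℕ) (t : ℝ) (x y : S) :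
    fellerIter Q k t x y ≤ fellerIter Q (k + 1) t x y := by
  classical
  induction k generalizing t x with
  | zero => exact zero_le
  | succ k ih =>
    rw [fellerIter_succ Q (k + 1), fellerIter_succ Q k]
    gcongr
    exact conv_mono Q (fun s _ _ z => ih s z) x

lemma monotone_fellerIter (t : ℝ) (x y : S) : Monotone fun k => fellerIter Q k t x y :=
  monotone_nat_of_le_succ fun k => fellerIter_le_succ Q k t x y

lemma measurable_transitionProb [Countable S] (x y : S) :
    Measurable fun t => transitionProb Q t x y :=
  Measurable.iSup fun k => measurable_fellerIter Q k x y

lemma measurable_iter [Countable S] (k : ℕ) (f : S → ℝ≥0∞) (x : S) :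
    Measurable fun t => iter Q k t f x :=
  Measurable.tsum fun y => (measurable_fellerIter Q k x y).mul_const _

lemma measurable_semigroup [Countable S] (f : S → ℝ≥0∞) (x : S) :
    Measurable fun t => semigroup Q t f x :=
  Measurable.tsum fun y => (measurable_transitionProb Q x y).mul_const _

lemma monotone_iter (t : ℝ) (f : S → ℝ≥0∞) (x : S) : Monotone fun k => iter Q k t f x :=
  fun _ _ h => ENNReal.tsum_le_tsum fun y => by
    gcongr; exact monotone_fellerIter Q t x y h

lemma tsum_iSup_of_monotone {β : Type*} {f : ℕ → β → ℝ≥0∞} (hf : ∀ y, Monotone fun k => f k y) :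
    ∑' y, ⨆ k, f k y = ⨆ k, ∑' y, f k y := by
  let _ : MeasurableSpace β := ⊤
  have := lintegral_iSup (μ := Measure.count) (f := f) (fun _ => measurable_from_top)
    (fun a b h y => hf y h)
  simpa [lintegral_count] using this

lemma semigroup_eq_iSup (t : ℝ) (f : S → ℝ≥0∞) (x : S) :
    semigroup Q t f x = ⨆ k, iter Q k t f x := by
  unfold semigroup iter transitionProb
  rw [← tsum_iSup_of_monotone]
  · simp_rw [ENNReal.iSup_mul]
  · intro y a b h
    exact mul_le_mul_left (monotone_fellerIter Q t x y h) _

/-- Tonelli: summing over end points commutes with the holding time integral and with the sum over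
the first jump. -/
lemma iter_succ [Countable S] (k : ℕ) (t : ℝ) (f : S → ℝ≥0∞) (x : S) :
    iter Q (k + 1) t f x = ENNReal.ofReal (Real.exp (Q x x * t)) * f x +
      conv Q (fun s z => iter Q k s f z) t x := by
  classical
  unfold iter
  simp_rw [fellerIter_succ, add_mul]
  rw [ENNReal.tsum_add]
  congr 1
  · rw [tsum_eq_single x]
    · simp
    · intro y hy; simp [Ne.symm hy]
  · unfold conv
    have : ∀ y, (∫⁻ s in Set.Ioc 0 t, ENNReal.ofReal (Real.exp (Q x x * s)) *
        jump Q (fun z => fellerIter Q k (t - s) z y) x) * f y =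
        ∫⁻ s in Set.Ioc 0 t, ENNReal.ofReal (Real.exp (Q x x * s)) *
        jump Q (fun z => fellerIter Q k (t - s) z y) x * f y := fun y =>
      (lintegral_mul_const _ (measurable_integrand Q
        (u := fun s z => fellerIter Q k s z y) (fun z => measurable_fellerIter Q k z y) t x)).symm
    simp_rw [this]
    rw [← lintegral_tsum fun y => ((measurable_integrand Q
        (u := fun s z => fellerIter Q k s z y)
        (fun z => measurable_fellerIter Q k z y) t x).mul_const _).aemeasurable]
    refine lintegral_congr fun s => ?_
    simp_rw [mul_assoc]
    rw [ENNReal.tsum_mul_left]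
    congr 1
    unfold jump
    simp_rw [← ENNReal.tsum_mul_right]
    rw [ENNReal.tsum_comm]
    refine tsum_congr fun z => ?_
    split_ifs
    · simp
    · rw [← ENNReal.tsum_mul_left]
      exact tsum_congr fun y => by ring

/-- The backward integral equation. -/
lemma semigroup_eq [Countable S] (t : ℝ) (f : S → ℝ≥0∞) (x : S) :
    semigroup Q t f x = ENNReal.ofReal (Real.exp (Q x x * t)) * f x +
      conv Q (fun s z => semigroup Q s f z) t x := by
  -- Dropping the zeroth iterate leaves the supremum unchanged and lets `iter_succ` apply to every
  -- term; the rest is monotone convergence.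
  rw [semigroup_eq_iSup, ← (monotone_iter Q t f x).iSup_nat_add 1]
  simp_rw [iter_succ]
  rw [← ENNReal.add_iSup]
  congr 1
  unfold conv
  rw [← lintegral_iSup]
  · refine lintegral_congr fun s => ?_
    rw [← ENNReal.mul_iSup]
    congr 1
    unfold jump
    simp_rw [semigroup_eq_iSup]
    rw [← tsum_iSup_of_monotone]
    · refine tsum_congr fun z => ?_
      split_ifs
      · simp
      · rw [ENNReal.mul_iSup]
    · intro z a b h
      dsimp only
      split_ifs
      · exact le_rfl
      · gcongr; exact monotone_iter Q _ f z h
  · exact fun k => measurable_integrand Q (measurable_iter Q k f) t x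
  · intro a b h s
    dsimp only
    gcongr
    exact jump_mono Q (fun z => monotone_iter Q _ f z h) x

/-- The semigroup is the minimal solution of the backward integral equation. -/
lemma semigroup_le [Countable S] {f : S → ℝ≥0∞} {u : ℝ → S → ℝ≥0∞}
    (hu : ∀ t, 0 ≤ t → ∀ x, ENNReal.ofReal (Real.exp (Q x x * t)) * f x + conv Q u t x ≤ u t x)
    {t : ℝ} (ht : 0 ≤ t) (x : S) : semigroup Q t f x ≤ u t x := by
  rw [semigroup_eq_iSup]
  refine iSup_le fun k => ?_
  -- Every iterate stays below the supersolution because `conv` is monotone, so their supremum does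
  -- too.
  induction k generalizing t x with
  | zero => simp [iter, fellerIter]
  | succ k ih =>
    rw [iter_succ]
    refine le_trans ?_ (hu t ht x)
    gcongr
    exact conv_mono Q (fun s hs _ z => ih hs z) x

end FellerChain

/-! ### Comparison for the backward equation, Chapman-Kolmogorov, positivity -/

namespace FellerChain

variable {S : Type*} (Q : S → S → ℝ)

lemma setLIntegral_ofReal_of_hasDerivAt {G g : ℝ → ℝ} {t : ℝ} (ht : 0 ≤ t)
    (hG : ∀ s, HasDerivAt G (g s) s) (hg : Continuous g) (hpos : ∀ s, 0 < s → s ≤ t → 0 ≤ g s) :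
    ∫⁻ s in Set.Ioc 0 t, ENNReal.ofReal (g s) = ENNReal.ofReal (G t - G 0) := by
  rw [← intervalIntegral.integral_eq_sub_of_hasDerivAt (fun s _ => hG s)
    (hg.intervalIntegrable 0 t), intervalIntegral.integral_of_le ht,
    ofReal_integral_eq_lintegral_ofReal]
  · exact (hg.intervalIntegrable 0 t).1
  · exact (ae_restrict_iff' measurableSet_Ioc).2 (Filter.Eventually.of_forall
      fun s hs => hpos s hs.1 hs.2)

/-- The last factor is the probability that the exponential holding time at x ends before t. It is
less than one, which is the source of the contraction in `le_semigroup_add`. -/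
lemma conv_const_le (hQ : ∀ x, jump Q (fun _ => 1) x ≤ ENNReal.ofReal (-Q x x))
    (hQ0 : ∀ x, Q x x ≤ 0) (M : ℝ≥0∞) {t : ℝ} (ht : 0 ≤ t) (x : S) :
    conv Q (fun _ _ => M) t x ≤ M * ENNReal.ofReal (1 - Real.exp (Q x x * t)) := by
  have h1 : ∀ s : ℝ, ENNReal.ofReal (Real.exp (Q x x * s)) * jump Q (fun _ => M) x ≤
      M * ENNReal.ofReal (-Q x x * Real.exp (Q x x * s)) := by
    intro s
    have h2 := jump_const_mul Q M (fun _ => 1) x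
    simp only [mul_one] at h2
    rw [h2, ENNReal.ofReal_mul (by linarith [hQ0 x])]
    calc _ ≤ ENNReal.ofReal (Real.exp (Q x x * s)) * (M * ENNReal.ofReal (-Q x x)) := by
          gcongr; exact hQ x
      _ = _ := by ring
  unfold conv
  refine (lintegral_mono h1).trans ?_
  rw [lintegral_const_mul _ (by fun_prop),
    setLIntegral_ofReal_of_hasDerivAt (G := fun s => -Real.exp (Q x x * s)) ht]
  · refine le_of_eq ?_
    congr 2
    simp only [mul_zero, Real.exp_zero]
    ring
  · intro s
    have := ((hasDerivAt_id s).const_mul (Q x x)).exp.neg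
    simp only [id, mul_one] at this
    refine this.congr_deriv ?_
    ring
  · fun_prop
  · intro s _ _
    have := hQ0 x
    have := Real.exp_pos (Q x x * s)
    nlinarith

/-- Comparison of a solution of the backward equation with the minimal one. -/
lemma le_semigroup_add [Countable S]
    (hQ : ∀ x, jump Q (fun _ => 1) x ≤ ENNReal.ofReal (-Q x x)) (hQ0 : ∀ x, Q x x ≤ 0)
    {f : S → ℝ≥0∞} {u v : ℝ → S → ℝ≥0∞} {T : ℝ} {F : Set S} (hF : F.Finite) {C : ℝ≥0∞}
    (hC : C ≠ ∞)
    (hu : ∀ t, 0 ≤ t → ∀ x, u t x ≤ ENNReal.ofReal (Real.exp (Q x x * t)) * f x + conv Q u t x)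
    (hv : ∀ t, 0 ≤ t → ∀ x, conv Q v t x ≤ v t x) (hvm : ∀ x, Measurable fun t => v t x)
    (hdom : ∀ t, 0 ≤ t → t ≤ T → ∀ x, x ∉ F → u t x ≤ v t x)
    (hbd : ∀ t, 0 ≤ t → t ≤ T → ∀ x ∈ F, u t x ≤ C)
    {t : ℝ} (ht : 0 ≤ t) (htT : t ≤ T) (x : S) : u t x ≤ semigroup Q t f x + v t x := by
  -- The truncated excess of u satisfies the homogeneous inequality δ ≤ conv δ and vanishes off the
  -- finite set F. The aim is to show that it is zero.
  set δ : ℝ → S → ℝ≥0∞ := fun t x => u t x - (semigroup Q t f x + v t x) with hδ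
  have hδconv : ∀ t, 0 ≤ t → ∀ x, δ t x ≤ conv Q δ t x := by
    intro t ht x
    rw [hδ]
    simp only [tsub_le_iff_left]
    have hm : ∀ x, Measurable fun t => semigroup Q t f x + v t x := fun x =>
      (measurable_semigroup Q f x).add (hvm x)
    calc u t x ≤ ENNReal.ofReal (Real.exp (Q x x * t)) * f x + conv Q u t x := hu t ht x
      _ ≤ ENNReal.ofReal (Real.exp (Q x x * t)) * f x +
          conv Q (fun s z => (semigroup Q s f z + v s z) + δ s z) t x := by
          gcongr
          exact conv_mono Q (fun s _ _ z => le_add_tsub) x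
      _ = (ENNReal.ofReal (Real.exp (Q x x * t)) * f x +
          conv Q (fun s z => semigroup Q s f z) t x) + conv Q v t x + conv Q δ t x := by
          rw [conv_add Q hm, conv_add Q (measurable_semigroup Q f)]
          simp only [add_assoc]
      _ ≤ semigroup Q t f x + v t x + conv Q δ t x := by
          rw [← semigroup_eq]
          gcongr
          exact hv t ht x
  have hoff : ∀ t, 0 ≤ t → t ≤ T → ∀ x, x ∉ F → δ t x = 0 := fun t h0 h1 x hx =>
    tsub_eq_zero_of_le ((hdom t h0 h1 x hx).trans le_add_self)
  set M : ℝ≥0∞ := ⨆ (t : ℝ) (_ : 0 ≤ t ∧ t ≤ T) (x : S), δ t x with hM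
  have hle : ∀ t, 0 ≤ t → t ≤ T → ∀ x, δ t x ≤ M := fun t h0 h1 x =>
    le_iSup_of_le t (le_iSup_of_le ⟨h0, h1⟩ (le_iSup (fun x => δ t x) x))
  have hMC : M ≤ C := by
    refine iSup_le fun t => iSup_le fun h => iSup_le fun x => ?_
    by_cases hx : x ∈ F
    · exact tsub_le_self.trans (hbd t h.1 h.2 x hx)
    · rw [hoff t h.1 h.2 x hx]; exact zero_le
  -- Exit rates are bounded on the finite set F, so the contraction factor is uniformly below one
  -- there, even if Q is unbounded on S.
  obtain ⟨b, hb⟩ : ∃ b : ℝ, ∀ x ∈ F, -b ≤ Q x x := by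
    obtain ⟨b, hb⟩ := (hF.image fun x => -Q x x).bddAbove
    exact ⟨b, fun x hx => by linarith [hb ⟨x, hx, rfl⟩]⟩
  have hT : 0 ≤ T := ht.trans htT
  have hMM : M ≤ M * ENNReal.ofReal (1 - Real.exp (-b * T)) := by
    refine iSup_le fun t => iSup_le fun h => iSup_le fun x => ?_
    by_cases hx : x ∈ F
    · calc δ t x ≤ conv Q δ t x := hδconv t h.1 x
        _ ≤ conv Q (fun _ _ => M) t x :=
          conv_mono Q (fun s h0 h1 z => hle s h0 (h1.trans h.2) z) x
        _ ≤ M * ENNReal.ofReal (1 - Real.exp (Q x x * t)) := conv_const_le Q hQ hQ0 M h.1 x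
        _ ≤ _ := by
          have h3 : -b * T ≤ Q x x * T := mul_le_mul_of_nonneg_right (hb x hx) hT
          have h4 : Q x x * T ≤ Q x x * t := mul_le_mul_of_nonpos_left h.2 (hQ0 x)
          have h5 := Real.exp_le_exp.2 (h3.trans h4)
          gcongr
    · rw [hoff t h.1 h.2 x hx]; exact zero_le
  -- M is finite and bounded by a factor below one times itself.
  have hM0 : M = 0 := by
    by_contra hne
    have hlt : ENNReal.ofReal (1 - Real.exp (-b * T)) < 1 := by
      rw [ENNReal.ofReal_lt_one]
      linarith [Real.exp_pos (-b * T)]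
    have := ENNReal.mul_lt_mul_right hne (ne_top_of_le_ne_top hC hMC) hlt
    rw [mul_one] at this
    exact absurd hMM (not_le.2 this)
  have := hle t ht htT x
  rw [hM0] at this
  exact tsub_eq_zero_iff_le.1 (le_antisymm this zero_le)

/-- A solution of the backward equation dominated by a Lyapunov function is the minimal one. -/
lemma semigroup_eq_of_lyapunov [Countable S]
    (hQ : ∀ x, jump Q (fun _ => 1) x ≤ ENNReal.ofReal (-Q x x)) (hQ0 : ∀ x, Q x x ≤ 0)
    {f : S → ℝ≥0∞} {u v : ℝ → S → ℝ≥0∞}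
    (hu : ∀ t, 0 ≤ t → ∀ x, u t x = ENNReal.ofReal (Real.exp (Q x x * t)) * f x + conv Q u t x)
    (hv : ∀ t, 0 ≤ t → ∀ x, conv Q v t x ≤ v t x) (hvm : ∀ x, Measurable fun t => v t x)
    (hvfin : ∀ t x, v t x ≠ ∞)
    (hdom : ∀ ε : NNReal, 0 < ε →
      ∃ F : Set S, F.Finite ∧ ∀ t, 0 ≤ t → ∀ x, x ∉ F → u t x ≤ ε * v t x)
    (hbd : ∀ x, ∃ C : ℝ≥0∞, C ≠ ∞ ∧ ∀ t, 0 ≤ t → u t x ≤ C)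
    {t : ℝ} (ht : 0 ≤ t) (x : S) : semigroup Q t f x = u t x := by
  refine le_antisymm (semigroup_le Q (fun t ht x => (hu t ht x).ge) ht x) ?_
  -- The comparison is applied with the supersolution ε v, which dominates u off a finite set; then
  -- ε tends to zero.
  have key : ∀ ε : NNReal, 0 < ε → u t x ≤ semigroup Q t f x + ε * v t x := by
    intro ε hε
    obtain ⟨F, hF, hd⟩ := hdom ε hε
    choose C hC hCu using hbd
    have hfin : ∑ y ∈ hF.toFinset, C y ≠ ∞ := ENNReal.sum_ne_top.2 fun y _ => hC y
    refine le_semigroup_add Q hQ hQ0 (v := fun s y => ε * v s y) hF hfin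
      (fun s hs y => (hu s hs y).le) ?_ (fun y => (hvm y).const_mul _)
      (fun s h0 _ y hy => hd s h0 y hy) ?_ ht le_rfl x
    · intro s hs y
      have : conv Q (fun s y => ε * v s y) s y = ε * conv Q v s y := by
        unfold conv
        rw [← lintegral_const_mul _ (measurable_integrand Q hvm s y)]
        refine lintegral_congr fun r => ?_
        rw [jump_const_mul]; ring
      rw [this]
      gcongr
      exact hv s hs y
    · intro s h0 _ y hy
      exact (hCu y s h0).trans (Finset.single_le_sum (f := C) (fun _ _ => zero_le)
        (hF.mem_toFinset.2 hy))
  refine ENNReal.le_of_forall_pos_le_add fun ε hε _ => ?_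
  lift v t x to NNReal using hvfin t x with c hc
  have hc' : 0 < ε / (c + 1) := by positivity
  refine (key _ hc').trans ?_
  gcongr
  rw [← ENNReal.coe_mul, ENNReal.coe_le_coe, div_mul_eq_mul_div]
  refine div_le_of_le_mul₀ (by positivity) (by positivity) ?_
  gcongr
  exact le_self_add

lemma semigroup_add_fun (t : ℝ) (f g : S → ℝ≥0∞) (x : S) :
    semigroup Q t (fun y => f y + g y) x = semigroup Q t f x + semigroup Q t g x := by
  unfold semigroup
  rw [← ENNReal.tsum_add]
  exact tsum_congr fun y => by ring

/-- The shifted function t ↦ `semigroup Q (t + s) f` solves the backward equation with initial datum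
`semigroup Q s f`, so it lies above the minimal solution. To see this the convolution over (0, t +
s] is cut at t; the far piece is a translate of the convolution at time s. -/
lemma semigroup_semigroup_le [Countable S] (f : S → ℝ≥0∞) {s t : ℝ} (hs : 0 ≤ s) (ht : 0 ≤ t)
    (x : S) : semigroup Q t (semigroup Q s f) x ≤ semigroup Q (t + s) f x := by
  refine semigroup_le Q (u := fun t => semigroup Q (t + s) f) ?_ ht x
  intro t ht x
  rw [semigroup_eq Q (t + s)]
  have h1 : conv Q (fun r => semigroup Q r f) (t + s) x =
      conv Q (fun r => semigroup Q (r + s) f) t x +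
      ENNReal.ofReal (Real.exp (Q x x * t)) * conv Q (fun r => semigroup Q r f) s x := by
    unfold conv
    rw [← Set.Ioc_union_Ioc_eq_Ioc ht (by linarith : t ≤ t + s),
      lintegral_union measurableSet_Ioc (Set.Ioc_disjoint_Ioc_of_le le_rfl)]
    congr 1
    · refine lintegral_congr fun r => ?_
      rw [show t + s - r = t - r + s by ring]
    · rw [← lintegral_const_mul _ (measurable_integrand Q (measurable_semigroup Q f) s x),
        ← lintegral_indicator measurableSet_Ioc, ← lintegral_indicator measurableSet_Ioc,
        ← lintegral_add_right_eq_self _ t]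
      refine lintegral_congr fun r => ?_
      by_cases hr : r ∈ Set.Ioc 0 s
      · have hr' : r + t ∈ Set.Ioc t (t + s) := ⟨by linarith [hr.1], by linarith [hr.2]⟩
        rw [Set.indicator_of_mem hr, Set.indicator_of_mem hr', mul_add, Real.exp_add,
          ENNReal.ofReal_mul (Real.exp_pos _).le, show t + s - (r + t) = s - r by ring]
        ring
      · have hr' : r + t ∉ Set.Ioc t (t + s) := fun h =>
          hr ⟨by linarith [h.1], by linarith [h.2]⟩
        rw [Set.indicator_of_notMem hr, Set.indicator_of_notMem hr']
  rw [h1, semigroup_eq Q s f x, mul_add (ENNReal.ofReal _), mul_add (Q x x), Real.exp_add,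
    ENNReal.ofReal_mul (Real.exp_pos _).le]
  refine le_of_eq ?_
  ring

/-- The Chapman-Kolmogorov equation. -/
lemma semigroup_semigroup [Countable S]
    (h1 : ∀ t, 0 ≤ t → ∀ x, semigroup Q t (fun _ => 1) x = 1)
    {f : S → ℝ≥0∞} (hf : ∀ x, f x ≤ 1) {s t : ℝ} (hs : 0 ≤ s) (ht : 0 ≤ t)
    (x : S) : semigroup Q t (semigroup Q s f) x = semigroup Q (t + s) f x := by
  refine le_antisymm (semigroup_semigroup_le Q f hs ht x) ?_
  -- One inequality is known for f and for 1 - f. By conservation of mass both pairs of sides add up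
  -- to one, so neither inequality can be strict.
  have hsplit : (fun y => f y + (1 - f y)) = fun _ => 1 := by
    ext y; exact add_tsub_cancel_of_le (hf y)
  have hA : semigroup Q t (semigroup Q s f) x +
      semigroup Q t (semigroup Q s fun y => 1 - f y) x = 1 := by
    rw [← semigroup_add_fun]
    simp_rw [← semigroup_add_fun, hsplit, h1 s hs]
    exact h1 t ht x
  have hB : semigroup Q (t + s) f x + semigroup Q (t + s) (fun y => 1 - f y) x = 1 := by
    rw [← semigroup_add_fun, hsplit, h1 _ (add_nonneg ht hs)]
  have hle := semigroup_semigroup_le Q (fun y => 1 - f y) hs ht x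
  have hfin : semigroup Q (t + s) (fun y => 1 - f y) x ≠ ∞ :=
    ne_top_of_le_ne_top ENNReal.one_ne_top (le_add_self.trans hB.le)
  refine (ENNReal.add_le_add_iff_right hfin).1 ?_
  refine (hB.trans hA.symm).le.trans ?_
  gcongr

lemma semigroup_pos_of_ne_zero [Countable S] {f : S → ℝ≥0∞} {x : S} (hx : f x ≠ 0) (t : ℝ) :
    0 < semigroup Q t f x := by
  rw [semigroup_eq]
  refine lt_of_lt_of_le ?_ le_self_add
  exact ENNReal.mul_pos (by simpa using Real.exp_pos _) hx

/-- Wait at x until any time s < t, jump to z, and continue from there: the integrand of the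
backward equation is positive on all of (0, t). -/
lemma semigroup_pos_of_step [Countable S] {f : S → ℝ≥0∞} {x z : S} (hne : z ≠ x)
    (hxz : 0 < Q x z) (hz : ∀ t, 0 < t → 0 < semigroup Q t f z) {t : ℝ} (ht : 0 < t) :
    0 < semigroup Q t f x := by
  classical
  rw [semigroup_eq]
  refine lt_of_lt_of_le ?_ le_add_self
  unfold conv
  rw [setLIntegral_pos_iff (measurable_integrand Q (measurable_semigroup Q f) t x)]
  refine lt_of_lt_of_le ?_ (measure_mono (?_ : Set.Ioo 0 t ⊆ _))
  · simpa using ht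
  · intro s hs
    refine ⟨?_, hs.1, hs.2.le⟩
    rw [Function.mem_support, ← pos_iff_ne_zero]
    refine ENNReal.mul_pos (by simpa using Real.exp_pos _) ?_
    rw [← pos_iff_ne_zero]
    unfold jump
    refine lt_of_lt_of_le ?_ (ENNReal.le_tsum z)
    rw [if_neg hne]
    exact ENNReal.mul_pos (by simpa using hxz) (hz _ (by linarith [hs.2])).ne'

end FellerChain

/-! ### Jump processes given by finitely many moves -/

namespace FellerChain

variable {S M : Type*} [Fintype M]

/-- The generator of the jump process which, at `x`, makes the move `T m` at rate `r m x`. -/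
def gen (r : M → S → ℝ) (T : M → S → S) (f : S → ℝ) (x : S) : ℝ :=
  ∑ m, r m x * (f (T m x) - f x)

section JumpSystem

variable {r : M → S → ℝ} {T : M → S → S} {Q : S → S → ℝ}

open Classical in
/-- `Q` is the rate matrix of the jump process with moves `T` at rates `r`. -/
def IsRateMatrix (r : M → S → ℝ) (T : M → S → S) (Q : S → S → ℝ) : Prop :=
  ∀ x z, Q x z = gen r T (fun y => if y = z then 1 else 0) x

lemma IsRateMatrix.diag_nonpos (h : IsRateMatrix r T Q) (hr : ∀ m x, 0 ≤ r m x) (x : S) :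
    Q x x ≤ 0 := by
  rw [h, gen]
  refine Finset.sum_nonpos fun m _ => mul_nonpos_of_nonneg_of_nonpos (hr m x) ?_
  simp only [if_true]
  split_ifs <;> norm_num

open Classical in
lemma IsRateMatrix.offDiag (h : IsRateMatrix r T Q) {x z : S} (hz : z ≠ x) :
    Q x z = ∑ m, if T m x = z then r m x else 0 := by
  rw [h, gen]
  refine Finset.sum_congr rfl fun m _ => ?_
  simp [hz.symm]

lemma IsRateMatrix.pos (h : IsRateMatrix r T Q) (hr : ∀ m x, 0 ≤ r m x) {x : S} {m : M}
    (hne : T m x ≠ x) (hm : 0 < r m x) : 0 < Q x (T m x) := by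
  classical
  rw [h.offDiag hne]
  refine Finset.sum_pos' (fun n _ => ?_) ⟨m, Finset.mem_univ _, by simpa using hm⟩
  split_ifs
  · exact hr n x
  · exact le_rfl

-- Moves that fix x contribute neither to the generator nor to `Q x x`; removing the diagonal leaves
-- the gain terms only.
open Classical in
lemma IsRateMatrix.gen_sub (h : IsRateMatrix r T Q) (f : S → ℝ) (x : S) :
    gen r T f x - Q x x * f x = ∑ m, if T m x = x then 0 else r m x * f (T m x) := by
  rw [h, gen, gen, Finset.sum_mul, ← Finset.sum_sub_distrib]
  refine Finset.sum_congr rfl fun m _ => ?_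
  by_cases hm : T m x = x
  · simp [hm]
  · simp [hm]; ring

/-- The link between the extended nonnegative calculus of `jump` and the real generator: the sum
over targets is regrouped by moves, several of which may share a target. -/
lemma IsRateMatrix.jump_ofReal (h : IsRateMatrix r T Q) (hr : ∀ m x, 0 ≤ r m x) {f : S → ℝ}
    (hf : ∀ x, 0 ≤ f x) (x : S) :
    jump Q (fun z => ENNReal.ofReal (f z)) x = ENNReal.ofReal (gen r T f x - Q x x * f x) := by
  classical
  rw [h.gen_sub, ENNReal.ofReal_sum_of_nonneg]
  swap
  · intro m _
    split_ifs
    · exact le_rfl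
    · exact mul_nonneg (hr m x) (hf _)
  unfold jump
  have h1 : ∀ z, (if z = x then 0 else ENNReal.ofReal (Q x z) * ENNReal.ofReal (f z)) =
      ∑ m, if T m x = z then
        (if z = x then 0 else ENNReal.ofReal (r m x) * ENNReal.ofReal (f z)) else 0 := by
    intro z
    by_cases hz : z = x
    · simp [hz]
    · rw [if_neg hz, h.offDiag hz, ENNReal.ofReal_sum_of_nonneg, Finset.sum_mul]
      · refine Finset.sum_congr rfl fun m _ => ?_
        by_cases hm : T m x = z
        · simp [hm, hz]
        · simp [hm]
      · intro m _
        split_ifs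
        · exact hr m x
        · exact le_rfl
  simp_rw [h1]
  rw [Summable.tsum_finsetSum fun _ _ => ENNReal.summable]
  refine Finset.sum_congr rfl fun m _ => ?_
  rw [tsum_eq_single (T m x)]
  · rw [if_pos rfl]
    split_ifs
    · simp
    · rw [ENNReal.ofReal_mul (hr m x)]
  · intro z hz; rw [if_neg (Ne.symm hz)]

lemma IsRateMatrix.jump_one (h : IsRateMatrix r T Q) (hr : ∀ m x, 0 ≤ r m x) (x : S) :
    jump Q (fun _ => 1) x = ENNReal.ofReal (-Q x x) := by
  have := h.jump_ofReal hr (f := fun _ => 1) (fun _ => zero_le_one) x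
  simpa [gen] using this

lemma IsRateMatrix.gen_sub_nonneg (h : IsRateMatrix r T Q) (hr : ∀ m x, 0 ≤ r m x) {f : S → ℝ}
    (hf : ∀ x, 0 ≤ f x) (x : S) : 0 ≤ gen r T f x - Q x x * f x := by
  classical
  rw [h.gen_sub]
  refine Finset.sum_nonneg fun m _ => ?_
  split_ifs
  · exact le_rfl
  · exact mul_nonneg (hr m x) (hf _)

/-- Variation of constants: -exp(q s) u(t - s) is a primitive of the integrand. The sign condition
lets the identity be read in the extended nonnegative reals. -/
lemma setLIntegral_variation {q t : ℝ} (ht : 0 ≤ t) {u u' : ℝ → ℝ}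
    (hu : ∀ s, HasDerivAt u (u' s) s) (hc : Continuous u')
    (hpos : ∀ s, 0 ≤ s → 0 ≤ u' s - q * u s) (hu0 : 0 ≤ u 0) :
    ENNReal.ofReal (Real.exp (q * t) * u 0) +
      ∫⁻ s in Set.Ioc 0 t, ENNReal.ofReal (Real.exp (q * s) * (u' (t - s) - q * u (t - s))) =
    ENNReal.ofReal (u t) := by
  have hder : ∀ s, HasDerivAt (fun s => -(Real.exp (q * s) * u (t - s)))
      (Real.exp (q * s) * (u' (t - s) - q * u (t - s))) s := by
    intro s
    have h1 : HasDerivAt (fun s => Real.exp (q * s)) (Real.exp (q * s) * (q * 1)) s :=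
      ((hasDerivAt_id s).const_mul q).exp
    have h2 : HasDerivAt (fun s => u (t - s)) (-u' (t - s)) s := by
      simpa using (hu (t - s)).comp_const_sub t s
    refine (h1.mul h2).neg.congr_deriv ?_
    ring
  have hcu : Continuous u := continuous_iff_continuousAt.2 fun s => (hu s).continuousAt
  have hcont : Continuous fun s => Real.exp (q * s) * (u' (t - s) - q * u (t - s)) := by
    fun_prop
  have hnn : ∀ s, 0 < s → s ≤ t → 0 ≤ Real.exp (q * s) * (u' (t - s) - q * u (t - s)) :=
    fun s _ hs => mul_nonneg (Real.exp_pos _).le (hpos _ (by linarith))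
  have hint := intervalIntegral.integral_eq_sub_of_hasDerivAt (fun s _ => hder s)
    (hcont.intervalIntegrable 0 t)
  have hge : 0 ≤ ∫ s in (0 : ℝ)..t, Real.exp (q * s) * (u' (t - s) - q * u (t - s)) :=
    intervalIntegral.integral_nonneg ht fun s hs =>
      mul_nonneg (Real.exp_pos _).le (hpos _ (by linarith [hs.2]))
  rw [setLIntegral_ofReal_of_hasDerivAt ht hder hcont hnn, ← ENNReal.ofReal_add]
  · simp
  · exact mul_nonneg (Real.exp_pos _).le hu0
  · rw [← hint]; exact hge

/-- A classical supersolution of the backward equation is an integral supersolution. -/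
lemma IsRateMatrix.supersolution (h : IsRateMatrix r T Q) (hr : ∀ m x, 0 ≤ r m x)
    {u u' : ℝ → S → ℝ} (hu : ∀ t x, HasDerivAt (fun t => u t x) (u' t x) t)
    (hc : ∀ x, Continuous fun t => u' t x) (hpos : ∀ t, 0 ≤ t → ∀ x, 0 ≤ u t x)
    (hsup : ∀ t, 0 ≤ t → ∀ x, gen r T (u t) x ≤ u' t x) {t : ℝ} (ht : 0 ≤ t) (x : S) :
    ENNReal.ofReal (Real.exp (Q x x * t)) * ENNReal.ofReal (u 0 x) +
      conv Q (fun s z => ENNReal.ofReal (u s z)) t x ≤ ENNReal.ofReal (u t x) := by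
  rw [← setLIntegral_variation (q := Q x x) ht (fun s => hu s x) (hc x)
    (fun s hs => (h.gen_sub_nonneg hr (hpos s hs) x).trans (by linarith [hsup s hs x]))
    (hpos 0 le_rfl x), ENNReal.ofReal_mul (Real.exp_pos _).le]
  gcongr
  refine setLIntegral_mono' measurableSet_Ioc fun s hs => ?_
  have hs' : 0 ≤ t - s := by linarith [hs.2]
  rw [ENNReal.ofReal_mul (Real.exp_pos _).le, h.jump_ofReal hr (hpos _ hs')]
  gcongr
  exact hsup _ hs' x

/-- A classical solution of the backward equation is an integral solution. -/
lemma IsRateMatrix.solution (h : IsRateMatrix r T Q) (hr : ∀ m x, 0 ≤ r m x)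
    {u u' : ℝ → S → ℝ} (hu : ∀ t x, HasDerivAt (fun t => u t x) (u' t x) t)
    (hc : ∀ x, Continuous fun t => u' t x) (hpos : ∀ t, 0 ≤ t → ∀ x, 0 ≤ u t x)
    (hsol : ∀ t, 0 ≤ t → ∀ x, u' t x = gen r T (u t) x) {t : ℝ} (ht : 0 ≤ t) (x : S) :
    ENNReal.ofReal (u t x) = ENNReal.ofReal (Real.exp (Q x x * t)) * ENNReal.ofReal (u 0 x) +
      conv Q (fun s z => ENNReal.ofReal (u s z)) t x := by
  rw [← setLIntegral_variation (q := Q x x) ht (fun s => hu s x) (hc x)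
    (fun s hs => (h.gen_sub_nonneg hr (hpos s hs) x).trans (by rw [hsol s hs x]))
    (hpos 0 le_rfl x), ENNReal.ofReal_mul (Real.exp_pos _).le]
  congr 1
  refine setLIntegral_congr_fun measurableSet_Ioc fun s hs => ?_
  have hs' : 0 ≤ t - s := by linarith [hs.2]
  dsimp only
  rw [ENNReal.ofReal_mul (Real.exp_pos _).le, h.jump_ofReal hr (hpos _ hs'), hsol _ hs' x]

end JumpSystem

/-! ### Semigroups of finite jump systems -/

section Finite

variable {ι : Type*} [Fintype ι]

/-- The generator of a finite jump system as a continuous linear map. -/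
noncomputable def genL (r : M → ι → ℝ) (T : M → ι → ι) : (ι → ℝ) →L[ℝ] (ι → ℝ) :=
  LinearMap.toContinuousLinearMap
    { toFun := gen r T
      map_add' := fun f g => by
        ext x
        simp only [gen, Pi.add_apply, ← Finset.sum_add_distrib]
        exact Finset.sum_congr rfl fun m _ => by ring
      map_smul' := fun c f => by
        ext x
        simp only [gen, Pi.smul_apply, smul_eq_mul, RingHom.id_apply, Finset.mul_sum]
        exact Finset.sum_congr rfl fun m _ => by ring }

variable (r : M → ι → ℝ) (T : M → ι → ι)

lemma genL_apply (f : ι → ℝ) (x : ι) : genL r T f x = gen r T f x := rfl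

/-- The semigroup of a finite jump system. -/
noncomputable def heat (t : ℝ) : (ι → ℝ) →L[ℝ] (ι → ℝ) := NormedSpace.exp (t • genL r T)

lemma heat_zero (f : ι → ℝ) : heat r T 0 f = f := by
  simp [heat]

lemma hasDerivAt_heat (f : ι → ℝ) (t : ℝ) (x : ι) :
    HasDerivAt (fun t => heat r T t f x) (gen r T (heat r T t f) x) t := by
  have h := hasDerivAt_exp_smul_const' (𝕂 := ℝ) (genL r T) t
  have h2 := (h.clm_apply (hasDerivAt_const t f))
  have h3 := (hasDerivAt_pi.1 h2) x
  simpa [heat, genL_apply] using h3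

lemma hasDerivAt_heat' (f : ι → ℝ) (t : ℝ) (x : ι) :
    HasDerivAt (fun t => heat r T t f x) (heat r T t (gen r T f) x) t := by
  have h := hasDerivAt_exp_smul_const (𝕂 := ℝ) (genL r T) t
  have h2 := (h.clm_apply (hasDerivAt_const t f))
  have h3 := (hasDerivAt_pi.1 h2) x
  refine h3.congr_deriv ?_
  rw [map_zero, add_zero]
  rfl

lemma continuous_heat (f : ι → ℝ) (x : ι) : Continuous fun t => heat r T t f x :=
  continuous_iff_continuousAt.2 fun t => (hasDerivAt_heat r T f t x).continuousAt

lemma heat_of_gen_eq_zero {f : ι → ℝ} (hf : gen r T f = 0) (t : ℝ) : heat r T t f = f := by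
  ext x
  have h : ∀ s, HasDerivAt (fun t => heat r T t f x) 0 s := fun s => by
    simpa [hf] using hasDerivAt_heat' r T f s x
  have := is_const_of_deriv_eq_zero (fun s => (h s).differentiableAt) (fun s => (h s).deriv) t 0
  simpa [heat_zero] using this

variable {r}

/-- Adding c times the identity, with c above every exit rate, makes the generator preserve
nonnegative functions. So do its powers and its exponential, and the shift only costs the scalar
exp(-tc). -/
lemma heat_nonneg (hr : ∀ m x, 0 ≤ r m x) {f : ι → ℝ} (hf : ∀ x, 0 ≤ f x) {t : ℝ} (ht : 0 ≤ t)
    (x : ι) : 0 ≤ heat r T t f x := by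
  set c : ℝ := ∑ m, ∑ y, r m y with hc
  set B : (ι → ℝ) →L[ℝ] (ι → ℝ) := genL r T + c • 1 with hB
  have hBpos : ∀ g : ι → ℝ, (∀ x, 0 ≤ g x) → ∀ x, 0 ≤ B g x := by
    intro g hg x
    have h1 : B g x = ∑ m, r m x * g (T m x) + (c - ∑ m, r m x) * g x := by
      simp only [hB, _root_.add_apply, Pi.add_apply, genL_apply, gen,
        _root_.smul_apply, Pi.smul_apply, smul_eq_mul,
        one_apply_eq_self, mul_sub, Finset.sum_sub_distrib, ← Finset.sum_mul]
      ring
    rw [h1]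
    refine add_nonneg (Finset.sum_nonneg fun m _ => mul_nonneg (hr m x) (hg _))
      (mul_nonneg (sub_nonneg.2 ?_) (hg x))
    exact Finset.sum_le_sum fun m _ =>
      Finset.single_le_sum (fun y _ => hr m y) (Finset.mem_univ x)
  have hpow : ∀ n : ℕ, ∀ x, 0 ≤ (B ^ n) f x := by
    intro n
    induction n with
    | zero => simpa using hf
    | succ n ih =>
      intro x
      rw [pow_succ']
      exact hBpos _ ih x
  have hexp : 0 ≤ NormedSpace.exp (t • B) f x := by
    have h1 := NormedSpace.exp_series_hasSum_exp' (𝕂 := ℝ) (t • B)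
    have h2 := h1.mapL (ContinuousLinearMap.apply ℝ (ι → ℝ) f)
    have h3 := (Pi.hasSum.1 h2) x
    refine h3.nonneg fun n => ?_
    simp only [ContinuousLinearMap.apply_apply, _root_.smul_apply, smul_pow,
      Pi.smul_apply, smul_eq_mul]
    have := hpow n x
    positivity
  have hsplit : t • genL r T = t • B + algebraMap ℝ _ (-(t * c)) := by
    rw [hB, Algebra.algebraMap_eq_smul_one, smul_add, smul_smul, neg_smul]
    abel
  let _ : NormedAlgebra ℚ ((ι → ℝ) →L[ℝ] (ι → ℝ)) := NormedAlgebra.restrictScalars ℚ ℝ _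
  rw [heat, hsplit, NormedSpace.exp_add_of_commute (Algebra.commutes _ _).symm,
    ← NormedSpace.algebraMap_exp_comm, Algebra.algebraMap_eq_smul_one, mul_smul_comm, mul_one,
    _root_.smul_apply, Pi.smul_apply, smul_eq_mul, ← Real.exp_eq_exp_ℝ]
  exact mul_nonneg (Real.exp_pos _).le hexp

/-- Constants are fixed by the semigroup, so positivity applies to C - f. -/
lemma heat_le (hr : ∀ m x, 0 ≤ r m x) {f : ι → ℝ} {C : ℝ} (hf : ∀ x, f x ≤ C) {t : ℝ}
    (ht : 0 ≤ t) (x : ι) : heat r T t f x ≤ C := by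
  have h0 : gen r T (fun _ => C) = 0 := by ext x; simp [gen]
  have h1 := heat_nonneg T hr (f := (fun _ => C) - f) (fun x => sub_nonneg.2 (hf x)) ht x
  rw [map_sub, heat_of_gen_eq_zero r T h0] at h1
  simpa using h1

/-- The integrating factor absorbs the loss term. For f ≥ 0 only nonnegative gain terms remain,
which yields the monotonicity behind the next two lemmas. -/
lemma hasDerivAt_exp_mul_heat (f : ι → ℝ) (t : ℝ) (x : ι) :
    HasDerivAt (fun t => Real.exp ((∑ m, r m x) * t) * heat r T t f x)
      (Real.exp ((∑ m, r m x) * t) * ∑ m, r m x * heat r T t f (T m x)) t := by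
  have h1 : HasDerivAt (fun t => Real.exp ((∑ m, r m x) * t))
      (Real.exp ((∑ m, r m x) * t) * ((∑ m, r m x) * 1)) t :=
    ((hasDerivAt_id t).const_mul _).exp
  refine (h1.mul (hasDerivAt_heat r T f t x)).congr_deriv ?_
  simp only [gen, mul_sub, Finset.sum_sub_distrib, ← Finset.sum_mul]
  ring

lemma heat_pos_of_pos (hr : ∀ m x, 0 ≤ r m x) {f : ι → ℝ} (hf : ∀ x, 0 ≤ f x) {x : ι}
    (hx : 0 < f x) {t : ℝ} (ht : 0 ≤ t) : 0 < heat r T t f x := by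
  have hmono : MonotoneOn (fun t => Real.exp ((∑ m, r m x) * t) * heat r T t f x)
      (Set.Ici 0) := by
    refine monotoneOn_of_deriv_nonneg (convex_Ici 0)
      (fun s _ => (hasDerivAt_exp_mul_heat T f s x).continuousAt.continuousWithinAt)
      (fun s _ => (hasDerivAt_exp_mul_heat T f s x).differentiableAt.differentiableWithinAt)
      fun s hs => ?_
    rw [interior_Ici] at hs
    rw [(hasDerivAt_exp_mul_heat T f s x).deriv]
    exact mul_nonneg (Real.exp_pos _).le (Finset.sum_nonneg fun m _ =>
      mul_nonneg (hr m x) (heat_nonneg T hr hf (le_of_lt hs) _))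
  have h := hmono (Set.mem_Ici.2 le_rfl) (Set.mem_Ici.2 ht) ht
  simp only [mul_zero, Real.exp_zero, one_mul, heat_zero] at h
  exact pos_of_mul_pos_right (hx.trans_le h) (Real.exp_pos _).le

lemma heat_pos_of_step (hr : ∀ m x, 0 ≤ r m x) {f : ι → ℝ} (hf : ∀ x, 0 ≤ f x) {x : ι} {m : M}
    (hm : 0 < r m x) (h : ∀ t, 0 < t → 0 < heat r T t f (T m x)) {t : ℝ} (ht : 0 < t) :
    0 < heat r T t f x := by
  have hmono : StrictMonoOn (fun t => Real.exp ((∑ m, r m x) * t) * heat r T t f x)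
      (Set.Ici 0) := by
    refine strictMonoOn_of_deriv_pos (convex_Ici 0)
      (fun s _ => (hasDerivAt_exp_mul_heat T f s x).continuousAt.continuousWithinAt)
      fun s hs => ?_
    rw [interior_Ici] at hs
    rw [(hasDerivAt_exp_mul_heat T f s x).deriv]
    refine mul_pos (Real.exp_pos _) (Finset.sum_pos' (fun n _ =>
      mul_nonneg (hr n x) (heat_nonneg T hr hf (le_of_lt hs) _))
      ⟨m, Finset.mem_univ _, mul_pos hm (h s hs)⟩)
  have h := hmono (Set.mem_Ici.2 le_rfl) (Set.mem_Ici.2 ht.le) ht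
  simp only [mul_zero, Real.exp_zero, one_mul, heat_zero] at h
  exact pos_of_mul_pos_right ((hf x).trans_lt h) (Real.exp_pos _).le

end Finite

end FellerChain

/-! ### Single-site relations and duality on one bond or reservoir -/

namespace BoundaryDriven

open FellerChain

variable (P : BoundaryDriven)

section Raw

variable {P}

lemma add_same (η : Fin P.N → ℕ) (x : Fin P.N) : P.add η x x = η x + 1 := by simp [add]

lemma add_of_ne (η : Fin P.N → ℕ) {x y : Fin P.N} (h : y ≠ x) : P.add η x y = η y := by
  simp [add, h]

lemma remove_same (η : Fin P.N → ℕ) (x : Fin P.N) : P.remove η x x = η x - 1 := by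
  simp [remove]

lemma remove_of_ne (η : Fin P.N → ℕ) {x y : Fin P.N} (h : y ≠ x) : P.remove η x y = η y := by
  simp [remove, h]

lemma remove_le (η : Fin P.N → ℕ) (x y : Fin P.N) : P.remove η x y ≤ η y := by
  simp [remove]

lemma sum_add (η : Fin P.N → ℕ) (x : Fin P.N) : ∑ z, P.add η x z = ∑ z, η z + 1 := by
  simp [add, Finset.sum_add_distrib]

lemma sum_remove (η : Fin P.N → ℕ) {x : Fin P.N} (h : 0 < η x) :
    ∑ z, P.remove η x z + 1 = ∑ z, η z := by
  have h1 : P.add (P.remove η x) x = η := by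
    ext z
    by_cases hz : z = x
    · subst hz; rw [add_same, remove_same]; omega
    · rw [add_of_ne _ hz, remove_of_ne _ hz]
  rw [← sum_add, h1]

lemma prod_pair_erase {x y : Fin P.N} (h : x ≠ y) (f : Fin P.N → ℝ) :
    ∏ z, f z = f x * f y * ∏ z ∈ (Finset.univ.erase x).erase y, f z := by
  rw [mul_assoc, Finset.mul_prod_erase _ _ (by simp [h.symm]),
    Finset.mul_prod_erase _ _ (Finset.mem_univ _)]

end Raw

/-- Particle numbers allowed at `x`. -/
def Allowed (x : Fin P.N) (k : ℕ) : Prop := P.σ = -1 → k ≤ P.α x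

/-- The single site factor of the duality function. -/
noncomputable def factor (x : Fin P.N) (k n : ℕ) : ℝ := (n.descFactorial k : ℝ) / P.w x k

variable {P}

lemma sigma_eq (hσ : P.σ = -1 ∨ P.σ = 1) :
    (P.σ = -1 ∧ (P.σ : ℝ) = -1) ∨ (P.σ = 1 ∧ (P.σ : ℝ) = 1) := by
  rcases hσ with h | h <;> simp [h]

lemma w_zero (x : Fin P.N) : P.w x 0 = 1 := by simp [w]

lemma w_succ (hσ : P.σ = -1 ∨ P.σ = 1) (x : Fin P.N) (k : ℕ) :
    P.w x (k + 1) = P.w x k * (P.α x + (P.σ : ℝ) * k) := by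
  rcases hσ with h | h
  · simp only [w, h, if_true]
    rw [Nat.descFactorial_succ]
    rcases le_or_gt k (P.α x) with hk | hk
    · push_cast [Nat.cast_sub hk, SignType.coe_neg]
      simp only [SignType.coe_one]
      ring
    · rw [Nat.descFactorial_of_lt hk]; simp
  · have h1 : (1 : SignType) ≠ -1 := by decide
    have h2 : (1 : SignType) ≠ 0 := by decide
    simp only [w, h, if_neg h1, if_neg h2, Nat.ascFactorial_succ, SignType.coe_one]
    push_cast
    ring

lemma w_nonneg (x : Fin P.N) (k : ℕ) : 0 ≤ P.w x k := by
  unfold w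
  split_ifs <;> positivity

lemma w_pos {x : Fin P.N} {k : ℕ} (hk : P.Allowed x k) : 0 < P.w x k := by
  have := P.α_pos x
  unfold w
  split_ifs with h1 h2
  · exact_mod_cast Nat.pos_of_ne_zero fun h => by
      rw [Nat.descFactorial_eq_zero_iff_lt] at h
      exact absurd (hk h1) (not_le.2 h)
  · positivity
  · obtain ⟨a, ha⟩ := Nat.exists_eq_succ_of_ne_zero this.ne'
    rw [ha]
    exact_mod_cast Nat.ascFactorial_pos a k

lemma factor_nonneg (x : Fin P.N) (k n : ℕ) : 0 ≤ P.factor x k n :=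
  div_nonneg (Nat.cast_nonneg _) (w_nonneg x k)

lemma factor_zero (x : Fin P.N) (n : ℕ) : P.factor x 0 n = 1 := by simp [factor, w_zero]

lemma factor_one (hσ : P.σ = -1 ∨ P.σ = 1) (x : Fin P.N) (n : ℕ) :
    P.factor x 1 n = n / P.α x := by
  have := w_succ hσ x 0
  simp only [zero_add, w_zero] at this
  simp [factor, this]

lemma cast_descFactorial_succ (n k : ℕ) :
    ((n.descFactorial (k + 1) : ℕ) : ℝ) = (n - k) * n.descFactorial k := by
  rw [Nat.descFactorial_succ]
  rcases le_or_gt k n with h | h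
  · push_cast [Nat.cast_sub h]; ring
  · rw [Nat.descFactorial_of_lt h]; simp

/-- This and the next two lemmas are the one-site relations that carry duality: removing a particle,
adding a dual particle, adding a particle. All are identities between falling factorials. -/
lemma mul_factor_pred (x : Fin P.N) (k n : ℕ) :
    n * P.factor x k (n - 1) = (n - k) * P.factor x k n := by
  unfold factor
  rw [← mul_div_assoc, ← mul_div_assoc, ← cast_descFactorial_succ]
  congr 1
  cases n with
  | zero => simp
  | succ n => rw [Nat.succ_descFactorial_succ]; push_cast; simp

lemma mul_factor_succ_left (hσ : P.σ = -1 ∨ P.σ = 1) {x : Fin P.N} {k n : ℕ}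
    (hn : P.Allowed x n) :
    (P.α x + (P.σ : ℝ) * k) * P.factor x (k + 1) n = (n - k) * P.factor x k n := by
  unfold factor
  rw [cast_descFactorial_succ, w_succ hσ]
  -- The degenerate case is a full dual site, possible only for exclusion. The left side then
  -- vanishes, and n ≤ α_x makes the right side vanish as well.
  by_cases h : (P.α x + (P.σ : ℝ) * k : ℝ) = 0
  · rw [h]
    rcases sigma_eq hσ with ⟨h1, h2⟩ | ⟨h1, h2⟩
    · rw [h2] at h
      have hk : P.α x = k := by
        have : (P.α x : ℝ) = k := by linarith
        exact_mod_cast this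
      have hnk := hn h1
      rcases hnk.eq_or_lt with h3 | h3
      · simp [h3, hk]
      · rw [Nat.descFactorial_of_lt (by omega : n < k)]; simp
    · rw [h2] at h
      have := P.α_pos x
      have : (0 : ℝ) < P.α x := by exact_mod_cast this
      have : (0 : ℝ) ≤ k := Nat.cast_nonneg k
      linarith
  · rw [mul_comm (P.w x k), ← div_div, mul_div_assoc', mul_div_assoc', mul_div_assoc']
    congr 1
    field_simp

lemma mul_factor_succ_right (hσ : P.σ = -1 ∨ P.σ = 1) {x : Fin P.N} {k : ℕ} (n : ℕ)
    (hk : P.Allowed x k) :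
    (P.α x + (P.σ : ℝ) * n) * P.factor x k (n + 1) =
      (P.α x + (P.σ : ℝ) * (n + k)) * P.factor x k n + k * P.factor x (k - 1) n := by
  cases k with
  | zero => simp [factor_zero]
  | succ k =>
    have hw := w_pos hk
    have hs := w_succ hσ x k
    have hw' : P.w x k ≠ 0 := fun h => by rw [hs, h, zero_mul] at hw; exact hw.false
    have ha : (P.α x + (P.σ : ℝ) * k : ℝ) ≠ 0 := fun h => by
      rw [hs, h, mul_zero] at hw; exact hw.false
    unfold factor
    rw [Nat.succ_descFactorial_succ, cast_descFactorial_succ, hs]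
    push_cast
    field_simp
    ring

/-- The bulk part of the duality function. -/
noncomputable def bulkDual (P : BoundaryDriven) (k n : Fin P.N → ℕ) : ℝ :=
  ∏ x, P.factor x (k x) (n x)

lemma prod_shift_right {x y : Fin P.N} (h : x ≠ y) (k n : Fin P.N → ℕ) :
    P.bulkDual k (P.add (P.remove n x) y) = P.factor x (k x) (n x - 1) *
      P.factor y (k y) (n y + 1) *
        ∏ z ∈ (Finset.univ.erase x).erase y, P.factor z (k z) (n z) := by
  rw [bulkDual, prod_pair_erase h, add_of_ne _ h, remove_same, add_same, remove_of_ne _ h.symm]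
  congr 1
  refine Finset.prod_congr rfl fun z hz => ?_
  simp only [Finset.mem_erase] at hz
  rw [add_of_ne _ hz.1, remove_of_ne _ hz.2.1]

lemma prod_shift_left {x y : Fin P.N} (h : x ≠ y) (k n : Fin P.N → ℕ) :
    P.bulkDual (P.add (P.remove k x) y) n = P.factor x (k x - 1) (n x) *
      P.factor y (k y + 1) (n y) *
        ∏ z ∈ (Finset.univ.erase x).erase y, P.factor z (k z) (n z) := by
  rw [bulkDual, prod_pair_erase h, add_of_ne _ h, remove_same, add_same, remove_of_ne _ h.symm]
  congr 1
  refine Finset.prod_congr rfl fun z hz => ?_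
  simp only [Finset.mem_erase] at hz
  rw [add_of_ne _ hz.1, remove_of_ne _ hz.2.1]

/-- Duality on a single bond. -/
lemma bond_duality (hσ : P.σ = -1 ∨ P.σ = 1) {x y : Fin P.N} (h : x ≠ y) {k n : Fin P.N → ℕ}
    (hk : ∀ z, P.Allowed z (k z)) (hn : ∀ z, P.Allowed z (n z)) :
    n x * (P.α y + (P.σ : ℝ) * n y) * (P.bulkDual k (P.add (P.remove n x) y) - P.bulkDual k n) +
    n y * (P.α x + (P.σ : ℝ) * n x) * (P.bulkDual k (P.add (P.remove n y) x) - P.bulkDual k n) =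
    k x * (P.α y + (P.σ : ℝ) * k y) * (P.bulkDual (P.add (P.remove k x) y) n - P.bulkDual k n) +
    k y * (P.α x + (P.σ : ℝ) * k x) * (P.bulkDual (P.add (P.remove k y) x) n - P.bulkDual k n) := by
  have e : P.bulkDual k n = P.factor x (k x) (n x) * P.factor y (k y) (n y) *
      ∏ z ∈ (Finset.univ.erase x).erase y, P.factor z (k z) (n z) := prod_pair_erase h _
  rw [prod_shift_right h, prod_shift_right h.symm, prod_shift_left h, prod_shift_left h.symm, e,
    Finset.erase_right_comm (a := y)]
  generalize ∏ z ∈ (Finset.univ.erase x).erase y, P.factor z (k z) (n z) = R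
  have x1 := mul_factor_pred x (k x) (n x)
  have y1 := mul_factor_pred y (k y) (n y)
  have x2 := mul_factor_succ_left hσ (k := k x) (hn x)
  have y2 := mul_factor_succ_left hσ (k := k y) (hn y)
  have x3 := mul_factor_succ_right hσ (n x) (hk x)
  have y3 := mul_factor_succ_right hσ (n y) (hk y)
  -- A particle jump from x to y matches the dual jump from y to x. The diagonal terms left over are
  -- antisymmetric in x and y, so they cancel only when both directions are added.
  linear_combination R * (P.α y + (P.σ : ℝ) * n y) * P.factor y (k y) (n y + 1) * x1 +
    R * (n x - k x) * P.factor x (k x) (n x) * y3 +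
    R * (P.α x + (P.σ : ℝ) * n x) * P.factor x (k x) (n x + 1) * y1 +
    R * (n y - k y) * P.factor y (k y) (n y) * x3 -
    R * k x * P.factor x (k x - 1) (n x) * y2 -
    R * k y * P.factor y (k y - 1) (n y) * x2

lemma prod_erase_single (x : Fin P.N) (f : Fin P.N → ℝ) :
    ∏ z, f z = f x * ∏ z ∈ Finset.univ.erase x, f z :=
  (Finset.mul_prod_erase _ _ (Finset.mem_univ _)).symm

/-- Duality for a reservoir. -/
lemma reservoir_duality (hσ : P.σ = -1 ∨ P.σ = 1) (x : Fin P.N) {k n : Fin P.N → ℕ}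
    (hk : P.Allowed x (k x)) (a θ : ℝ) :
    n x * (a + (P.σ : ℝ) * (a * θ)) * (P.bulkDual k (P.remove n x) - P.bulkDual k n) +
      a * θ * (P.α x + (P.σ : ℝ) * n x) * (P.bulkDual k (P.add n x) - P.bulkDual k n) =
    a * k x * (θ * P.bulkDual (P.remove k x) n - P.bulkDual k n) := by
  have e : P.bulkDual k n = P.factor x (k x) (n x) *
      ∏ z ∈ Finset.univ.erase x, P.factor z (k z) (n z) := prod_erase_single x _
  have e1 : P.bulkDual k (P.remove n x) = P.factor x (k x) (n x - 1) *
      ∏ z ∈ Finset.univ.erase x, P.factor z (k z) (n z) := by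
    rw [bulkDual, prod_erase_single x, remove_same]
    congr 1
    exact Finset.prod_congr rfl fun z hz => by rw [remove_of_ne _ (Finset.ne_of_mem_erase hz)]
  have e2 : P.bulkDual k (P.add n x) = P.factor x (k x) (n x + 1) *
      ∏ z ∈ Finset.univ.erase x, P.factor z (k z) (n z) := by
    rw [bulkDual, prod_erase_single x, add_same]
    congr 1
    exact Finset.prod_congr rfl fun z hz => by rw [add_of_ne _ (Finset.ne_of_mem_erase hz)]
  have e3 : P.bulkDual (P.remove k x) n = P.factor x (k x - 1) (n x) *
      ∏ z ∈ Finset.univ.erase x, P.factor z (k z) (n z) := by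
    rw [bulkDual, prod_erase_single x, remove_same]
    congr 1
    exact Finset.prod_congr rfl fun z hz => by rw [remove_of_ne _ (Finset.ne_of_mem_erase hz)]
  rw [e, e1, e2, e3]
  generalize ∏ z ∈ Finset.univ.erase x, P.factor z (k z) (n z) = R
  have x1 := mul_factor_pred x (k x) (n x)
  have x3 := mul_factor_succ_right hσ (n x) hk
  linear_combination R * (a + (P.σ : ℝ) * (a * θ)) * x1 + R * a * θ * x3

/-- Since ω is symmetric and vanishes on the diagonal, only the symmetrisation of the summand on
each bond matters. This suits `bond_duality`, which holds for unordered bonds only. -/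
lemma sum_bonds_congr {F G : Fin P.N → Fin P.N → ℝ}
    (h : ∀ x y, x ≠ y → F x y + F y x = G x y + G y x) :
    ∑ x, ∑ y, P.ω x y * F x y = ∑ x, ∑ y, P.ω x y * G x y := by
  have key : ∀ F : Fin P.N → Fin P.N → ℝ, ∑ x, ∑ y, P.ω x y * F x y =
      (∑ x, ∑ y, P.ω x y * (F x y + F y x)) / 2 := by
    intro F
    have h1 : ∑ x, ∑ y, P.ω x y * F y x = ∑ x, ∑ y, P.ω x y * F x y := by
      rw [Finset.sum_comm]
      exact Finset.sum_congr rfl fun x _ => Finset.sum_congr rfl fun y _ => by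
        rw [P.ω_symm]
    simp only [mul_add, Finset.sum_add_distrib, h1]
    ring
  rw [key F, key G]
  congr 1
  refine Finset.sum_congr rfl fun x _ => Finset.sum_congr rfl fun y _ => ?_
  by_cases hxy : x = y
  · subst hxy; simp [P.ω_diag]
  · rw [h x y hxy]

end BoundaryDriven

/-! ### Moves of the particle system and of its dual; duality of generators -/

namespace BoundaryDriven

open FellerChain

variable (P : BoundaryDriven)

/-- The site attached to a reservoir (`false` is the left one, `true` the right one). -/
def site (b : Bool) : Fin P.N := if b then P.last else P.first

/-- The conductance of a reservoir. -/
def resω (b : Bool) : ℝ := if b then P.ωR else P.ωL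

/-- The parameter `α` of a reservoir. -/
def resα (b : Bool) : ℝ := if b then P.αR else P.αL

/-- The parameter `θ` of a reservoir. -/
def resθ (b : Bool) : ℝ := if b then P.θR else P.θL

/-- The moves of the particle system. -/
abbrev Move : Type := (Fin P.N × Fin P.N) ⊕ Bool ⊕ Bool

/-- The moves of the dual system. -/
abbrev DualMove : Type := (Fin P.N × Fin P.N) ⊕ Bool

variable {P}

lemma resω_nonneg (b : Bool) : 0 ≤ P.resω b := by
  cases b
  · exact P.ωL_nonneg
  · exact P.ωR_nonneg

lemma resα_pos (b : Bool) : 0 < P.resα b := by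
  cases b
  · exact P.αL_pos
  · exact P.αR_pos

lemma resθ_nonneg (b : Bool) : 0 ≤ P.resθ b := by
  cases b
  · exact P.θL_nonneg
  · exact P.θR_nonneg

lemma resθ_le_one (h : P.σ = -1) (b : Bool) : P.resθ b ≤ 1 := by
  cases b
  · exact P.θL_le_one h
  · exact P.θR_le_one h

namespace State

lemma allowed (η : P.State) (x : Fin P.N) : P.Allowed x (η.1 x) := fun h => η.2 h x

lemma room_nonneg (hσ : P.σ = -1 ∨ P.σ = 1) (η : P.State) (x : Fin P.N) :
    0 ≤ (P.α x + (P.σ : ℝ) * η.1 x) := by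
  rcases sigma_eq hσ with ⟨h1, h2⟩ | ⟨h1, h2⟩
  · have : (η.1 x : ℝ) ≤ P.α x := by exact_mod_cast η.2 h1 x
    rw [h2]; linarith
  · rw [h2]; positivity

lemma lt_of_room (η : P.State) {x : Fin P.N} (hx : (P.α x + (P.σ : ℝ) * η.1 x) ≠ 0)
    (h : P.σ = -1) : η.1 x < P.α x := by
  refine lt_of_le_of_ne (η.2 h x) fun h3 => hx ?_
  rw [h3, h, SignType.coe_neg, SignType.coe_one]
  ring

lemma room_pos_of_eq_zero (η : P.State) {x : Fin P.N} (hx : η.1 x = 0) :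
    0 < (P.α x + (P.σ : ℝ) * η.1 x) := by
  simpa [hx] using P.α_pos x

open Classical in
/-- Move a particle from `x` to `y`. -/
noncomputable def bulkMove (η : P.State) (x y : Fin P.N) : P.State :=
  if h : 0 < η.1 x ∧ (P.σ = -1 → ∀ z, P.add (P.remove η.1 x) y z ≤ P.α z) then
    ⟨P.add (P.remove η.1 x) y, h.2⟩
  else η

/-- Remove a particle at `x`. -/
def removeAt (η : P.State) (x : Fin P.N) : P.State :=
  ⟨P.remove η.1 x, fun h z => (remove_le _ _ _).trans (η.2 h z)⟩

open Classical in
/-- Add a particle at `x`. -/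
noncomputable def addAt (η : P.State) (x : Fin P.N) : P.State :=
  if h : P.σ = -1 → ∀ z, P.add η.1 x z ≤ P.α z then ⟨P.add η.1 x, h⟩ else η

lemma bulkMove_val {η : P.State} {x y : Fin P.N} (hx : 0 < η.1 x)
    (hy : (P.α y + (P.σ : ℝ) * η.1 y) ≠ 0) :
    (η.bulkMove x y).1 = P.add (P.remove η.1 x) y := by
  refine congrArg Subtype.val (dif_pos ?_)
  refine ⟨hx, fun h z => ?_⟩
  by_cases hz : z = y
  · subst hz
    rw [add_same]
    have := remove_le η.1 x z
    have := η.lt_of_room hy h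
    omega
  · rw [add_of_ne _ hz]
    exact (remove_le _ _ _).trans (η.2 h z)

lemma addAt_val {η : P.State} {x : Fin P.N} (hx : (P.α x + (P.σ : ℝ) * η.1 x) ≠ 0) :
    (η.addAt x).1 = P.add η.1 x := by
  refine congrArg Subtype.val (dif_pos ?_)
  intro h z
  by_cases hz : z = x
  · subst hz
    rw [add_same]
    exact η.lt_of_room hx h
  · rw [add_of_ne _ hz]
    exact η.2 h z

lemma sum_bulkMove (η : P.State) (x y : Fin P.N) :
    ∑ z, (η.bulkMove x y).1 z = ∑ z, η.1 z := by
  by_cases h : 0 < η.1 x ∧ (P.σ = -1 → ∀ z, P.add (P.remove η.1 x) y z ≤ P.α z)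
  · have h1 : (η.bulkMove x y).1 = P.add (P.remove η.1 x) y := congrArg Subtype.val (dif_pos h)
    rw [h1, sum_add, sum_remove _ h.1]
  · have h1 : η.bulkMove x y = η := dif_neg h
    rw [h1]

lemma sum_removeAt {η : P.State} {x : Fin P.N} (hx : 0 < η.1 x) :
    ∑ z, (η.removeAt x).1 z + 1 = ∑ z, η.1 z := sum_remove _ hx

instance : Countable P.State := by
  unfold State
  infer_instance

end State

/-- The moves of the particle system, acting on configurations. -/
noncomputable def move : P.Move → P.State → P.State
  | Sum.inl (x, y), η => η.bulkMove x y
  | Sum.inr (Sum.inl b), η => η.removeAt (P.site b)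
  | Sum.inr (Sum.inr b), η => η.addAt (P.site b)

/-- The rates of the moves of the particle system. -/
noncomputable def moveRate : P.Move → P.State → ℝ
  | Sum.inl (x, y), η => P.ω x y * (η.1 x * (P.α y + (P.σ : ℝ) * η.1 y))
  | Sum.inr (Sum.inl b), η =>
    P.resω b * (η.1 (P.site b) * (P.resα b + (P.σ : ℝ) * (P.resα b * P.resθ b)))
  | Sum.inr (Sum.inr b), η =>
    P.resω b * (P.resα b * P.resθ b * (P.α (P.site b) + (P.σ : ℝ) * η.1 (P.site b)))

lemma exit_nonneg (hσ : P.σ = -1 ∨ P.σ = 1) (b : Bool) :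
    0 ≤ P.resα b + (P.σ : ℝ) * (P.resα b * P.resθ b) := by
  have h1 := resα_pos (P := P) b
  have h2 := resθ_nonneg (P := P) b
  rcases sigma_eq hσ with ⟨h3, h4⟩ | ⟨h3, h4⟩
  · have := resθ_le_one h3 b
    rw [h4]
    nlinarith
  · rw [h4]
    positivity

lemma moveRate_nonneg (hσ : P.σ = -1 ∨ P.σ = 1) (m : P.Move) (η : P.State) :
    0 ≤ moveRate m η := by
  rcases m with ⟨x, y⟩ | b | b
  · exact mul_nonneg (P.ω_nonneg x y) (mul_nonneg (Nat.cast_nonneg _) (η.room_nonneg hσ y))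
  · exact mul_nonneg (resω_nonneg b) (mul_nonneg (Nat.cast_nonneg _) (exit_nonneg hσ b))
  · exact mul_nonneg (resω_nonneg b) (mul_nonneg (mul_nonneg (resα_pos b).le (resθ_nonneg b))
      (η.room_nonneg hσ _))

/-- The default values of `bulkMove` and `addAt` are irrelevant: where the source is empty or the
target full, the rate or the conductance factor is multiplied by zero. -/
lemma generator_eq (f : (Fin P.N → ℕ) → ℝ) (η : P.State) :
    P.generator f η.1 = gen moveRate move (fun ζ => f ζ.1) η := by
  unfold gen generator
  rw [Fintype.sum_sum_type, Fintype.sum_sum_type, Fintype.sum_prod_type]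
  have hbulk : ∀ x y, P.ω x y * (η.1 x * (P.α y + (P.σ : ℝ) * η.1 y) *
      (f (P.add (P.remove η.1 x) y) - f η.1)) =
      moveRate (Sum.inl (x, y)) η * (f (move (Sum.inl (x, y)) η).1 - f η.1) := by
    intro x y
    simp only [moveRate, move]
    rcases Nat.eq_zero_or_pos (η.1 x) with hx | hx
    · simp [hx]
    by_cases hy : (P.α y + (P.σ : ℝ) * η.1 y) = 0
    · simp [hy]
    · rw [State.bulkMove_val hx hy]; ring
  have hadd : ∀ b, P.resω b * (P.resα b * P.resθ b *
      (P.α (P.site b) + (P.σ : ℝ) * η.1 (P.site b)) * (f (P.add η.1 (P.site b)) - f η.1)) =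
      moveRate (Sum.inr (Sum.inr b)) η * (f (move (Sum.inr (Sum.inr b)) η).1 - f η.1) := by
    intro b
    simp only [moveRate, move]
    by_cases hy : (P.α (P.site b) + (P.σ : ℝ) * η.1 (P.site b)) = 0
    · simp [hy]
    · rw [State.addAt_val hy]; ring
  have hl := hadd false
  have hr := hadd true
  simp only [Fintype.sum_bool]
  rw [← hl, ← hr]
  simp_rw [hbulk]
  simp only [moveRate, move, State.removeAt, resω, resα, resθ, site, Bool.false_eq_true,
    if_false, if_true]
  ring

lemma isRateMatrix_rate : IsRateMatrix (moveRate (P := P)) move P.rate := by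
  classical
  intro η η'
  rw [rate, generator_eq]
  simp only [gen]
  refine Finset.sum_congr rfl fun m _ => ?_
  have h : ∀ ζ : P.State, (if ζ.1 = η'.1 then (1 : ℝ) else 0) = if ζ = η' then 1 else 0 :=
    fun ζ => if_congr Subtype.ext_iff.symm rfl rfl
  rw [h, h]

/-- The configurations of the dual system with `n` particles in total. -/
def DualLevel (P : BoundaryDriven) (n : ℕ) : Type :=
  {ξ : P.DualState // ∑ x, ξ.bulk.1 x + ξ.left + ξ.right = n}

namespace DualLevel

variable {n : ℕ}

/-- Absorbed particles stay counted, so every occupation number is at most n. This finiteness makes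
the dual semigroup a matrix exponential. -/
instance : Finite (P.DualLevel n) := by
  let f : P.DualLevel n → (Fin P.N → Fin (n + 1)) × Fin (n + 1) × Fin (n + 1) := fun ξ =>
    (fun x => ⟨ξ.1.bulk.1 x, by
      have h1 := ξ.2
      have h2 := Finset.single_le_sum (f := ξ.1.bulk.1) (fun _ _ => Nat.zero_le _)
        (Finset.mem_univ x)
      omega⟩,
      ⟨ξ.1.left, by have h1 := ξ.2; omega⟩, ⟨ξ.1.right, by have h1 := ξ.2; omega⟩)
  refine Finite.of_injective f fun ξ ζ h => ?_
  simp only [f, Prod.mk.injEq, Fin.mk.injEq] at h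
  obtain ⟨h1, h2, h3⟩ := h
  obtain ⟨⟨⟨b, hb⟩, l, r⟩, hξ⟩ := ξ
  obtain ⟨⟨⟨b', hb'⟩, l', r'⟩, hζ⟩ := ζ
  have : b = b' := by
    ext x
    simpa using congrFun h1 x
  subst this
  simp only at h2 h3
  subst h2 h3
  rfl

noncomputable instance : Fintype (P.DualLevel n) := Fintype.ofFinite _

/-- The number of particles at `x`. -/
abbrev at_ (ξ : P.DualLevel n) (x : Fin P.N) : ℕ := ξ.1.bulk.1 x

/-- Move a dual particle from `x` to `y`. -/
noncomputable def bulkMove (ξ : P.DualLevel n) (x y : Fin P.N) : P.DualLevel n :=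
  ⟨⟨ξ.1.bulk.bulkMove x y, ξ.1.left, ξ.1.right⟩, by rw [State.sum_bulkMove]; exact ξ.2⟩

/-- Absorb a dual particle in a reservoir. -/
def absorb (ξ : P.DualLevel n) (b : Bool) : P.DualLevel n :=
  if h : 0 < ξ.at_ (P.site b) then
    ⟨⟨ξ.1.bulk.removeAt (P.site b), ξ.1.left + (if b then 0 else 1),
      ξ.1.right + (if b then 1 else 0)⟩, by
      have h1 := State.sum_removeAt h
      have h2 := ξ.2
      cases b <;> simp <;> omega⟩
  else ξ

lemma absorb_val {ξ : P.DualLevel n} {b : Bool} (h : 0 < ξ.at_ (P.site b)) :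
    (ξ.absorb b).1 = ⟨ξ.1.bulk.removeAt (P.site b), ξ.1.left + (if b then 0 else 1),
      ξ.1.right + (if b then 1 else 0)⟩ :=
  congrArg Subtype.val (dif_pos h)

end DualLevel

variable {n : ℕ}

/-- The moves of the dual system. -/
noncomputable def dualMove : P.DualMove → P.DualLevel n → P.DualLevel n
  | Sum.inl (x, y), ξ => ξ.bulkMove x y
  | Sum.inr b, ξ => ξ.absorb b

/-- The rates of the moves of the dual system. -/
noncomputable def dualRate : P.DualMove → P.DualLevel n → ℝ
  | Sum.inl (x, y), ξ => P.ω x y * (ξ.at_ x * (P.α y + (P.σ : ℝ) * ξ.at_ y))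
  | Sum.inr b, ξ => P.resω b * (P.resα b * ξ.at_ (P.site b))

lemma dualRate_nonneg (hσ : P.σ = -1 ∨ P.σ = 1) (m : P.DualMove) (ξ : P.DualLevel n) :
    0 ≤ dualRate m ξ := by
  rcases m with ⟨x, y⟩ | b
  · exact mul_nonneg (P.ω_nonneg x y)
      (mul_nonneg (Nat.cast_nonneg _) (ξ.1.bulk.room_nonneg hσ y))
  · exact mul_nonneg (resω_nonneg b) (mul_nonneg (resα_pos b).le (Nat.cast_nonneg _))

/-- The generator of the dual process on functions that are explicit in the bulk configuration. -/
lemma dual_gen_eq (F : (Fin P.N → ℕ) → ℝ) (ξ : P.DualLevel n) :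
    gen dualRate dualMove
      (fun ζ : P.DualLevel n => P.θL ^ ζ.1.left * F ζ.1.bulk.1 * P.θR ^ ζ.1.right) ξ =
    P.θL ^ ξ.1.left * ((∑ x, ∑ y, P.ω x y * (ξ.at_ x * (P.α y + (P.σ : ℝ) * ξ.at_ y) *
        (F (P.add (P.remove ξ.1.bulk.1 x) y) - F ξ.1.bulk.1))) +
      ∑ b, P.resω b * (P.resα b * ξ.at_ (P.site b) *
        (P.resθ b * F (P.remove ξ.1.bulk.1 (P.site b)) - F ξ.1.bulk.1))) * P.θR ^ ξ.1.right := by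
  unfold gen
  rw [Fintype.sum_sum_type, Fintype.sum_prod_type, mul_add, add_mul]
  congr 1
  · rw [Finset.mul_sum, Finset.sum_mul]
    refine Finset.sum_congr rfl fun x _ => ?_
    rw [Finset.mul_sum, Finset.sum_mul]
    refine Finset.sum_congr rfl fun y _ => ?_
    simp only [dualRate, dualMove, DualLevel.bulkMove]
    rcases Nat.eq_zero_or_pos (ξ.1.bulk.1 x) with hx | hx
    · simp [hx]
    by_cases hy : (P.α y + (P.σ : ℝ) * ξ.1.bulk.1 y) = 0
    · simp [hy]
    · rw [State.bulkMove_val hx hy]; ring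
  · rw [Finset.mul_sum, Finset.sum_mul]
    refine Finset.sum_congr rfl fun b _ => ?_
    simp only [dualRate, dualMove]
    rcases Nat.eq_zero_or_pos (ξ.1.bulk.1 (P.site b)) with hx | hx
    · simp [hx]
    · rw [DualLevel.absorb_val hx]
      cases b <;> simp [resθ, State.removeAt, pow_succ] <;> ring

lemma Dcl_eq (ξ : P.DualState) (η : P.State) :
    P.Dcl ξ η = P.θL ^ ξ.left * P.bulkDual ξ.bulk.1 η.1 * P.θR ^ ξ.right := rfl

/-- Duality between the generators. -/
lemma duality (hσ : P.σ = -1 ∨ P.σ = 1) (ξ : P.DualLevel n) (η : P.State) :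
    gen moveRate move (P.Dcl ξ.1) η =
      gen dualRate dualMove (fun ζ : P.DualLevel n => P.Dcl ζ.1 η) ξ := by
  have h1 : gen moveRate move (P.Dcl ξ.1) η =
      P.generator (fun ζ => P.θL ^ ξ.1.left * P.bulkDual ξ.1.bulk.1 ζ * P.θR ^ ξ.1.right) η.1 := by
    rw [generator_eq]; rfl
  have h2 := dual_gen_eq (fun k => P.bulkDual k η.1) ξ
  simp only [Dcl_eq]
  rw [h2, h1]
  have hb := sum_bonds_congr
    (F := fun x y => η.1 x * (P.α y + (P.σ : ℝ) * η.1 y) *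
      (P.bulkDual ξ.1.bulk.1 (P.add (P.remove η.1 x) y) - P.bulkDual ξ.1.bulk.1 η.1))
    (G := fun x y => ξ.at_ x * (P.α y + (P.σ : ℝ) * ξ.at_ y) *
      (P.bulkDual (P.add (P.remove ξ.1.bulk.1 x) y) η.1 - P.bulkDual ξ.1.bulk.1 η.1))
    fun x y hxy => bond_duality hσ hxy ξ.1.bulk.allowed η.allowed
  have hL := reservoir_duality hσ P.first (n := η.1) (ξ.1.bulk.allowed P.first) P.αL P.θL
  have hR := reservoir_duality hσ P.last (n := η.1) (ξ.1.bulk.allowed P.last) P.αR P.θR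
  simp only [Fintype.sum_bool, resω, resα, resθ, site, if_true, Bool.false_eq_true, if_false]
  rw [← hb]
  dsimp only [DualLevel.at_]
  rw [← hL, ← hR]
  unfold generator
  have hS : ∀ F G : Fin P.N → Fin P.N → ℝ, ∀ c : ℝ,
      (∀ x y, F x y = c * G x y) → ∑ x, ∑ y, F x y = c * ∑ x, ∑ y, G x y := by
    intro F G c h
    simp only [Finset.mul_sum, h]
  rw [hS _ (fun x y => P.ω x y * (η.1 x * (P.α y + (P.σ : ℝ) * η.1 y) *
      (P.bulkDual ξ.1.bulk.1 (P.add (P.remove η.1 x) y) - P.bulkDual ξ.1.bulk.1 η.1)))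
      (P.θL ^ ξ.1.left * P.θR ^ ξ.1.right) (fun x y => by ring)]
  ring

end BoundaryDriven

/-! ### Lyapunov functions, duality of semigroups, non-explosion -/

namespace BoundaryDriven

open FellerChain

variable {P : BoundaryDriven} {n : ℕ}

namespace State

/-- The total number of particles. -/
def size (η : P.State) : ℝ := ((∑ x, η.1 x : ℕ) : ℝ)

lemma size_nonneg (η : P.State) : 0 ≤ η.size := Nat.cast_nonneg _

lemma coord_le_size (η : P.State) (x : Fin P.N) : (η.1 x : ℝ) ≤ η.size := by
  unfold size
  exact_mod_cast Finset.single_le_sum (f := η.1) (fun _ _ => Nat.zero_le _) (Finset.mem_univ x)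

lemma finite_size_le (R : ℝ) : {η : P.State | η.size ≤ R}.Finite := by
  have h1 : (Set.Iic (fun _ : Fin P.N => ⌊R⌋₊)).Finite := Set.finite_Iic _
  have h2 : Function.Injective fun η : P.State => η.1 := Subtype.val_injective
  refine (h1.preimage h2.injOn).subset fun η hη => ?_
  intro x
  exact Nat.le_floor ((η.coord_le_size x).trans hη)

lemma size_bulkMove (η : P.State) (x y : Fin P.N) : (η.bulkMove x y).size = η.size := by
  unfold size
  rw [sum_bulkMove]

lemma size_removeAt_le (η : P.State) (x : Fin P.N) : (η.removeAt x).size ≤ η.size := by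
  unfold size
  exact_mod_cast Finset.sum_le_sum fun z _ => remove_le η.1 x z

lemma size_addAt_le (η : P.State) (x : Fin P.N) : (η.addAt x).size ≤ η.size + 1 := by
  by_cases h : P.σ = -1 → ∀ z, P.add η.1 x z ≤ P.α z
  · have h1 : (η.addAt x).1 = P.add η.1 x := congrArg Subtype.val (dif_pos h)
    unfold size
    rw [h1, sum_add]
    push_cast
    exact le_rfl
  · have h1 : η.addAt x = η := dif_neg h
    rw [h1]
    linarith

end State

/-- With a = 1 + particle number, injections have rate at most a constant times a and raise a^k by
this difference. The drift of a^k is therefore at most linear in a^k. -/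
lemma mul_pow_succ_sub_pow_le {a : ℝ} (ha : 1 ≤ a) (k : ℕ) :
    a * ((a + 1) ^ k - a ^ k) ≤ 3 ^ k * a ^ k := by
  induction k with
  | zero => simp
  | succ k ih =>
    have h3 : (1 : ℝ) ≤ 3 ^ k := one_le_pow₀ (by norm_num)
    have hak : 0 ≤ a ^ k := by positivity
    calc a * ((a + 1) ^ (k + 1) - a ^ (k + 1))
        = (a + 1) * (a * ((a + 1) ^ k - a ^ k)) + a * a ^ k := by ring
      _ ≤ (a + 1) * (3 ^ k * a ^ k) + a * a ^ k := by gcongr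
      _ = ((a + 1) * 3 ^ k + a * 1) * a ^ k := by ring
      _ ≤ ((a + a) * 3 ^ k + a * 3 ^ k) * a ^ k := by gcongr
      _ = _ := by ring

/-- Polynomials of the particle number are Lyapunov functions. -/
lemma exists_lyapunov (hσ : P.σ = -1 ∨ P.σ = 1) (k : ℕ) :
    ∃ c : ℝ, 0 ≤ c ∧ ∀ η : P.State,
      gen moveRate move (fun ζ : P.State => (1 + ζ.size) ^ k) η ≤ c * (1 + η.size) ^ k := by
  -- Bulk jumps preserve the size and exits do not increase it, so only injections count. Their room
  -- α + σ η is at most α (1 + size) for either sign.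
  refine ⟨∑ b, P.resω b * (P.resα b * P.resθ b * P.α (P.site b)) * 3 ^ k,
    Finset.sum_nonneg fun b _ => mul_nonneg (mul_nonneg (resω_nonneg b) (mul_nonneg
      (mul_nonneg (resα_pos b).le (resθ_nonneg b)) (Nat.cast_nonneg _))) (by positivity),
    fun η => ?_⟩
  unfold gen
  rw [Fintype.sum_sum_type, Fintype.sum_sum_type]
  have hs := η.size_nonneg
  have h1 : ∑ m : Fin P.N × Fin P.N, moveRate (Sum.inl m) η *
      ((1 + (move (Sum.inl m) η).size) ^ k - (1 + η.size) ^ k) = 0 :=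
    Finset.sum_eq_zero fun ⟨x, y⟩ _ => by simp [move, State.size_bulkMove]
  have h2 : ∑ b, moveRate (Sum.inr (Sum.inl b)) η *
      ((1 + (move (Sum.inr (Sum.inl b)) η).size) ^ k - (1 + η.size) ^ k) ≤ 0 :=
    Finset.sum_nonpos fun b _ => mul_nonpos_of_nonneg_of_nonpos (moveRate_nonneg hσ _ _) <| by
      have h := η.size_removeAt_le (P.site b)
      have h' := (η.removeAt (P.site b)).size_nonneg
      simp only [move, sub_nonpos]
      gcongr
  rw [h1, zero_add, Finset.sum_mul]
  refine (add_le_add_left h2 _).trans ?_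
  rw [zero_add]
  refine Finset.sum_le_sum fun b _ => ?_
  have h := η.size_addAt_le (P.site b)
  have h' := (η.addAt (P.site b)).size_nonneg
  have hr : moveRate (Sum.inr (Sum.inr b)) η ≤
      P.resω b * (P.resα b * P.resθ b * P.α (P.site b)) * (1 + η.size) := by
    have hα : (1 : ℝ) ≤ P.α (P.site b) := by exact_mod_cast P.α_pos (P.site b)
    have hx := η.coord_le_size (P.site b)
    have hx0 : (0 : ℝ) ≤ η.1 (P.site b) := Nat.cast_nonneg _
    have hroom : (P.α (P.site b) + (P.σ : ℝ) * η.1 (P.site b)) ≤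
        P.α (P.site b) * (1 + η.size) := by
      rcases sigma_eq hσ with ⟨-, h2⟩ | ⟨-, h2⟩ <;> rw [h2] <;> nlinarith
    have ha := resω_nonneg (P := P) b
    have hb := (resα_pos (P := P) b).le
    have hc := resθ_nonneg (P := P) b
    calc moveRate (Sum.inr (Sum.inr b)) η
        ≤ P.resω b * (P.resα b * P.resθ b * (P.α (P.site b) * (1 + η.size))) := by
          simp only [moveRate]
          gcongr
      _ = _ := by ring
  have hd : (1 + (move (Sum.inr (Sum.inr b)) η).size) ^ k - (1 + η.size) ^ k ≤
      (1 + η.size + 1) ^ k - (1 + η.size) ^ k := by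
    exact sub_le_sub_right (pow_le_pow_left₀ (by simp only [move]; linarith)
      (by simp only [move]; linarith) k) _
  have hd0 : 0 ≤ (1 + η.size + 1) ^ k - (1 + η.size) ^ k := by
    exact sub_nonneg.2 (pow_le_pow_left₀ (by linarith) (by linarith) k)
  calc moveRate (Sum.inr (Sum.inr b)) η *
        ((1 + (move (Sum.inr (Sum.inr b)) η).size) ^ k - (1 + η.size) ^ k)
      ≤ moveRate (Sum.inr (Sum.inr b)) η * ((1 + η.size + 1) ^ k - (1 + η.size) ^ k) := by
        gcongr
        exact moveRate_nonneg hσ _ _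
    _ ≤ P.resω b * (P.resα b * P.resθ b * P.α (P.site b)) * (1 + η.size) *
        ((1 + η.size + 1) ^ k - (1 + η.size) ^ k) := by gcongr
    _ = P.resω b * (P.resα b * P.resθ b * P.α (P.site b)) * ((1 + η.size) *
        ((1 + η.size + 1) ^ k - (1 + η.size) ^ k)) := by ring
    _ ≤ P.resω b * (P.resα b * P.resθ b * P.α (P.site b)) * (3 ^ k * (1 + η.size) ^ k) := by
        have ha := resω_nonneg (P := P) b
        have hb := (resα_pos (P := P) b).le
        have hc := resθ_nonneg (P := P) b
        have := mul_pow_succ_sub_pow_le (by linarith : 1 ≤ 1 + η.size) k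
        gcongr
    _ = _ := by ring

lemma Dcl_nonneg (ξ : P.DualState) (η : P.State) : 0 ≤ P.Dcl ξ η :=
  mul_nonneg (mul_nonneg (pow_nonneg P.θL_nonneg _)
    (Finset.prod_nonneg fun x _ => factor_nonneg x _ _)) (pow_nonneg P.θR_nonneg _)

lemma exists_Dcl_le (P : BoundaryDriven) (n : ℕ) : ∃ C : ℝ, 0 ≤ C ∧
    ∀ (ξ : P.DualLevel n) (η : P.State), P.Dcl ξ.1 η ≤ C * (1 + η.size) ^ n := by
  set c : P.DualLevel n → ℝ := fun ξ =>
    P.θL ^ ξ.1.left * (∏ x, P.w x (ξ.at_ x))⁻¹ * P.θR ^ ξ.1.right with hc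
  have hc0 : ∀ ξ, 0 ≤ c ξ := fun ξ => mul_nonneg (mul_nonneg (pow_nonneg P.θL_nonneg _)
    (inv_nonneg.2 (Finset.prod_nonneg fun x _ => w_nonneg x _))) (pow_nonneg P.θR_nonneg _)
  refine ⟨∑ ξ, c ξ, Finset.sum_nonneg fun ξ _ => hc0 ξ, fun ξ η => ?_⟩
  have hs := η.size_nonneg
  have h1 : P.Dcl ξ.1 η = c ξ * ∏ x, ((η.1 x).descFactorial (ξ.at_ x) : ℝ) := by
    rw [Dcl_eq, bulkDual, hc]
    simp only [factor, Finset.prod_div_distrib]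
    ring
  have h2 : ∏ x, ((η.1 x).descFactorial (ξ.at_ x) : ℝ) ≤ (1 + η.size) ^ n := by
    calc ∏ x, ((η.1 x).descFactorial (ξ.at_ x) : ℝ) ≤ ∏ x, (1 + η.size) ^ (ξ.at_ x) := by
          refine Finset.prod_le_prod (fun _ _ => Nat.cast_nonneg _) fun x _ => ?_
          have h3 : ((η.1 x).descFactorial (ξ.at_ x) : ℝ) ≤ (η.1 x : ℝ) ^ (ξ.at_ x) := by
            exact_mod_cast Nat.descFactorial_le_pow _ _
          refine h3.trans ?_
          gcongr
          linarith [η.coord_le_size x]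
      _ = (1 + η.size) ^ (∑ x, ξ.at_ x) := Finset.prod_pow_eq_pow_sum _ _ _
      _ ≤ _ := by
          refine pow_le_pow_right₀ (by linarith) ?_
          have := ξ.2
          simp only [DualLevel.at_]
          omega
  rw [h1]
  have h3 : c ξ ≤ ∑ ξ, c ξ := Finset.single_le_sum (fun ξ _ => hc0 ξ) (Finset.mem_univ ξ)
  have h4 : 0 ≤ ∏ x, ((η.1 x).descFactorial (ξ.at_ x) : ℝ) :=
    Finset.prod_nonneg fun x _ => Nat.cast_nonneg _
  exact mul_le_mul h3 h2 h4 ((hc0 ξ).trans h3)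

/-- The semigroup of the dual process on the configurations with `n` particles. -/
noncomputable abbrev dualHeat (P : BoundaryDriven) (n : ℕ) (t : ℝ) :
    (P.DualLevel n → ℝ) →L[ℝ] (P.DualLevel n → ℝ) := heat dualRate dualMove t

/-- The two operators act on different variables, and the particle generator is a finite linear
combination of evaluations, so it passes through the linear map. -/
lemma gen_dualHeat (F : P.State → P.DualLevel n → ℝ) (t : ℝ) (ξ : P.DualLevel n) (η : P.State) :
    gen moveRate move (fun ζ => P.dualHeat n t (F ζ) ξ) η =
      P.dualHeat n t (fun ζ => gen moveRate move (fun η => F η ζ) η) ξ := by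
  have h : (fun ζ => gen moveRate move (fun η => F η ζ) η) =
      ∑ m, moveRate m η • (F (move m η) - F η) := by
    ext ζ
    simp [gen]
  rw [h, map_sum, Finset.sum_apply]
  simp only [map_smul, map_sub, Pi.smul_apply, Pi.sub_apply, smul_eq_mul, gen]

/-- Duality between the semigroups. -/
theorem semigroup_Dcl (hσ : P.σ = -1 ∨ P.σ = 1) (ξ : P.DualLevel n) {t : ℝ} (ht : 0 ≤ t)
    (η : P.State) :
    semigroup P.rate t (fun ζ => ENNReal.ofReal (P.Dcl ξ.1 ζ)) η =
      ENNReal.ofReal (P.dualHeat n t (fun ζ => P.Dcl ζ.1 η) ξ) := by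
  have hQ := isRateMatrix_rate (P := P)
  have hr := moveRate_nonneg hσ
  have hdr := dualRate_nonneg (n := n) hσ
  obtain ⟨C, hC0, hC⟩ := exists_Dcl_le P n
  -- The candidate solution grows with degree n in the size; one more degree makes the Lyapunov
  -- function dominate it off finite sets.
  obtain ⟨c, hc0, hc⟩ := exists_lyapunov hσ (n + 1)
  have hbd : ∀ t, 0 ≤ t → ∀ η, P.dualHeat n t (fun ζ => P.Dcl ζ.1 η) ξ ≤ C * (1 + η.size) ^ n :=
    fun t ht η => heat_le dualMove hdr (fun ζ => hC ζ η) ht ξ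
  have hpos : ∀ t, 0 ≤ t → ∀ η, 0 ≤ P.dualHeat n t (fun ζ => P.Dcl ζ.1 η) ξ :=
    fun t ht η => heat_nonneg dualMove hdr (fun ζ => Dcl_nonneg ζ.1 η) ht ξ
  refine semigroup_eq_of_lyapunov P.rate (fun x => (hQ.jump_one hr x).le) (hQ.diag_nonpos hr)
    (u := fun t η => ENNReal.ofReal (P.dualHeat n t (fun ζ => P.Dcl ζ.1 η) ξ))
    (v := fun t η => ENNReal.ofReal (Real.exp (c * t) * (1 + η.size) ^ (n + 1)))
    ?_ ?_ ?_ (fun _ _ => ENNReal.ofReal_ne_top) ?_ ?_ ht η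
  · intro t ht η
    have h := hQ.solution hr (u := fun t η => P.dualHeat n t (fun ζ => P.Dcl ζ.1 η) ξ)
      (u' := fun t η => P.dualHeat n t (gen dualRate dualMove fun ζ => P.Dcl ζ.1 η) ξ)
      (fun t η => hasDerivAt_heat' dualRate dualMove _ t ξ)
      (fun η => continuous_heat dualRate dualMove _ ξ) hpos ?_ ht η
    · simpa [heat_zero] using h
    · intro t _ η
      rw [gen_dualHeat]
      -- Duality of generators is what makes the dual semigroup solve the backward equation in η.
      have h : (gen dualRate dualMove fun ζ : P.DualLevel n => P.Dcl ζ.1 η) =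
          fun ζ : P.DualLevel n => gen moveRate move (P.Dcl ζ.1) η :=
        funext fun ζ => (duality hσ ζ η).symm
      rw [h]
  · intro t ht η
    refine le_trans le_add_self (hQ.supersolution hr
      (u := fun t η => Real.exp (c * t) * (1 + η.size) ^ (n + 1))
      (u' := fun t η => Real.exp (c * t) * (c * 1) * (1 + η.size) ^ (n + 1))
      ?_ ?_ ?_ ?_ ht η)
    · intro t η
      exact (((hasDerivAt_id t).const_mul c).exp).mul_const _
    · intro η
      fun_prop
    · intro t _ η
      have := η.size_nonneg
      positivity
    · intro t _ η
      have h1 : gen moveRate move (fun η : P.State => Real.exp (c * t) * (1 + η.size) ^ (n + 1)) η =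
          Real.exp (c * t) * gen moveRate move (fun η : P.State => (1 + η.size) ^ (n + 1)) η := by
        simp only [gen, Finset.mul_sum]
        exact Finset.sum_congr rfl fun m _ => by ring
      rw [h1]
      calc _ ≤ Real.exp (c * t) * (c * (1 + η.size) ^ (n + 1)) := by gcongr; exact hc η
        _ = _ := by ring
  · intro η
    exact ENNReal.measurable_ofReal.comp (by fun_prop)
  · intro ε hε
    -- Beyond size C / ε the constant C is absorbed by ε (1 + size).
    refine ⟨_, State.finite_size_le (C / ε), fun t ht η hη => ?_⟩
    simp only [Set.mem_ofPred_eq, not_le] at hη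
    have hs := η.size_nonneg
    have hε' : (0 : ℝ) < ε := hε
    rw [← ENNReal.ofReal_coe_nnreal, ← ENNReal.ofReal_mul (NNReal.coe_nonneg ε)]
    refine ENNReal.ofReal_le_ofReal ((hbd t ht η).trans ?_)
    have h1 : C ≤ ε * (1 + η.size) := by
      rw [div_lt_iff₀ hε'] at hη
      nlinarith
    have h2 : 1 ≤ Real.exp (c * t) := Real.one_le_exp (by positivity)
    calc C * (1 + η.size) ^ n ≤ ε * (1 + η.size) * (1 + η.size) ^ n := by gcongr
      _ = ε * (1 * (1 + η.size) ^ (n + 1)) := by ring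
      _ ≤ _ := by gcongr
  · intro η
    exact ⟨_, ENNReal.ofReal_ne_top, fun t ht => ENNReal.ofReal_le_ofReal (hbd t ht η)⟩

lemma Dcl_of_level_zero (ξ : P.DualLevel 0) (η : P.State) : P.Dcl ξ.1 η = 1 := by
  have h := ξ.2
  have h1 : ∀ x, ξ.1.bulk.1 x = 0 := fun x => by
    have := Finset.single_le_sum (f := ξ.1.bulk.1) (fun _ _ => Nat.zero_le _) (Finset.mem_univ x)
    omega
  have h2 : ξ.1.left = 0 := by omega
  have h3 : ξ.1.right = 0 := by omega
  simp [Dcl_eq, bulkDual, h1, h2, h3, factor_zero]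

/-- The process does not explode. -/
theorem semigroup_one (hσ : P.σ = -1 ∨ P.σ = 1) {t : ℝ} (ht : 0 ≤ t) (η : P.State) :
    semigroup P.rate t (fun _ => 1) η = 1 := by
  let ξ : P.DualLevel 0 := ⟨⟨⟨fun _ => 0, fun _ _ => Nat.zero_le _⟩, 0, 0⟩, by simp⟩
  have h := semigroup_Dcl hσ ξ ht η
  simp only [Dcl_of_level_zero, ENNReal.ofReal_one] at h
  have h0 : gen (dualRate (P := P)) dualMove (fun _ : P.DualLevel 0 => (1 : ℝ)) = 0 := by
    ext x; simp [gen]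
  rw [h, dualHeat, heat_of_gen_eq_zero _ _ h0, ENNReal.ofReal_one]

lemma lintegral_law (μ : Measure P.State) (t : ℝ) (f : P.State → ℝ≥0∞) :
    ∫⁻ η, f η ∂(P.law μ t) = ∫⁻ η, semigroup P.rate t f η ∂μ := by
  unfold law lawAt
  rw [Measure.lintegral_bind measurable_from_top.aemeasurable measurable_from_top.aemeasurable]
  refine lintegral_congr fun η => ?_
  rw [lintegral_sum_measure]
  simp_rw [lintegral_smul_measure, lintegral_dirac' _ (measurable_from_top (f := f))]
  rfl

end BoundaryDriven

/-! ### Reachability by bulk jumps, access to the empty configuration -/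

namespace BoundaryDriven

open FellerChain

variable {P : BoundaryDriven} {n : ℕ}

namespace State

/-- `η'` is obtained from `η` by a bulk jump which has positive rate. -/
def Hop (η η' : P.State) : Prop :=
  ∃ x y, 0 < P.ω x y ∧ 0 < η.1 x ∧ 0 < (P.α y + (P.σ : ℝ) * η.1 y) ∧ η' = η.bulkMove x y

/-- Reachability by bulk jumps. -/
abbrev Reach : P.State → P.State → Prop := Relation.ReflTransGen Hop

lemma ne_of_conductance {x y : Fin P.N} (h : 0 < P.ω x y) : x ≠ y := by
  rintro rfl
  rw [P.ω_diag] at h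
  exact h.false

lemma conductance_of_adj {x y : Fin P.N}
    (h : (SimpleGraph.fromRel fun x y => P.ω x y ≠ 0).Adj x y) : 0 < P.ω x y := by
  rw [SimpleGraph.fromRel_adj] at h
  refine lt_of_le_of_ne (P.ω_nonneg x y) (Ne.symm ?_)
  rcases h.2 with h | h
  · exact h
  · rwa [P.ω_symm]

lemma exists_hop (η : P.State) {x y : Fin P.N} (h : 0 < P.ω x y) (hx : 0 < η.1 x)
    (hy : η.1 y = 0) : ∃ η' : P.State, Hop η η' ∧ η'.1 y = 1 ∧ η'.1 x = η.1 x - 1 ∧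
      ∀ z, z ≠ x → z ≠ y → η'.1 z = η.1 z := by
  have hr := η.room_pos_of_eq_zero hy
  have hne := ne_of_conductance h
  refine ⟨_, ⟨x, y, h, hx, hr, rfl⟩, ?_, ?_, fun z hzx hzy => ?_⟩ <;> rw [bulkMove_val hx hr.ne']
  · rw [add_same, remove_of_ne _ hne.symm, hy]
  · rw [add_of_ne _ hne, remove_same]
  · rw [add_of_ne _ hzy, remove_of_ne _ hzx]

lemma Reach.sum_eq {η η' : P.State} (h : Reach η η') : ∑ z, η'.1 z = ∑ z, η.1 z := by
  induction h with
  | refl => rfl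
  | tail _ h ih =>
    obtain ⟨x, y, -, -, -, rfl⟩ := h
    rw [sum_bulkMove, ih]

/-- When the next site of the walk is occupied, the particle there takes over, so every jump made
has an empty target and exclusion is no obstacle. -/
lemma exists_reach_walk {z x : Fin P.N}
    (p : (SimpleGraph.fromRel fun x y => P.ω x y ≠ 0).Walk z x) (η : P.State) (hz : 0 < η.1 z) :
    ∃ η', Reach η η' ∧ 0 < η'.1 x := by
  induction p generalizing η with
  | nil => exact ⟨η, .refl, hz⟩
  | @cons z z' x h p ih =>
    rcases Nat.eq_zero_or_pos (η.1 z') with h0 | h0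
    · obtain ⟨η₁, h1, h2, -⟩ := η.exists_hop (conductance_of_adj h) hz h0
      obtain ⟨η', h3, h4⟩ := ih η₁ (by omega)
      exact ⟨η', .head h1 h3, h4⟩
    · exact ih η h0

lemma exists_reach (η : P.State) (h : 0 < ∑ z, η.1 z) (x : Fin P.N) :
    ∃ η', Reach η η' ∧ 0 < η'.1 x := by
  obtain ⟨z, -, hz⟩ := Finset.exists_ne_zero_of_sum_ne_zero h.ne'
  obtain ⟨p⟩ := P.connected.preconnected z x
  exact exists_reach_walk p η (Nat.pos_of_ne_zero hz)

/-- A second particle follows the walk towards x while x stays occupied. Once it is next to x, the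
particle at x hops to y and the follower refills x if needed. Reaching y earlier is also a success.
-/
lemma exists_reach_pair_walk {z x y : Fin P.N} (hxy : 0 < P.ω x y)
    (p : (SimpleGraph.fromRel fun x y => P.ω x y ≠ 0).Walk z x) (η : P.State) (hzx : z ≠ x)
    (hz : 0 < η.1 z) (hx : 0 < η.1 x) : ∃ η', Reach η η' ∧ 0 < η'.1 x ∧ 0 < η'.1 y := by
  induction p generalizing η with
  | nil => exact absurd rfl hzx
  | @cons z z' x h p ih =>
    have hne := ne_of_conductance hxy
    rcases Nat.eq_zero_or_pos (η.1 y) with hy | hy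
    swap
    · exact ⟨η, .refl, hx, hy⟩
    have hzy : z ≠ y := by rintro rfl; omega
    by_cases hx' : z' = x
    · subst hx'
      obtain ⟨η₁, h1, h2, h3, h4⟩ := η.exists_hop hxy hx hy
      rcases Nat.eq_zero_or_pos (η₁.1 z') with h5 | h5
      · have h6 := h4 z hzx hzy
        obtain ⟨η₂, h7, h8, -, h9⟩ := η₁.exists_hop (conductance_of_adj h) (by omega) h5
        have h10 := h9 y hzy.symm hne.symm
        exact ⟨η₂, .head h1 (.single h7), by omega, by omega⟩
      · exact ⟨η₁, .single h1, h5, by omega⟩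
    · rcases Nat.eq_zero_or_pos (η.1 z') with h0 | h0
      · obtain ⟨η₁, h1, h2, -, h4⟩ := η.exists_hop (conductance_of_adj h) hz h0
        have h5 := h4 x hzx.symm (Ne.symm hx')
        obtain ⟨η', h6, h7⟩ := ih hxy η₁ hx' (by omega) (by omega)
        exact ⟨η', .head h1 h6, h7⟩
      · exact ih hxy η hx' h0 hx

/-- Two particles can be brought to the endpoints of any given bond. -/
lemma exists_reach_pair (η : P.State) (h : 2 ≤ ∑ z, η.1 z) {x y : Fin P.N} (hxy : 0 < P.ω x y) :
    ∃ η', Reach η η' ∧ 0 < η'.1 x ∧ 0 < η'.1 y := by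
  obtain ⟨η₁, h1, hx⟩ := η.exists_reach (by omega) x
  have hsum := h1.sum_eq
  rcases Nat.eq_zero_or_pos (η₁.1 y) with hy | hy
  swap
  · exact ⟨η₁, h1, hx, hy⟩
  by_cases hx2 : 2 ≤ η₁.1 x
  · obtain ⟨η₂, h2, h3, h4, -⟩ := η₁.exists_hop hxy hx hy
    exact ⟨η₂, h1.tail h2, by omega, by omega⟩
  · have h5 : ∑ z ∈ Finset.univ.erase x, η₁.1 z ≠ 0 := by
      have := Finset.add_sum_erase Finset.univ η₁.1 (Finset.mem_univ x)
      omega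
    obtain ⟨z, hz, hz0⟩ := Finset.exists_ne_zero_of_sum_ne_zero h5
    obtain ⟨p⟩ := P.connected.preconnected z x
    obtain ⟨η₂, h6, h7⟩ := exists_reach_pair_walk hxy p η₁ (Finset.ne_of_mem_erase hz)
      (Nat.pos_of_ne_zero hz0) hx
    exact ⟨η₂, h1.trans h6, h7⟩

/-- The empty configuration. -/
def empty : P.State := ⟨fun _ => 0, fun _ _ => Nat.zero_le _⟩

lemma eq_empty_of_sum {η : P.State} (h : ∑ z, η.1 z = 0) : η = empty := by
  refine Subtype.ext (funext fun z => ?_)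
  have := Finset.single_le_sum (f := η.1) (fun _ _ => Nat.zero_le _) (Finset.mem_univ z)
  exact Nat.le_zero.1 (this.trans h.le)

end State

/-- Properties that propagate backwards along bulk jumps hold for all dual configurations with two
bulk particles as soon as they hold when both endpoints of some bond are occupied. -/
lemma dual_induction {C : P.DualLevel n → Prop} {x y : Fin P.N} (hxy : 0 < P.ω x y)
    (hstep : ∀ (ξ : P.DualLevel n) x y, 0 < dualRate (Sum.inl (x, y)) ξ →
      C (ξ.bulkMove x y) → C ξ)
    (hbase : ∀ ξ : P.DualLevel n, 0 < ξ.at_ x → 0 < ξ.at_ y → C ξ)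
    (ξ : P.DualLevel n) (h : 2 ≤ ∑ z, ξ.at_ z) : C ξ := by
  obtain ⟨η', hr, h1, h2⟩ := ξ.1.bulk.exists_reach_pair h hxy
  -- The path lives on bulk configurations, so the induction quantifies over all dual configurations
  -- lying above its starting point.
  have key : ∀ ζ : P.DualLevel n, ζ.1.bulk = ξ.1.bulk → C ζ := by
    clear h
    generalize ξ.1.bulk = η at hr
    induction hr using Relation.ReflTransGen.head_induction_on with
    | refl =>
      rintro ζ rfl
      exact hbase ζ h1 h2
    | head hop _ ih =>
      rintro ζ rfl
      obtain ⟨a, b, hab, ha, hb, rfl⟩ := hop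
      refine hstep ζ a b ?_ (ih _ rfl)
      exact mul_pos hab (mul_pos (by exact_mod_cast ha) hb)
  exact key ξ rfl

/-- For exclusion the exit rate is proportional to 1 - θ, and two different values of θ cannot both
equal one. -/
lemma exists_exit_pos (hσ : P.σ = -1 ∨ P.σ = 1) (hθ : P.θL ≠ P.θR) :
    ∃ b, 0 < P.resα b + (P.σ : ℝ) * (P.resα b * P.resθ b) := by
  rcases sigma_eq hσ with ⟨h1, h2⟩ | ⟨h1, h2⟩
  · have hlt : ∃ b, P.resθ b < 1 := by
      by_contra! hcon
      have hL := le_antisymm (P.θL_le_one h1) (hcon false)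
      have hR := le_antisymm (P.θR_le_one h1) (hcon true)
      exact hθ (hL.trans hR.symm)
    obtain ⟨b, hb⟩ := hlt
    have := resα_pos (P := P) b
    refine ⟨b, ?_⟩
    rw [h2]
    nlinarith
  · refine ⟨false, ?_⟩
    have := resα_pos (P := P) false
    have := resθ_nonneg (P := P) false
    rw [h2]
    positivity

/-- The empty configuration is charged at all positive times. -/
lemma semigroup_empty_pos (hσ : P.σ = -1 ∨ P.σ = 1) (hω : ∀ b, 0 < P.resω b)
    (hθ : P.θL ≠ P.θR) {f : P.State → ℝ≥0∞} (hf : f State.empty ≠ 0) (η : P.State) {t : ℝ}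
    (ht : 0 < t) : 0 < semigroup P.rate t f η := by
  have hQ := isRateMatrix_rate (P := P)
  have hr := moveRate_nonneg hσ
  obtain ⟨b, hb⟩ := exists_exit_pos hσ hθ
  have hreach : ∀ η η' : P.State, State.Reach η η' →
      (∀ t, 0 < t → 0 < semigroup P.rate t f η') → ∀ t, 0 < t → 0 < semigroup P.rate t f η := by
    intro η η' h hη'
    induction h using Relation.ReflTransGen.head_induction_on with
    | refl => exact hη'
    | @head η η₁ hop _ ih =>
      intro t ht
      obtain ⟨x, y, hxy, hx, hy, rfl⟩ := hop
      have hne : η.bulkMove x y ≠ η := fun h => by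
        have h1 := congrArg (fun ζ : P.State => ζ.1 y) h
        simp only [State.bulkMove_val hx hy.ne', add_same,
          remove_of_ne _ (State.ne_of_conductance hxy).symm] at h1
        omega
      exact semigroup_pos_of_step P.rate hne (hQ.pos hr (m := Sum.inl (x, y)) hne
        (mul_pos hxy (mul_pos (by exact_mod_cast hx) hy))) ih ht
  -- Induction on the particle number: bring a particle to the open reservoir and let it leave.
  have key : ∀ k : ℕ, ∀ η : P.State, ∑ z, η.1 z = k →
      ∀ t, 0 < t → 0 < semigroup P.rate t f η := by
    intro k
    induction k with
    | zero =>
      intro η h t _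
      rw [State.eq_empty_of_sum h]
      exact semigroup_pos_of_ne_zero P.rate hf t
    | succ k ih =>
      intro η h
      obtain ⟨η', h1, h2⟩ := η.exists_reach (by omega) (P.site b)
      refine hreach η η' h1 fun t ht => ?_
      have h3 := State.sum_removeAt h2
      have h4 := h1.sum_eq
      have hne : η'.removeAt (P.site b) ≠ η' := fun h => by
        rw [h] at h3
        omega
      refine semigroup_pos_of_step P.rate hne (hQ.pos hr (m := Sum.inr (Sum.inl b)) hne
        (mul_pos (hω b) (mul_pos (by exact_mod_cast h2) hb))) (ih _ (by omega)) ht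
  exact key _ η rfl t ht

end BoundaryDriven

/-! ### Invariant weights of a stochastic kernel -/

namespace FellerChain

variable {S : Type*}

lemma eq_of_le_of_tsum_eq {a b : S → ℝ≥0∞} (h : ∀ x, a x ≤ b x) (hs : ∑' x, b x ≤ ∑' x, a x)
    (ha : ∑' x, a x ≠ ∞) : a = b := by
  ext x
  by_contra hne
  exact absurd hs (not_le.2 (ENNReal.tsum_lt_tsum ha h (lt_of_le_of_ne (h x) hne)))

/-- Pushing a weight forward by a stochastic kernel preserves its mass. -/
lemma tsum_tsum_mul_kernel {k : S → S → ℝ≥0∞} (hk : ∀ x, ∑' y, k x y = 1) (a : S → ℝ≥0∞) :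
    ∑' y, ∑' x, a x * k x y = ∑' x, a x := by
  rw [ENNReal.tsum_comm]
  refine tsum_congr fun x => ?_
  rw [ENNReal.tsum_mul_left, hk, mul_one]

/-- A stochastic kernel that charges some point from everywhere has at most one invariant
probability weight. -/
lemma invariant_unique {k : S → S → ℝ≥0∞} (hk : ∀ x, ∑' y, k x y = 1) {y₀ : S}
    (hy₀ : ∀ x, k x y₀ ≠ 0) {a b : S → ℝ≥0∞} (ha : ∑' x, a x = 1) (hb : ∑' x, b x = 1)
    (hka : ∀ y, ∑' x, a x * k x y = a y) (hkb : ∀ y, ∑' x, b x * k x y = b y) : a = b := by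
  -- The positive part of a - b lies below its image under the kernel, which has the same mass; so
  -- it is invariant and, if nonzero, charges y₀. Whichever weight is smaller at y₀ is thus smaller
  -- everywhere, and equal masses force equality.
  have key : ∀ a b : S → ℝ≥0∞, ∑' x, a x = 1 → (∀ y, ∑' x, a x * k x y = a y) →
      (∀ y, ∑' x, b x * k x y = b y) → ∀ x, b x < a x → b y₀ < a y₀ := by
    intro a b ha hka hkb x hx
    have hle : ∀ y, a y - b y ≤ ∑' x, (a x - b x) * k x y := by
      intro y
      rw [tsub_le_iff_left]
      calc a y = ∑' x, a x * k x y := (hka y).symm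
        _ ≤ ∑' x, (b x * k x y + (a x - b x) * k x y) := by
          refine ENNReal.tsum_le_tsum fun x => ?_
          rw [← add_mul]
          gcongr
          exact le_add_tsub
        _ = _ := by rw [ENNReal.tsum_add, hkb]
    have hfin : ∑' x, (a x - b x) ≠ ∞ := by
      refine ne_top_of_le_ne_top ENNReal.one_ne_top (ha ▸ ?_)
      exact ENNReal.tsum_le_tsum fun x => tsub_le_self
    have heq := eq_of_le_of_tsum_eq hle (tsum_tsum_mul_kernel hk _).le hfin
    have h0 := congrFun heq y₀
    rw [← tsub_pos_iff_lt, h0]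
    refine lt_of_lt_of_le ?_ (ENNReal.le_tsum x)
    exact ENNReal.mul_pos (tsub_pos_iff_lt.2 hx).ne' (hy₀ x)
  rcases le_total (a y₀) (b y₀) with h | h
  · refine eq_of_le_of_tsum_eq (fun x => ?_) (by rw [ha, hb]) (by simp [ha])
    by_contra! hx
    exact absurd (key a b ha hka hkb x hx) (not_lt.2 h)
  · refine (eq_of_le_of_tsum_eq (fun x => ?_) (by rw [ha, hb]) (by simp [hb])).symm
    by_contra! hx
    exact absurd (key b a hb hkb hka x hx) (not_lt.2 h)

open Filter Topology in
/-- The Krylov-Bogoliubov construction of an invariant probability weight. -/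
lemma exists_invariant {k : S → S → ℝ≥0∞} (hk : ∀ x, ∑' y, k x y = 1) {q : ℕ → S → ℝ≥0∞}
    (hq1 : ∀ j, ∑' x, q j x = 1) (hqk : ∀ j y, ∑' x, q j x * k x y = q (j + 1) y)
    {V : S → ℝ≥0∞} (hV : ∀ R : ℕ, {x | V x ≤ R}.Finite) {C : ℝ≥0∞} (hC : C ≠ ∞)
    (hVC : ∀ j, ∑' x, q j x * V x ≤ C) :
    ∃ a : S → ℝ≥0∞, ∑' x, a x = 1 ∧ (∀ y, ∑' x, a x * k x y = a y) ∧
      ∀ (f : S → ℝ≥0∞) (D : ℝ≥0∞), (∀ x, f x ≠ ∞) → (∀ j, ∑' x, q j x * f x ≤ D) →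
        ∑' x, a x * f x ≤ D := by
  -- Cesàro averages along the orbit. Applying the kernel shifts the sum by one index, so each
  -- weight grows by at most 1 / (n + 1).
  set m : ℕ → S → ℝ≥0∞ := fun n x => ((n + 1 : ℕ) : ℝ≥0∞)⁻¹ * ∑ j ∈ Finset.range (n + 1), q j x
    with hm
  have hinv : ∀ n : ℕ, ((n + 1 : ℕ) : ℝ≥0∞)⁻¹ * ((n + 1 : ℕ) : ℝ≥0∞) = 1 := fun n =>
    ENNReal.inv_mul_cancel (by simp) (ENNReal.natCast_ne_top _)
  have hmf : ∀ n (f : S → ℝ≥0∞), ∑' x, m n x * f x =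
      ((n + 1 : ℕ) : ℝ≥0∞)⁻¹ * ∑ j ∈ Finset.range (n + 1), ∑' x, q j x * f x := by
    intro n f
    rw [← Summable.tsum_finsetSum fun _ _ => ENNReal.summable, ← ENNReal.tsum_mul_left]
    refine tsum_congr fun x => ?_
    rw [hm, mul_assoc, Finset.sum_mul]
  have hmfD : ∀ n (f : S → ℝ≥0∞) (D : ℝ≥0∞), (∀ j, ∑' x, q j x * f x ≤ D) →
      ∑' x, m n x * f x ≤ D := by
    intro n f D h
    rw [hmf]
    calc _ ≤ ((n + 1 : ℕ) : ℝ≥0∞)⁻¹ * ∑ j ∈ Finset.range (n + 1), D := by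
          gcongr with j; exact h j
      _ = D := by
          rw [Finset.sum_const, Finset.card_range, nsmul_eq_mul, ← mul_assoc, hinv, one_mul]
  have hm1 : ∀ n, ∑' x, m n x = 1 := by
    intro n
    have h := hmf n fun _ => 1
    simp only [mul_one, hq1, Finset.sum_const, Finset.card_range, nsmul_eq_mul] at h
    rw [h, hinv]
  have hmk : ∀ n y, ∑' x, m n x * k x y ≤ m n y + ((n + 1 : ℕ) : ℝ≥0∞)⁻¹ := by
    intro n y
    rw [hmf]
    simp only [hqk, hm]
    calc _ ≤ ((n + 1 : ℕ) : ℝ≥0∞)⁻¹ * ∑ j ∈ Finset.range (n + 1 + 1), q j y := by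
          rw [Finset.sum_range_succ' _ (n + 1)]
          gcongr
          exact le_self_add
      _ ≤ ((n + 1 : ℕ) : ℝ≥0∞)⁻¹ * (∑ j ∈ Finset.range (n + 1), q j y + 1) := by
          rw [Finset.sum_range_succ _ (n + 1)]
          gcongr
          exact (ENNReal.le_tsum y).trans (hq1 _).le
      _ = _ := by rw [mul_add, mul_one]
  -- A limit along an ultrafilter exists at all points simultaneously by compactness of [0, ∞],
  -- without extracting subsequences.
  set U : Ultrafilter ℕ := hyperfilter ℕ
  have hlim : ∀ x, ∃ c, Tendsto (fun n => m n x) U (𝓝 c) := fun x =>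
    ⟨_, (U.map fun n => m n x).le_nhds_lim⟩
  choose a ha using hlim
  have hsum : ∀ (F : Finset S) (f : S → ℝ≥0∞), (∀ x, f x ≠ ∞) →
      Tendsto (fun n => ∑ x ∈ F, m n x * f x) U (𝓝 (∑ x ∈ F, a x * f x)) := fun F f hf =>
    tendsto_finsetSum F fun x _ => ENNReal.Tendsto.mul_const (ha x) (Or.inr (hf x))
  have hbound : ∀ (f : S → ℝ≥0∞) (D : ℝ≥0∞), (∀ x, f x ≠ ∞) → (∀ j, ∑' x, q j x * f x ≤ D) →
      ∑' x, a x * f x ≤ D := by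
    intro f D hf h
    rw [ENNReal.tsum_eq_iSup_sum]
    refine iSup_le fun F => le_of_tendsto (hsum F f hf) (Eventually.of_forall fun n => ?_)
    exact (ENNReal.sum_le_tsum F).trans (hmfD n f D h)
  have hk1 : ∀ x y, k x y ≠ ∞ := fun x y =>
    ne_top_of_le_ne_top ENNReal.one_ne_top ((ENNReal.le_tsum y).trans (hk x).le)
  have hle1 : ∑' x, a x ≤ 1 := by
    simpa using hbound (fun _ => 1) 1 (fun _ => ENNReal.one_ne_top) (by simp [hq1])
  -- No mass escapes: by Markov's inequality the averages put all but C / (R + 1) of their mass on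
  -- the finite set where V ≤ R + 1.
  have hge1 : 1 ≤ ∑' x, a x := by
    have hR : ∀ R : ℕ, 1 ≤ ∑' x, a x + C / ((R + 1 : ℕ) : ℝ≥0∞) := by
      intro R
      have hR0 : ((R + 1 : ℕ) : ℝ≥0∞) ≠ 0 := by simp
      have h1 : ∀ n, 1 ≤ ∑ x ∈ (hV (R + 1)).toFinset, m n x * 1 + C / ((R + 1 : ℕ) : ℝ≥0∞) := by
        intro n
        classical
        calc (1 : ℝ≥0∞) = ∑' x, m n x := (hm1 n).symm
          _ ≤ ∑' x, ((if x ∈ (hV (R + 1)).toFinset then m n x * 1 else 0) +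
              m n x * V x / ((R + 1 : ℕ) : ℝ≥0∞)) := by
            refine ENNReal.tsum_le_tsum fun x => ?_
            split_ifs with hx
            · rw [mul_one]; exact le_self_add
            · rw [zero_add, mul_div_assoc]
              refine le_mul_of_one_le_right zero_le ?_
              rw [ENNReal.le_div_iff_mul_le (Or.inl hR0) (Or.inl (ENNReal.natCast_ne_top _)),
                one_mul]
              simp only [Set.Finite.mem_toFinset, Set.mem_ofPred_eq, not_le] at hx
              exact hx.le
          _ ≤ _ := by
            rw [ENNReal.tsum_add]
            gcongr
            · rw [tsum_eq_sum (s := (hV (R + 1)).toFinset) (fun x hx => if_neg hx)]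
              exact (Finset.sum_congr rfl fun x hx => if_pos hx).le
            · simp_rw [div_eq_mul_inv]
              rw [ENNReal.tsum_mul_right]
              gcongr
              exact hmfD n V C hVC
      have h2 := (hsum (hV (R + 1)).toFinset (fun _ => 1) fun _ => ENNReal.one_ne_top).add_const
        (C / ((R + 1 : ℕ) : ℝ≥0∞))
      refine (ge_of_tendsto h2 (Eventually.of_forall h1)).trans ?_
      gcongr
      simpa using ENNReal.sum_le_tsum (f := a) (hV (R + 1)).toFinset
    have hlimR : Tendsto (fun R : ℕ => ∑' x, a x + C / ((R + 1 : ℕ) : ℝ≥0∞)) atTop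
        (𝓝 (∑' x, a x + 0)) := by
      refine tendsto_const_nhds.add ?_
      have h3 : Tendsto (fun R : ℕ => C / (R : ℝ≥0∞)) atTop (𝓝 0) := by
        have := ENNReal.Tendsto.const_div ENNReal.tendsto_nat_nhds_top (Or.inr hC)
        simpa using this
      exact h3.comp (tendsto_add_atTop_nat 1)
    rw [add_zero] at hlimR
    exact ge_of_tendsto hlimR (Eventually.of_forall hR)
  -- Fatou yields only this inequality; equality follows because the kernel preserves the finite
  -- total mass.
  have hak : ∀ y, ∑' x, a x * k x y ≤ a y := by
    intro y
    rw [ENNReal.tsum_eq_iSup_sum]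
    refine iSup_le fun F => ?_
    have h1 : Tendsto (fun n => m n y + ((n + 1 : ℕ) : ℝ≥0∞)⁻¹) U (𝓝 (a y + 0)) := by
      refine (ha y).add (Tendsto.mono_left ?_ Nat.hyperfilter_le_atTop)
      exact ENNReal.tendsto_inv_nat_nhds_zero.comp (tendsto_add_atTop_nat 1)
    rw [add_zero] at h1
    refine le_of_tendsto_of_tendsto' (hsum F (fun x => k x y) fun x => hk1 x y) h1 fun n => ?_
    exact (ENNReal.sum_le_tsum F).trans (hmk n y)
  refine ⟨a, le_antisymm hle1 hge1, fun y => ?_, hbound⟩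
  have hs := tsum_tsum_mul_kernel hk a
  exact congrFun (eq_of_le_of_tsum_eq hak hs.ge
    (by rw [hs]; exact ne_top_of_le_ne_top ENNReal.one_ne_top hle1)) y

end FellerChain

/-! ### The transition function as a stochastic kernel -/

namespace FellerChain

variable {S : Type*} (Q : S → S → ℝ)

open Classical in
lemma semigroup_indicator (t : ℝ) (x z : S) :
    semigroup Q t (fun y => if y = z then 1 else 0) x = transitionProb Q t x z := by
  unfold semigroup
  rw [tsum_eq_single z fun y hy => by simp [hy]]
  simp

lemma tsum_transitionProb_mul [Countable S]
    (h1 : ∀ t, 0 ≤ t → ∀ x, semigroup Q t (fun _ => 1) x = 1) {s t : ℝ} (hs : 0 ≤ s)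
    (ht : 0 ≤ t) (x z : S) :
    ∑' y, transitionProb Q t x y * transitionProb Q s y z = transitionProb Q (t + s) x z := by
  classical
  rw [← semigroup_indicator, ← semigroup_semigroup Q h1 (fun y => by split_ifs <;> simp) hs ht]
  simp_rw [funext fun y => semigroup_indicator Q s y z]
  rfl

lemma tsum_transitionProb (h1 : ∀ t, 0 ≤ t → ∀ x, semigroup Q t (fun _ => 1) x = 1) {t : ℝ}
    (ht : 0 ≤ t) (x : S) : ∑' y, transitionProb Q t x y = 1 := by
  rw [← h1 t ht x]
  simp [semigroup]

end FellerChain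

/-! ### Existence, uniqueness and moments of the stationary measure -/

namespace BoundaryDriven

open FellerChain

variable {P : BoundaryDriven} {n : ℕ}

instance : DiscreteMeasurableSpace P.State := ⟨fun _ => trivial⟩

lemma law_singleton (μ : Measure P.State) (t : ℝ) (y : P.State) :
    P.law μ t {y} = ∑' x, μ {x} * transitionProb P.rate t x y := by
  classical
  rw [← lintegral_indicator_one (measurableSet_singleton y), lintegral_law, lintegral_countable']
  refine tsum_congr fun x => ?_
  rw [← semigroup_indicator, mul_comm]
  congr 2

lemma State.size_empty : (empty : P.State).size = 0 := by simp [size, empty]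

/-- The dual configuration with a single particle at `x`. -/
noncomputable def DualLevel.single (P : BoundaryDriven) (x : Fin P.N) :
    P.DualLevel 1 :=
  ⟨⟨⟨Pi.single x 1, fun _ z => by
    by_cases hz : z = x
    · subst hz; simpa using Nat.succ_le_of_lt (P.α_pos z)
    · simp [hz]⟩, 0, 0⟩, by simp⟩

lemma Dcl_single (hσ : P.σ = -1 ∨ P.σ = 1) (x : Fin P.N) (η : P.State) :
    P.Dcl (DualLevel.single P x).1 η = η.1 x / P.α x := by
  rw [Dcl_eq, bulkDual, prod_erase_single x, Finset.prod_eq_one]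
  · simp [DualLevel.single, factor_one hσ]
  · intro z hz
    simp [DualLevel.single, Finset.ne_of_mem_erase hz, factor_zero]

lemma size_eq_sum_Dcl (hσ : P.σ = -1 ∨ P.σ = 1) (η : P.State) :
    η.size = ∑ x, P.α x * P.Dcl (DualLevel.single P x).1 η := by
  unfold State.size
  push_cast
  refine Finset.sum_congr rfl fun x _ => ?_
  have : (P.α x : ℝ) ≠ 0 := by exact_mod_cast (P.α_pos x).ne'
  rw [Dcl_single hσ]
  field_simp

/-- By duality these moments are the dual semigroup applied to a bounded function, hence bounded
uniformly in time. This supplies both tightness and the stationary moments. -/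
lemma exists_semigroup_Dcl_empty_le (hσ : P.σ = -1 ∨ P.σ = 1) (n : ℕ) :
    ∃ C : ℝ, 0 ≤ C ∧ ∀ (ξ : P.DualLevel n) (t : ℝ), 0 ≤ t →
      semigroup P.rate t (fun ζ => ENNReal.ofReal (P.Dcl ξ.1 ζ)) State.empty ≤
        ENNReal.ofReal C := by
  obtain ⟨C, hC0, hC⟩ := exists_Dcl_le P n
  refine ⟨C, hC0, fun ξ t ht => ?_⟩
  rw [semigroup_Dcl hσ ξ ht]
  refine ENNReal.ofReal_le_ofReal (heat_le dualMove (dualRate_nonneg hσ) (fun ζ => ?_) ht ξ)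
  simpa [State.size_empty] using hC ζ State.empty

/-- Existence and uniqueness of the stationary measure, which has all moments. -/
theorem exists_stationary (hσ : P.σ = -1 ∨ P.σ = 1) (hω : ∀ b, 0 < P.resω b)
    (hθ : P.θL ≠ P.θR) :
    ∃ μ : Measure P.State, IsProbabilityMeasure μ ∧ P.IsStationary μ ∧
      (∀ μ' : Measure P.State, IsProbabilityMeasure μ' → P.IsStationary μ' → μ' = μ) ∧
      ∀ (n : ℕ) (ξ : P.DualLevel n), ∫⁻ η, ENNReal.ofReal (P.Dcl ξ.1 η) ∂μ ≠ ∞ := by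
  have h1 : ∀ t, 0 ≤ t → ∀ η, semigroup P.rate t (fun _ => 1) η = 1 :=
    fun t ht η => semigroup_one hσ ht η
  have hk : ∀ x, ∑' y, transitionProb P.rate 1 x y = 1 :=
    tsum_transitionProb P.rate h1 zero_le_one
  have hpos : ∀ x, transitionProb P.rate 1 x State.empty ≠ 0 := by
    classical
    intro x
    rw [← semigroup_indicator]
    exact (semigroup_empty_pos hσ hω hθ (by simp) x one_pos).ne'
  obtain ⟨C, hC0, hC⟩ := exists_semigroup_Dcl_empty_le hσ 1
  -- Krylov-Bogoliubov for the chain observed at integer times, started from the empty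
  -- configuration, with the particle number as tightness function.
  obtain ⟨a, ha1, hak, haf⟩ := exists_invariant hk
    (q := fun j y => transitionProb P.rate j State.empty y)
    (fun j => tsum_transitionProb P.rate h1 (Nat.cast_nonneg j) _)
    (fun j y => by
      rw [tsum_transitionProb_mul P.rate h1 zero_le_one (Nat.cast_nonneg j)]; push_cast; rfl)
    (V := fun η => ENNReal.ofReal η.size)
    (fun R => by
      refine (State.finite_size_le R).subset fun η hη => ?_
      simp only [Set.mem_ofPred_eq] at hη ⊢
      rwa [← ENNReal.ofReal_natCast, ENNReal.ofReal_le_ofReal_iff (Nat.cast_nonneg _)] at hη)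
    (C := ∑ x, ENNReal.ofReal (P.α x) * ENNReal.ofReal C)
    (ENNReal.sum_ne_top.2 fun x _ => ENNReal.mul_ne_top ENNReal.ofReal_ne_top
      ENNReal.ofReal_ne_top)
    (fun j => by
      have h2 : ∀ η : P.State, transitionProb P.rate j State.empty η * ENNReal.ofReal η.size =
          ∑ x, ENNReal.ofReal (P.α x) * (transitionProb P.rate j State.empty η *
            ENNReal.ofReal (P.Dcl (DualLevel.single P x).1 η)) := by
        intro η
        rw [size_eq_sum_Dcl hσ, ENNReal.ofReal_sum_of_nonneg
          (fun x _ => mul_nonneg (Nat.cast_nonneg _) (Dcl_nonneg _ _)), Finset.mul_sum]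
        refine Finset.sum_congr rfl fun x _ => ?_
        rw [ENNReal.ofReal_mul (Nat.cast_nonneg _)]
        ring
      simp_rw [h2]
      rw [Summable.tsum_finsetSum fun _ _ => ENNReal.summable]
      refine Finset.sum_le_sum fun x _ => ?_
      rw [ENNReal.tsum_mul_left]
      gcongr
      exact hC _ _ (Nat.cast_nonneg j))
  set μ : Measure P.State := Measure.sum fun η => a η • Measure.dirac η with hμ
  have hμf : ∀ f : P.State → ℝ≥0∞, ∫⁻ η, f η ∂μ = ∑' η, a η * f η := by
    intro f
    rw [hμ, lintegral_sum_measure]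
    simp [lintegral_smul_measure]
  have hμs : ∀ y, μ {y} = a y := by
    classical
    intro y
    rw [← lintegral_indicator_one (measurableSet_singleton y), hμf, tsum_eq_single y]
    · simp
    · intro z hz; simp [hz]
  have huniq : ∀ b : P.State → ℝ≥0∞, ∑' x, b x = 1 →
      (∀ y, ∑' x, b x * transitionProb P.rate 1 x y = b y) → b = a := fun b hb1 hbk =>
    invariant_unique hk hpos hb1 ha1 hbk hak
  have hmass : ∀ ν : Measure P.State, IsProbabilityMeasure ν → ∑' x, ν {x} = 1 := by
    intro ν hν
    have := lintegral_countable' (μ := ν) fun _ => 1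
    simpa using this.symm
  refine ⟨μ, ⟨?_⟩, fun t ht => Measure.ext_of_singleton fun y => ?_, fun μ' hμ' hst => ?_, ?_⟩
  · rw [← lintegral_one, hμf]
    simpa using ha1
  · rw [law_singleton]
    simp_rw [hμs]
    -- The kernels at times t and 1 commute, so the image of a at time t is again invariant for the
    -- time-one kernel; uniqueness identifies it with a.
    refine congrFun (huniq (fun y => ∑' x, a x * transitionProb P.rate t x y) ?_ fun z => ?_) y
    · rw [tsum_tsum_mul_kernel (tsum_transitionProb P.rate h1 ht), ha1]
    · calc ∑' y, (∑' x, a x * transitionProb P.rate t x y) * transitionProb P.rate 1 y z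
          = ∑' x, a x * ∑' y, transitionProb P.rate t x y * transitionProb P.rate 1 y z := by
            simp_rw [← ENNReal.tsum_mul_right, ← ENNReal.tsum_mul_left]
            rw [ENNReal.tsum_comm]
            simp_rw [mul_assoc]
        _ = ∑' x, a x * ∑' y, transitionProb P.rate 1 x y * transitionProb P.rate t y z := by
            simp_rw [tsum_transitionProb_mul P.rate h1 zero_le_one ht,
              tsum_transitionProb_mul P.rate h1 ht zero_le_one, add_comm]
        _ = ∑' y, (∑' x, a x * transitionProb P.rate 1 x y) * transitionProb P.rate t y z := by
            simp_rw [← ENNReal.tsum_mul_right, ← ENNReal.tsum_mul_left]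
            rw [ENNReal.tsum_comm]
            simp_rw [mul_assoc]
        _ = _ := by simp_rw [hak]
  · refine Measure.ext_of_singleton fun y => ?_
    rw [hμs]
    refine congrFun (huniq (fun y => μ' {y}) (hmass μ' hμ') fun y => ?_) y
    rw [← law_singleton, hst 1 zero_le_one]
  · intro n ξ
    obtain ⟨D, hD0, hD⟩ := exists_semigroup_Dcl_empty_le hσ n
    rw [hμf]
    exact ne_top_of_le_ne_top ENNReal.ofReal_ne_top
      (haf _ (ENNReal.ofReal D) (fun _ => ENNReal.ofReal_ne_top)
        fun j => hD ξ j (Nat.cast_nonneg j))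

end BoundaryDriven

/-! ### Stationary moments and the harmonic profile -/

namespace BoundaryDriven

open FellerChain

variable {P : BoundaryDriven} {n : ℕ}

/-- The dual semigroup evaluated at one configuration is a finite weighted sum, so it can be
exchanged with integrals over η. -/
lemma exists_heat_eq_sum (t : ℝ) (ξ : P.DualLevel n) :
    ∃ c : P.DualLevel n → ℝ, ∀ f, P.dualHeat n t f ξ = ∑ ζ, f ζ * c ζ := by
  classical
  refine ⟨fun i => P.dualHeat n t (fun j => if i = j then 1 else 0) ξ, fun f => ?_⟩
  have h := LinearMap.pi_apply_eq_sum_univ (P.dualHeat n t).toLinearMap f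
  simpa only [ContinuousLinearMap.coe_coe, Finset.sum_apply, Pi.smul_apply, smul_eq_mul] using
    congrFun h ξ

/-- The expectation of the duality function at time `t`. -/
lemma integral_law_Dcl (hσ : P.σ = -1 ∨ P.σ = 1) {μ : Measure P.State}
    (hint : ∀ ζ : P.DualLevel n, Integrable (P.Dcl ζ.1) μ) {t : ℝ} (ht : 0 ≤ t)
    (ξ : P.DualLevel n) :
    Integrable (P.Dcl ξ.1) (P.law μ t) ∧
      ∫ η, P.Dcl ξ.1 η ∂(P.law μ t) = P.dualHeat n t (fun ζ => ∫ η, P.Dcl ζ.1 η ∂μ) ξ := by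
  have hpos : ∀ η, 0 ≤ P.dualHeat n t (fun ζ => P.Dcl ζ.1 η) ξ := fun η =>
    heat_nonneg dualMove (dualRate_nonneg hσ) (fun ζ => Dcl_nonneg ζ.1 η) ht ξ
  obtain ⟨c, hc⟩ := exists_heat_eq_sum t ξ
  have hint' : Integrable (fun η => P.dualHeat n t (fun ζ => P.Dcl ζ.1 η) ξ) μ := by
    simp_rw [hc]
    exact integrable_finsetSum _ fun ζ _ => (hint ζ).mul_const _
  have hval : ∫ η, P.dualHeat n t (fun ζ => P.Dcl ζ.1 η) ξ ∂μ =
      P.dualHeat n t (fun ζ => ∫ η, P.Dcl ζ.1 η ∂μ) ξ := by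
    simp_rw [hc]
    rw [integral_finsetSum _ fun ζ _ => (hint ζ).mul_const _]
    simp_rw [integral_mul_const]
  have hlint : ∫⁻ η, ENNReal.ofReal (P.Dcl ξ.1 η) ∂(P.law μ t) =
      ENNReal.ofReal (P.dualHeat n t (fun ζ => ∫ η, P.Dcl ζ.1 η ∂μ) ξ) := by
    rw [lintegral_law]
    simp_rw [semigroup_Dcl hσ ξ ht]
    rw [← hval, ofReal_integral_eq_lintegral_ofReal hint' (Filter.Eventually.of_forall hpos)]
  have hmeas : AEStronglyMeasurable (P.Dcl ξ.1) (P.law μ t) :=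
    (measurable_from_top (f := P.Dcl ξ.1)).aestronglyMeasurable
  have hnn : 0 ≤ᵐ[P.law μ t] P.Dcl ξ.1 := Filter.Eventually.of_forall fun η => Dcl_nonneg _ η
  refine ⟨⟨hmeas, ?_⟩, ?_⟩
  · rw [hasFiniteIntegral_iff_ofReal hnn, hlint]
    exact ENNReal.ofReal_lt_top
  · rw [integral_eq_lintegral_of_nonneg_ae hnn hmeas, hlint, ENNReal.toReal_ofReal]
    exact heat_nonneg dualMove (dualRate_nonneg hσ)
      (fun ζ => integral_nonneg fun η => Dcl_nonneg ζ.1 η) ht ξ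

/-- The stationary moments are harmonic for the dual process. -/
lemma gen_stationary (hσ : P.σ = -1 ∨ P.σ = 1) {μ : Measure P.State}
    (hst : P.IsStationary μ) (hint : ∀ ζ : P.DualLevel n, Integrable (P.Dcl ζ.1) μ)
    (ξ : P.DualLevel n) :
    gen dualRate dualMove (fun ζ : P.DualLevel n => ∫ η, P.Dcl ζ.1 η ∂μ) ξ = 0 := by
  set G : P.DualLevel n → ℝ := fun ζ => ∫ η, P.Dcl ζ.1 η ∂μ
  have h : ∀ t, 0 ≤ t → P.dualHeat n t G = G := fun t ht => funext fun ζ => by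
    rw [← (integral_law_Dcl hσ hint ht ζ).2, hst t ht]
  have h1 := hasDerivAt_heat dualRate dualMove G 1 ξ
  have h2 : HasDerivAt (fun t => P.dualHeat n t G ξ) 0 1 := by
    refine (hasDerivAt_const (1 : ℝ) (G ξ)).congr_of_eventuallyEq ?_
    filter_upwards [eventually_gt_nhds (zero_lt_one (α := ℝ))] with t ht
    rw [h t ht.le]
  have h3 := h1.unique h2
  rwa [show heat dualRate dualMove 1 G = G from h 1 zero_le_one] at h3

lemma integrable_Dcl {μ : Measure P.State} {ξ : P.DualState}
    (h : ∫⁻ η, ENNReal.ofReal (P.Dcl ξ η) ∂μ ≠ ∞) : Integrable (P.Dcl ξ) μ := by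
  refine ⟨(measurable_from_top (f := P.Dcl ξ)).aestronglyMeasurable, ?_⟩
  rw [hasFiniteIntegral_iff_ofReal (Filter.Eventually.of_forall fun η => Dcl_nonneg _ η)]
  exact h.lt_top

lemma integral_Dcl (μ : Measure P.State) (ξ : P.DualState) :
    ∫ η, P.Dcl ξ η ∂μ =
      P.θL ^ ξ.left * (∫ η, P.bulkDual ξ.bulk.1 η.1 ∂μ) * P.θR ^ ξ.right := by
  simp_rw [Dcl_eq]
  rw [integral_mul_const, integral_const_mul]

/-- The discrete harmonic equation with values `c` in the reservoirs. -/
def IsHarmonic (P : BoundaryDriven) (h : Fin P.N → ℝ) (c : Bool → ℝ) : Prop :=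
  ∀ x, ∑ y, P.ω x y * (P.α y * (h y - h x)) +
    ∑ b, (if P.site b = x then P.resω b * (P.resα b * (c b - h x)) else 0) = 0

lemma IsHarmonic.neg {h : Fin P.N → ℝ} {c : Bool → ℝ} (hh : P.IsHarmonic h c) :
    P.IsHarmonic (fun x => -h x) (fun b => -c b) := by
  intro x
  refine Eq.trans ?_ (neg_eq_zero.2 (hh x))
  rw [neg_add, ← Finset.sum_neg_distrib, ← Finset.sum_neg_distrib]
  congr 1
  · exact Finset.sum_congr rfl fun y _ => by ring
  · refine Finset.sum_congr rfl fun b _ => ?_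
    split_ifs <;> ring

lemma forall_of_adj {p : Fin P.N → Prop} (hp : ∀ x y, 0 < P.ω x y → p x → p y) {x : Fin P.N}
    (hx : p x) (y : Fin P.N) : p y := by
  obtain ⟨w⟩ := P.connected.preconnected x y
  induction w with
  | nil => exact hx
  | cons h _ ih => exact ih (hp _ _ (State.conductance_of_adj h) hx)

/-- The strong maximum principle. -/
lemma IsHarmonic.lt {h : Fin P.N → ℝ} {c : Bool → ℝ} (hh : P.IsHarmonic h c)
    (hω : ∀ b, 0 < P.resω b) (hc : c false ≠ c true) {K : ℝ} (hK : ∀ b, c b ≤ K)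
    (x : Fin P.N) : h x < K := by
  have : Nonempty (Fin P.N) := ⟨x⟩
  obtain ⟨x₀, hx₀⟩ := Finite.exists_max h
  by_contra! hx
  have hM : K ≤ h x₀ := hx.trans (hx₀ x)
  -- At a maximum point all terms of the harmonic equation are nonpositive and sum to zero. So the
  -- maximum spreads to neighbours and to attached reservoirs, and both reservoirs would have the
  -- same value.
  have key : ∀ z, h z = h x₀ → (∀ y, 0 < P.ω z y → h y = h x₀) ∧
      ∀ b, P.site b = z → c b = h x₀ := by
    intro z hz
    have h1 : ∀ y ∈ Finset.univ, P.ω z y * (P.α y * (h y - h z)) ≤ 0 := fun y _ =>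
      mul_nonpos_of_nonneg_of_nonpos (P.ω_nonneg z y) (mul_nonpos_of_nonneg_of_nonpos
        (Nat.cast_nonneg _) (by rw [hz]; linarith [hx₀ y]))
    have h2 : ∀ b ∈ Finset.univ,
        (if P.site b = z then P.resω b * (P.resα b * (c b - h z)) else 0) ≤ 0 := by
      intro b _
      split_ifs
      · exact mul_nonpos_of_nonneg_of_nonpos (hω b).le (mul_nonpos_of_nonneg_of_nonpos
          (resα_pos b).le (by linarith [hK b]))
      · exact le_rfl
    have h3 := Finset.sum_nonpos h1
    have h4 := Finset.sum_nonpos h2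
    have h5 := hh z
    have h6 := (Finset.sum_eq_zero_iff_of_nonpos h1).1 (by linarith)
    have h7 := (Finset.sum_eq_zero_iff_of_nonpos h2).1 (by linarith)
    refine ⟨fun y hy => ?_, fun b hb => ?_⟩
    · have h8 := h6 y (Finset.mem_univ _)
      have hα : (P.α y : ℝ) ≠ 0 := by exact_mod_cast (P.α_pos y).ne'
      simp only [mul_eq_zero, hy.ne', hα, false_or] at h8
      linarith
    · have h8 := h7 b (Finset.mem_univ _)
      simp only [hb, if_true, mul_eq_zero, (hω b).ne', (resα_pos b).ne', false_or] at h8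
      linarith
  have hall : ∀ z, h z = h x₀ := forall_of_adj (p := fun z => h z = h x₀)
    (fun z y hzy hz => (key z hz).1 y hzy) rfl
  exact hc (((key _ (hall _)).2 false rfl).trans ((key _ (hall _)).2 true rfl).symm)

/-- A non-constant harmonic function varies along some bond. -/
lemma IsHarmonic.exists_ne {h : Fin P.N → ℝ} {c : Bool → ℝ} (hh : P.IsHarmonic h c)
    (hN : 2 ≤ P.N) (hω : ∀ b, 0 < P.resω b) (hc : c false ≠ c true) :
    ∃ x y, 0 < P.ω x y ∧ h x ≠ h y := by
  by_contra! hcon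
  have hall : ∀ z, h z = h P.first := forall_of_adj (p := fun z => h z = h P.first)
    (fun z y hzy hz => (hcon z y hzy).symm.trans hz) rfl
  -- With two distinct end sites each reservoir appears alone in its equation, so a constant h would
  -- equal both reservoir values.
  have hne : P.first ≠ P.last := by
    simp only [first, last, ne_eq, Fin.mk.injEq]
    omega
  have hb : ∀ b, c b = h P.first := by
    intro b
    have h1 := hh (P.site b)
    simp only [hall, sub_self, mul_zero, Finset.sum_const_zero, zero_add] at h1
    rw [Finset.sum_eq_single b] at h1
    · simp only [if_true, mul_eq_zero, (hω b).ne', (resα_pos b).ne', false_or] at h1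
      linarith
    · intro b' _ hb'
      rw [if_neg]
      cases b <;> cases b' <;> simp_all [site, hne.symm]
    · simp
  exact hc ((hb false).trans (hb true).symm)

lemma integral_bulkDual_single (hσ : P.σ = -1 ∨ P.σ = 1) (μ : Measure P.State) (y : Fin P.N) :
    ∫ η, P.bulkDual (Pi.single y 1) η.1 ∂μ = P.profile μ y := by
  refine integral_congr_ae (Filter.Eventually.of_forall fun η => ?_)
  have := Dcl_single hσ y η
  simpa [Dcl_eq, DualLevel.single] using this

lemma integral_bulkDual_zero (μ : Measure P.State) [IsProbabilityMeasure μ] :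
    ∫ η : P.State, P.bulkDual 0 η.1 ∂μ = 1 := by
  simp [bulkDual, factor_zero]

/-- The stationary profile is harmonic. -/
lemma isHarmonic_profile (hσ : P.σ = -1 ∨ P.σ = 1) {μ : Measure P.State}
    [IsProbabilityMeasure μ] (hst : P.IsStationary μ)
    (hint : ∀ ζ : P.DualLevel 1, Integrable (P.Dcl ζ.1) μ) :
    P.IsHarmonic (P.profile μ) P.resθ := by
  intro x
  have h1 := gen_stationary hσ hst hint (DualLevel.single P x)
  simp_rw [integral_Dcl] at h1
  rw [dual_gen_eq (fun k => ∫ η, P.bulkDual k η.1 ∂μ)] at h1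
  have hF1 := integral_bulkDual_single hσ μ
  have hF0 := integral_bulkDual_zero μ
  have hs : (DualLevel.single P x).1.bulk.1 = Pi.single x 1 := rfl
  have hl : (DualLevel.single P x).1.left = 0 := rfl
  have hr : (DualLevel.single P x).1.right = 0 := rfl
  have hrem : P.remove (Pi.single x 1) x = 0 := by simp [remove]
  have hadd : ∀ y, P.add 0 y = Pi.single y 1 := fun y => by simp [add]
  simp only [DualLevel.at_, hs, hl, hr, pow_zero, one_mul, mul_one] at h1
  rw [Finset.sum_eq_single x (fun z _ hz => by simp [hz]) (by simp)] at h1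
  refine Eq.trans ?_ h1
  congr 1
  · refine Finset.sum_congr rfl fun y _ => ?_
    by_cases hy : y = x
    · subst hy; simp [P.ω_diag]
    · rw [hrem, hadd, hF1, hF1]
      simp [hy]
  · refine Finset.sum_congr rfl fun b _ => ?_
    split_ifs with hb
    · rw [hb, hrem, hF0, hF1]
      simp
    · simp [hb]

end BoundaryDriven

/-! ### Factorial moments of the local equilibrium measures -/

namespace BoundaryDriven

open FellerChain

variable {P : BoundaryDriven} {n : ℕ}

lemma tsum_prod_pi {m : ℕ} (f : Fin m → ℕ → ℝ≥0∞) :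
    ∑' η : Fin m → ℕ, ∏ x, f x (η x) = ∏ x, ∑' k, f x k := by
  induction m with
  | zero => simp
  | succ m ih =>
    rw [Fin.prod_univ_succ, ← ih, ← (Fin.insertNthEquiv (fun _ => ℕ) 0).tsum_eq,
      ENNReal.tsum_prod', ← ENNReal.tsum_mul_right]
    refine tsum_congr fun k => ?_
    rw [← ENNReal.tsum_mul_left]
    refine tsum_congr fun η => ?_
    rw [Fin.prod_univ_succ]
    simp [Fin.insertNthEquiv]

lemma descFactorial_add_div_factorial (m k : ℕ) :
    ((m + k).descFactorial k : ℝ) / ((m + k).factorial : ℝ) = 1 / (m.factorial : ℝ) := by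
  have h := Nat.factorial_mul_descFactorial (Nat.le_add_left k m)
  rw [Nat.add_sub_cancel] at h
  rw [← h]
  have h1 : ((m.factorial : ℕ) : ℝ) ≠ 0 := by exact_mod_cast m.factorial_ne_zero
  have h2 : (((m + k).descFactorial k : ℕ) : ℝ) ≠ 0 := by
    exact_mod_cast (Nat.descFactorial_pos.2 (Nat.le_add_left k m)).ne'
  push_cast
  field_simp

/-- Factorial moments of the binomial distribution. -/
lemma hasSum_binomial {a k : ℕ} (hk : k ≤ a) {θ : ℝ} (h1 : θ < 1) :
    HasSum (fun n : ℕ => (a.descFactorial n : ℝ) / ((1 - θ) ^ a)⁻¹ *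
      ((θ / (1 - θ)) ^ n / (n.factorial : ℝ)) *
      ((n.descFactorial k : ℝ) / (a.descFactorial k : ℝ))) (θ ^ k) := by
  have h0 : (1 : ℝ) - θ ≠ 0 := by linarith
  have hak : (a.descFactorial k : ℝ) ≠ 0 := by exact_mod_cast (Nat.descFactorial_pos.2 hk).ne'
  -- Terms with n < k vanish; after shifting by k the series is the binomial expansion of exponent a
  -- - k.
  rw [← hasSum_nat_add_iff' k, Finset.sum_eq_zero (fun i hi => by
    rw [Nat.descFactorial_of_lt (Finset.mem_range.1 hi)]; simp), sub_zero]
  have hterm : ∀ m : ℕ, (a.descFactorial (m + k) : ℝ) / ((1 - θ) ^ a)⁻¹ *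
      ((θ / (1 - θ)) ^ (m + k) / ((m + k).factorial : ℝ)) *
      (((m + k).descFactorial k : ℝ) / (a.descFactorial k : ℝ)) =
      ((θ / (1 - θ)) ^ k * (1 - θ) ^ a) * ((θ / (1 - θ)) ^ m * 1 ^ (a - k - m) *
        (a - k).choose m) := by
    intro m
    have e1 := Nat.descFactorial_mul_descFactorial (n := a) (Nat.le_add_left k m)
    rw [Nat.add_sub_cancel, Nat.descFactorial_eq_factorial_mul_choose (a - k)] at e1
    have hm : ((m.factorial : ℕ) : ℝ) ≠ 0 := by exact_mod_cast m.factorial_ne_zero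
    rw [← e1]
    calc _ = (1 - θ) ^ a * (θ / (1 - θ)) ^ (m + k) * ((a - k).choose m * m.factorial) *
          (((m + k).descFactorial k : ℝ) / ((m + k).factorial : ℝ)) *
          ((a.descFactorial k : ℝ) / (a.descFactorial k : ℝ)) := by
          push_cast
          rw [div_inv_eq_mul]
          ring
      _ = _ := by
          rw [descFactorial_add_div_factorial, div_self hak, pow_add]
          field_simp
          simp
  simp_rw [hterm]
  have hsum : ∑ m ∈ Finset.range (a - k + 1), (θ / (1 - θ)) ^ m * 1 ^ (a - k - m) *
      ((a - k).choose m : ℝ) = ((1 - θ) ^ (a - k))⁻¹ := by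
    rw [← add_pow, ← inv_pow]
    congr 1
    field_simp
    ring
  have hs : HasSum (fun m : ℕ => (θ / (1 - θ)) ^ m * 1 ^ (a - k - m) * ((a - k).choose m : ℝ))
      (∑ m ∈ Finset.range (a - k + 1), (θ / (1 - θ)) ^ m * 1 ^ (a - k - m) *
        ((a - k).choose m : ℝ)) :=
    hasSum_sum_of_ne_finset_zero fun m (hm : m ∉ Finset.range (a - k + 1)) => by
      have hm' : a - k < m := by rw [Finset.mem_range] at hm; omega
      rw [Nat.choose_eq_zero_of_lt hm']; simp
  rw [hsum] at hs
  have h2 := hs.mul_left ((θ / (1 - θ)) ^ k * (1 - θ) ^ a)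
  have h3 : (θ / (1 - θ)) ^ k * (1 - θ) ^ a * ((1 - θ) ^ (a - k))⁻¹ = θ ^ k := by
    rw [div_pow, show (1 - θ) ^ a = (1 - θ) ^ (a - k) * (1 - θ) ^ k by
      rw [← pow_add, Nat.sub_add_cancel hk]]
    field_simp
  rwa [h3] at h2

/-- Factorial moments of the negative binomial distribution. -/
lemma hasSum_negBinomial {a : ℕ} (ha : 0 < a) (k : ℕ) {θ : ℝ} (h0 : 0 ≤ θ) :
    HasSum (fun n : ℕ => (a.ascFactorial n : ℝ) / (1 + θ) ^ a *
      ((θ / (1 + θ)) ^ n / (n.factorial : ℝ)) *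
      ((n.descFactorial k : ℝ) / (a.ascFactorial k : ℝ))) (θ ^ k) := by
  obtain ⟨b, rfl⟩ := Nat.exists_eq_succ_of_ne_zero ha.ne'
  have h1 : (1 : ℝ) + θ ≠ 0 := by linarith
  have hak : ((b.succ.ascFactorial k : ℕ) : ℝ) ≠ 0 := by
    exact_mod_cast (Nat.ascFactorial_pos b k).ne'
  -- The same shift turns the series into the negative binomial series with parameter a + k, where a
  -- = b + 1.
  rw [← hasSum_nat_add_iff' k, Finset.sum_eq_zero (fun i hi => by
    rw [Nat.descFactorial_of_lt (Finset.mem_range.1 hi)]; simp), sub_zero]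
  have hterm : ∀ m : ℕ, (b.succ.ascFactorial (m + k) : ℝ) / (1 + θ) ^ b.succ *
      ((θ / (1 + θ)) ^ (m + k) / ((m + k).factorial : ℝ)) *
      (((m + k).descFactorial k : ℝ) / (b.succ.ascFactorial k : ℝ)) =
      ((θ / (1 + θ)) ^ k / (1 + θ) ^ b.succ) *
        ((m + (b + k)).choose (b + k) * (θ / (1 + θ)) ^ m) := by
    intro m
    have e1 := Nat.ascFactorial_mul_ascFactorial b.succ k m
    have e2 := Nat.ascFactorial_eq_factorial_mul_choose (b + k) m
    rw [show b + k + 1 = b.succ + k by omega, ← Nat.choose_symm_add, add_comm (b + k) m] at e2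
    rw [e2, add_comm k m] at e1
    have hm : ((m.factorial : ℕ) : ℝ) ≠ 0 := by exact_mod_cast m.factorial_ne_zero
    rw [← e1]
    calc _ = ((1 + θ) ^ b.succ)⁻¹ * (θ / (1 + θ)) ^ (m + k) *
          (m.factorial * (m + (b + k)).choose (b + k)) *
          (((m + k).descFactorial k : ℝ) / ((m + k).factorial : ℝ)) *
          ((b.succ.ascFactorial k : ℝ) / (b.succ.ascFactorial k : ℝ)) := by
          push_cast
          ring
      _ = _ := by
          rw [descFactorial_add_div_factorial, div_self hak, pow_add]
          field_simp
  simp_rw [hterm]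
  have hr : ‖θ / (1 + θ)‖ < 1 := by
    rw [Real.norm_of_nonneg (by positivity), div_lt_one (by linarith)]
    linarith
  have h2 := (hasSum_choose_mul_geometric_of_norm_lt_one (b + k) hr).mul_left
    ((θ / (1 + θ)) ^ k / (1 + θ) ^ b.succ)
  have h3 : 1 - θ / (1 + θ) = (1 + θ)⁻¹ := by field_simp; ring
  have h4 : (θ / (1 + θ)) ^ k / (1 + θ) ^ b.succ * (1 / (1 - θ / (1 + θ)) ^ (b + k + 1)) =
      θ ^ k := by
    rw [h3, inv_pow, div_pow, one_div, inv_inv, show b + k + 1 = b.succ + k by omega, pow_add]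
    field_simp
  rwa [h4] at h2

/-- Admissible densities for the local equilibrium measures. -/
def IsDensity (P : BoundaryDriven) (θ : ℝ) : Prop := 0 < θ ∧ (P.σ = -1 → θ < 1)

lemma nu_nonneg (hσ : P.σ = -1 ∨ P.σ = 1) {θ : ℝ} (hθ : P.IsDensity θ) (x : Fin P.N) (k : ℕ) :
    0 ≤ P.ν x θ k := by
  have h0 := hθ.1
  have h1 : (1 : SignType) ≠ -1 := by decide
  have h2 : (1 : SignType) ≠ 0 := by decide
  have hw := w_nonneg x k
  unfold ν z
  rcases sigma_eq hσ with ⟨h3, h4⟩ | ⟨h3, h4⟩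
  · have h5 := hθ.2 h3
    have h6 : 0 < 1 - θ := by linarith
    have h7 : 1 + (-1 : ℝ) * θ = 1 - θ := by ring
    rw [if_neg (fun h => h5.ne h.2), if_pos h3, h4, h7]
    positivity
  · rw [if_neg (fun h => h1 (h3.symm.trans h.1)), if_neg (by rw [h3]; exact h1),
      if_neg (by rw [h3]; exact h2), h4, one_mul]
    positivity

lemma hasSum_nu_mul_factor (hσ : P.σ = -1 ∨ P.σ = 1) {θ : ℝ} (hθ : P.IsDensity θ)
    {x : Fin P.N} {k : ℕ} (hk : P.Allowed x k) :
    HasSum (fun m => P.ν x θ m * P.factor x k m) (θ ^ k) := by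
  have h1 : (1 : SignType) ≠ -1 := by decide
  have h2 : (1 : SignType) ≠ 0 := by decide
  unfold ν z factor w
  rcases sigma_eq hσ with ⟨h3, h4⟩ | ⟨h3, h4⟩
  · have h5 := hθ.2 h3
    have h7 : 1 + (-1 : ℝ) * θ = 1 - θ := by ring
    simp only [h3, h5.ne, and_false, if_false, if_true, SignType.coe_neg, SignType.coe_one, h7]
    exact hasSum_binomial (hk h3) h5
  · simp only [h3, h1, h2, false_and, if_false, SignType.coe_one, one_mul]
    exact hasSum_negBinomial (P.α_pos x) k hθ.1.le

lemma nu_eq_zero {θ : ℝ} (hσ : P.σ = -1) (hθ : θ < 1) {x : Fin P.N} {k : ℕ} (hk : P.α x < k) :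
    P.ν x θ k = 0 := by
  simp [ν, w, hσ, hθ.ne, Nat.descFactorial_of_lt hk]

/-- The weights vanish when exclusion is violated, so the sum may run over all of ℕ^V, where it
factorises over sites. -/
lemma tsum_state {θ : Fin P.N → ℝ} (hθ : ∀ x, P.IsDensity (θ x))
    (f : (Fin P.N → ℕ) → ℝ≥0∞) :
    ∑' η : P.State, ENNReal.ofReal (∏ x, P.ν x (θ x) (η.1 x)) * f η.1 =
      ∑' η : Fin P.N → ℕ, ENNReal.ofReal (∏ x, P.ν x (θ x) (η x)) * f η := by
  refine tsum_subtype_eq_of_support_subset 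
    (f := fun η : Fin P.N → ℕ => ENNReal.ofReal (∏ x, P.ν x (θ x) (η x)) * f η)
    (s := {η : Fin P.N → ℕ | P.σ = -1 → ∀ x, η x ≤ P.α x}) ?_
  intro η hη h x
  by_contra! hx
  refine hη ?_
  dsimp only
  rw [Finset.prod_eq_zero (Finset.mem_univ x) (nu_eq_zero h ((hθ x).2 h) hx)]
  simp

/-- Expectation of the duality function under a local equilibrium product measure. -/
lemma lintegral_productMeasure_Dcl (hσ : P.σ = -1 ∨ P.σ = 1) {θ : Fin P.N → ℝ}
    (hθ : ∀ x, P.IsDensity (θ x)) (ξ : P.DualState) :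
    ∫⁻ η, ENNReal.ofReal (P.Dcl ξ η) ∂(P.productMeasure θ) =
      ENNReal.ofReal (P.θL ^ ξ.left * (∏ x, θ x ^ ξ.bulk.1 x) * P.θR ^ ξ.right) := by
  have hL : 0 ≤ P.θL ^ ξ.left := pow_nonneg P.θL_nonneg _
  have hR : 0 ≤ P.θR ^ ξ.right := pow_nonneg P.θR_nonneg _
  have hB : ∀ η : Fin P.N → ℕ, 0 ≤ P.bulkDual ξ.bulk.1 η := fun η =>
    Finset.prod_nonneg fun x _ => factor_nonneg x _ _
  have h1 : ∀ η : P.State, ENNReal.ofReal (P.Dcl ξ η) =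
      ENNReal.ofReal (P.θL ^ ξ.left * P.θR ^ ξ.right) * ENNReal.ofReal (P.bulkDual ξ.bulk.1 η.1) :=
    fun η => by
      rw [Dcl_eq, ← ENNReal.ofReal_mul (mul_nonneg hL hR)]
      ring_nf
  have h2 : ∫⁻ η : P.State, ENNReal.ofReal (P.bulkDual ξ.bulk.1 η.1) ∂(P.productMeasure θ) =
      ENNReal.ofReal (∏ x, θ x ^ ξ.bulk.1 x) := by
    unfold productMeasure
    rw [lintegral_sum_measure]
    simp_rw [lintegral_smul_measure, lintegral_dirac, smul_eq_mul]
    rw [tsum_state hθ fun η => ENNReal.ofReal (P.bulkDual ξ.bulk.1 η)]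
    have h3 : ∀ η : Fin P.N → ℕ, ENNReal.ofReal (∏ x, P.ν x (θ x) (η x)) *
        ENNReal.ofReal (P.bulkDual ξ.bulk.1 η) =
        ∏ x, ENNReal.ofReal (P.ν x (θ x) (η x) * P.factor x (ξ.bulk.1 x) (η x)) := by
      intro η
      rw [← ENNReal.ofReal_mul' (hB η), bulkDual, ← Finset.prod_mul_distrib,
        ENNReal.ofReal_prod_of_nonneg fun x _ =>
          mul_nonneg (nu_nonneg hσ (hθ x) x _) (factor_nonneg x _ _)]
    simp_rw [h3]
    rw [tsum_prod_pi fun x m => ENNReal.ofReal (P.ν x (θ x) m * P.factor x (ξ.bulk.1 x) m),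
      ENNReal.ofReal_prod_of_nonneg fun x _ => pow_nonneg (hθ x).1.le _]
    refine Finset.prod_congr rfl fun x _ => ?_
    have h4 := hasSum_nu_mul_factor hσ (hθ x) (ξ.bulk.allowed x)
    rw [← h4.tsum_eq, ENNReal.ofReal_tsum_of_nonneg
      (fun m => mul_nonneg (nu_nonneg hσ (hθ x) x _) (factor_nonneg x _ _)) h4.summable]
  simp_rw [h1]
  rw [lintegral_const_mul _ measurable_from_top, h2, ← ENNReal.ofReal_mul (mul_nonneg hL hR)]
  ring_nf

lemma integral_productMeasure_Dcl (hσ : P.σ = -1 ∨ P.σ = 1) {θ : Fin P.N → ℝ}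
    (hθ : ∀ x, P.IsDensity (θ x)) (ξ : P.DualState) :
    ∫ η, P.Dcl ξ η ∂(P.productMeasure θ) =
      P.θL ^ ξ.left * (∏ x, θ x ^ ξ.bulk.1 x) * P.θR ^ ξ.right := by
  rw [integral_eq_lintegral_of_nonneg_ae (Filter.Eventually.of_forall fun η => Dcl_nonneg _ η)
    (measurable_from_top (f := P.Dcl ξ)).aestronglyMeasurable,
    lintegral_productMeasure_Dcl hσ hθ, ENNReal.toReal_ofReal]
  exact mul_nonneg (mul_nonneg (pow_nonneg P.θL_nonneg _)
    (Finset.prod_nonneg fun x _ => pow_nonneg (hθ x).1.le _)) (pow_nonneg P.θR_nonneg _)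

end BoundaryDriven

/-! ### The interaction term and the two positivity arguments -/

namespace BoundaryDriven

open FellerChain

variable {P : BoundaryDriven} {n : ℕ}

/-- The expectation of the duality function under the product measure with densities `θ`. -/
noncomputable def equilibriumMoment (θ : Fin P.N → ℝ) (ξ : P.DualState) : ℝ :=
  P.θL ^ ξ.left * (∏ x, θ x ^ ξ.bulk.1 x) * P.θR ^ ξ.right

/-- The Dirichlet form-like gradient term produced by the interaction. -/
noncomputable def interaction (θ : Fin P.N → ℝ) (ξ : P.DualState) : ℝ :=
  ∑ x, ∑ y, P.ω x y *
    (ξ.bulk.1 x * ξ.bulk.1 y * ((θ y - θ x) ^ 2 / (2 * (θ x * θ y))))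

lemma prod_pow_add (θ : Fin P.N → ℝ) (k : Fin P.N → ℕ) (y : Fin P.N) :
    ∏ z, θ z ^ P.add k y z = (∏ z, θ z ^ k z) * θ y := by
  simp only [add, Pi.add_apply, pow_add, Finset.prod_mul_distrib]
  congr 1
  rw [Finset.prod_eq_single y] <;> simp +contextual

lemma prod_pow_remove {θ : Fin P.N → ℝ} (hθ : ∀ x, 0 < θ x) {k : Fin P.N → ℕ} {x : Fin P.N}
    (hx : 0 < k x) : ∏ z, θ z ^ P.remove k x z = (∏ z, θ z ^ k z) / θ x := by
  rw [eq_div_iff (hθ x).ne', ← prod_pow_add]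
  refine Finset.prod_congr rfl fun z _ => ?_
  by_cases hz : z = x
  · subst hz
    rw [add_same, remove_same, Nat.sub_add_cancel hx]
  · rw [add_of_ne _ hz, remove_of_ne _ hz]

/-- The dual generator applied to the moments of a product measure with a harmonic density. -/
lemma gen_equilibriumMoment {θ : Fin P.N → ℝ} (hθ : ∀ x, 0 < θ x) (hh : P.IsHarmonic θ P.resθ)
    (ξ : P.DualLevel n) :
    gen dualRate dualMove (fun ζ : P.DualLevel n => equilibriumMoment θ ζ.1) ξ =
      (P.σ : ℝ) * (equilibriumMoment θ ξ.1 * interaction θ ξ.1) := by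
  unfold equilibriumMoment
  rw [dual_gen_eq fun k => ∏ x, θ x ^ k x]
  set k := ξ.1.bulk.1
  set F := ∏ x, θ x ^ k x with hF
  -- The rate splits into an α part, which together with the reservoirs forms the harmonic equation
  -- weighted by k x / θ x, and a σ part, which is the interaction.
  have hbulk : ∀ x y, P.ω x y * (k x * (P.α y + (P.σ : ℝ) * k y) *
      (∏ z, θ z ^ P.add (P.remove k x) y z - F)) =
      F * (k x / θ x * (P.ω x y * (P.α y * (θ y - θ x)))) +
        (P.σ : ℝ) * F * (P.ω x y * (k x * k y * ((θ y - θ x) / θ x))) := by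
    intro x y
    rcases Nat.eq_zero_or_pos (k x) with hx | hx
    · simp [hx]
    · have := (hθ x).ne'
      rw [prod_pow_add, prod_pow_remove hθ hx]
      field_simp
      ring
  have hres : ∀ b, P.resω b * (P.resα b * k (P.site b) *
      (P.resθ b * ∏ z, θ z ^ P.remove k (P.site b) z - F)) =
      F * ∑ x, k x / θ x * (if P.site b = x then P.resω b * (P.resα b * (P.resθ b - θ x))
        else 0) := by
    intro b
    simp only [mul_ite, mul_zero, Finset.sum_ite_eq, Finset.mem_univ, if_true]
    rcases Nat.eq_zero_or_pos (k (P.site b)) with hx | hx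
    · simp [hx]
    · have := (hθ (P.site b)).ne'
      rw [prod_pow_remove hθ hx, ← hF]
      field_simp
  -- Both directions of a bond add up to (θ y - θ x)² / (θ x θ y), a square: this is where the
  -- definite sign comes from.
  have hsym := sum_bonds_congr (P := P) (F := fun x y => k x * k y * ((θ y - θ x) / θ x))
    (G := fun x y => k x * k y * ((θ y - θ x) ^ 2 / (2 * (θ x * θ y)))) fun x y _ => by
      have h1 := (hθ x).ne'
      have h2 := (hθ y).ne'
      field_simp
      ring
  have hharm : ∑ x, ∑ y, F * (k x / θ x * (P.ω x y * (P.α y * (θ y - θ x)))) +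
      ∑ b, F * ∑ x, k x / θ x * (if P.site b = x then P.resω b * (P.resα b * (P.resθ b - θ x))
        else 0) = 0 := by
    have h1 : ∑ x, F * (k x / θ x * (∑ y, P.ω x y * (P.α y * (θ y - θ x)) +
        ∑ b, (if P.site b = x then P.resω b * (P.resα b * (P.resθ b - θ x)) else 0))) = 0 :=
      Finset.sum_eq_zero fun x _ => by rw [hh x]; simp
    refine Eq.trans ?_ h1
    simp only [mul_add, Finset.sum_add_distrib, Finset.mul_sum]
    congr 1
    exact Finset.sum_comm
  have hint : ∑ x, ∑ y, P.ω x y * (k x * k y * ((θ y - θ x) ^ 2 / (2 * (θ x * θ y)))) =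
      interaction θ ξ.1 := rfl
  simp only [DualLevel.at_]
  change _ * ((∑ x, ∑ y, P.ω x y * (k x * (P.α y + (P.σ : ℝ) * k y) *
      (∏ z, θ z ^ P.add (P.remove k x) y z - F))) + ∑ b, P.resω b * (P.resα b * k (P.site b) *
      (P.resθ b * ∏ z, θ z ^ P.remove k (P.site b) z - F))) * _ = _
  simp_rw [hbulk, hres, Finset.sum_add_distrib]
  rw [add_right_comm, hharm, zero_add]
  simp_rw [← Finset.mul_sum]
  rw [hsym, hint]
  ring

lemma equilibriumMoment_nonneg {θ : Fin P.N → ℝ} (hθ : ∀ x, 0 < θ x) (ξ : P.DualState) :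
    0 ≤ equilibriumMoment θ ξ :=
  mul_nonneg (mul_nonneg (pow_nonneg P.θL_nonneg _)
    (Finset.prod_nonneg fun x _ => pow_nonneg (hθ x).le _)) (pow_nonneg P.θR_nonneg _)

lemma equilibriumMoment_pos {θ : Fin P.N → ℝ} (hθ : ∀ x, 0 < θ x) {ξ : P.DualState}
    (hl : 0 < ξ.left → 0 < P.θL) (hr : 0 < ξ.right → 0 < P.θR) :
    0 < equilibriumMoment θ ξ := by
  have h : ∀ {a : ℝ} {k : ℕ}, (0 < k → 0 < a) → 0 < a ^ k := by
    intro a k hk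
    rcases Nat.eq_zero_or_pos k with rfl | h0
    · simp
    · exact pow_pos (hk h0) k
  exact mul_pos (mul_pos (h hl) (Finset.prod_pos fun x _ => pow_pos (hθ x) _)) (h hr)

lemma interaction_nonneg {θ : Fin P.N → ℝ} (hθ : ∀ x, 0 < θ x) (ξ : P.DualState) :
    0 ≤ interaction θ ξ :=
  Finset.sum_nonneg fun x _ => Finset.sum_nonneg fun y _ => mul_nonneg (P.ω_nonneg x y) <| by
    have := hθ x
    have := hθ y
    positivity

lemma interaction_pos {θ : Fin P.N → ℝ} (hθ : ∀ x, 0 < θ x) {ξ : P.DualState} {x y : Fin P.N}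
    (hxy : 0 < P.ω x y) (hne : θ x ≠ θ y) (hx : 0 < ξ.bulk.1 x) (hy : 0 < ξ.bulk.1 y) :
    0 < interaction θ ξ := by
  have hterm : ∀ a b, 0 ≤ P.ω a b *
      (ξ.bulk.1 a * ξ.bulk.1 b * ((θ b - θ a) ^ 2 / (2 * (θ a * θ b)))) := fun a b => by
    have := hθ a
    have := hθ b
    have := P.ω_nonneg a b
    positivity
  refine Finset.sum_pos' (fun a _ => Finset.sum_nonneg fun b _ => hterm a b)
    ⟨x, Finset.mem_univ _, Finset.sum_pos' (fun b _ => hterm x b) ⟨y, Finset.mem_univ _, ?_⟩⟩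
  have h1 := hθ x
  have h2 := hθ y
  have h3 : 0 < (θ y - θ x) ^ 2 := by
    have : θ y - θ x ≠ 0 := sub_ne_zero.2 hne.symm
    positivity
  have h4 : (0 : ℝ) < ξ.bulk.1 x := by exact_mod_cast hx
  have h5 : (0 : ℝ) < ξ.bulk.1 y := by exact_mod_cast hy
  positivity

/-- The time derivative of the moments, started from local equilibrium, is not zero. -/
lemma dualHeat_interaction_pos (hσ : P.σ = -1 ∨ P.σ = 1) {θ : Fin P.N → ℝ} (hθ : ∀ x, 0 < θ x)
    {x y : Fin P.N} (hxy : 0 < P.ω x y) (hne : θ x ≠ θ y) (ξ : P.DualLevel n)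
    (h2 : 2 ≤ ∑ z, ξ.at_ z) (hl : 0 < ξ.1.left → 0 < P.θL) (hr : 0 < ξ.1.right → 0 < P.θR)
    {t : ℝ} (ht : 0 < t) :
    0 < P.dualHeat n t (fun ζ => equilibriumMoment θ ζ.1 * interaction θ ζ.1) ξ := by
  have hg : ∀ ζ : P.DualLevel n, 0 ≤ equilibriumMoment θ ζ.1 * interaction θ ζ.1 := fun ζ =>
    mul_nonneg (equilibriumMoment_nonneg hθ _) (interaction_nonneg hθ _)
  -- Bulk jumps leave the absorbed counts unchanged, so the conditions on θ_L and θ_R persist along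
  -- the path.
  refine dual_induction (C := fun ζ : P.DualLevel n => (0 < ζ.1.left → 0 < P.θL) →
    (0 < ζ.1.right → 0 < P.θR) → ∀ t, 0 < t →
      0 < P.dualHeat n t (fun ζ => equilibriumMoment θ ζ.1 * interaction θ ζ.1) ζ) hxy
    (fun ζ a b hr hC hl hr' t ht => ?_) (fun ζ hx hy hl hr t ht => ?_) ξ h2 hl hr t ht
  · exact heat_pos_of_step dualMove (dualRate_nonneg hσ) hg hr (hC hl hr') ht
  · exact heat_pos_of_pos dualMove (dualRate_nonneg hσ) hg
      (mul_pos (equilibriumMoment_pos hθ hl hr) (interaction_pos hθ hxy hne hx hy)) ht.le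

/-- A superharmonic function which vanishes when fewer than two particles are in the bulk, and is
strictly superharmonic when both ends of a given bond are occupied, is positive. -/
lemma pos_of_superharmonic (hσ : P.σ = -1 ∨ P.σ = 1) {K g : P.DualLevel 2 → ℝ}
    (hg : ∀ ζ, 0 ≤ g ζ) (hK : ∀ ζ, gen dualRate dualMove K ζ = -g ζ)
    (h0 : ∀ ζ : P.DualLevel 2, ∑ z, ζ.at_ z < 2 → K ζ = 0) {x y : Fin P.N} (hxy : 0 < P.ω x y)
    (hgpos : ∀ ζ : P.DualLevel 2, 0 < ζ.at_ x → 0 < ζ.at_ y → 0 < g ζ) (ξ : P.DualLevel 2)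
    (h2 : 2 ≤ ∑ z, ξ.at_ z) : 0 < K ξ := by
  by_contra! hneg
  have : Nonempty (P.DualLevel 2) := ⟨ξ⟩
  obtain ⟨ζ₀, hmin⟩ := Finite.exists_min K
  have hterm : ∀ ζ, K ζ = K ζ₀ → ∀ m ∈ Finset.univ,
      0 ≤ dualRate m ζ * (K (dualMove m ζ) - K ζ) := fun ζ hζ m _ =>
    mul_nonneg (dualRate_nonneg hσ m ζ) (by rw [hζ]; linarith [hmin (dualMove m ζ)])
  -- No configuration with two bulk particles attains the minimum: minimality passes along moves of
  -- positive rate and contradicts strict superharmonicity on the bond. A minimiser thus has K = 0,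
  -- and then K ξ ≤ 0 would make ξ a minimiser.
  have key := dual_induction (n := 2) (C := fun ζ => K ζ ≠ K ζ₀) hxy
    (fun ζ a b hrate hC hζ => ?_) (fun ζ hx hy hζ => ?_)
  · have hξ := key ξ h2
    by_cases h : 2 ≤ ∑ z, ζ₀.at_ z
    · exact key ζ₀ h rfl
    · have h3 := h0 ζ₀ (not_le.1 h)
      exact hξ (le_antisymm (by linarith) (hmin ξ))
  · have h1 := Finset.sum_nonneg (hterm ζ hζ)
    have h3 : ∑ m, dualRate m ζ * (K (dualMove m ζ) - K ζ) = 0 :=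
      le_antisymm ((hK ζ).le.trans (by linarith [hg ζ])) h1
    have h4 := (Finset.sum_eq_zero_iff_of_nonneg (hterm ζ hζ)).1 h3 (Sum.inl (a, b))
      (Finset.mem_univ _)
    rw [mul_eq_zero, or_iff_right hrate.ne', sub_eq_zero] at h4
    exact hC (h4.trans hζ)
  · have h1 := Finset.sum_nonneg (hterm ζ hζ)
    have h3 : 0 ≤ -g ζ := h1.trans (hK ζ).le
    linarith [hgpos ζ hx hy]

/-- The dual configuration with one particle at `x` and one at `y`. -/
noncomputable def DualLevel.pair (P : BoundaryDriven) {x y : Fin P.N} (h : x ≠ y) :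
    P.DualLevel 2 :=
  ⟨⟨⟨Pi.single x 1 + Pi.single y 1, fun _ z => by
    have hz := Nat.succ_le_of_lt (P.α_pos z)
    by_cases hx : z = x
    · subst hx
      simpa [h] using hz
    · by_cases hy : z = y
      · subst hy
        simpa [hx] using hz
      · simp [hx, hy]⟩, 0, 0⟩, by simp [Finset.sum_add_distrib]⟩

lemma Dcl_pair (hσ : P.σ = -1 ∨ P.σ = 1) {x y : Fin P.N} (h : x ≠ y) (η : P.State) :
    P.Dcl (DualLevel.pair P h).1 η = (η.1 x / P.α x) * (η.1 y / P.α y) := by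
  rw [Dcl_eq, bulkDual, prod_pair_erase h, Finset.prod_eq_one]
  · simp [DualLevel.pair, factor_one hσ, h, h.symm]
  · intro z hz
    simp only [Finset.mem_erase] at hz
    simp [DualLevel.pair, hz.1, hz.2.1, factor_zero]

lemma equilibriumMoment_pair (θ : Fin P.N → ℝ) {x y : Fin P.N} (h : x ≠ y) :
    equilibriumMoment θ (DualLevel.pair P h).1 = θ x * θ y := by
  rw [equilibriumMoment, prod_pair_erase h, Finset.prod_eq_one]
  · simp [DualLevel.pair, h, h.symm]
  · intro z hz
    simp only [Finset.mem_erase] at hz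
    simp [DualLevel.pair, hz.1, hz.2.1]

/-- Stationary moments agree with local equilibrium if there is at most one bulk particle. -/
lemma integral_Dcl_of_sum_lt_two (hσ : P.σ = -1 ∨ P.σ = 1) (μ : Measure P.State)
    [IsProbabilityMeasure μ] (ξ : P.DualState) (h : ∑ z, ξ.bulk.1 z < 2) :
    ∫ η, P.Dcl ξ η ∂μ = equilibriumMoment (P.profile μ) ξ := by
  rw [integral_Dcl, equilibriumMoment]
  congr 2
  generalize ξ.bulk.1 = k at h
  by_cases h0 : ∃ x, k x ≠ 0
  · obtain ⟨x, hx⟩ := h0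
    have hk : k = Pi.single x 1 := by
      have h1 := Finset.add_sum_erase Finset.univ k (Finset.mem_univ x)
      ext z
      by_cases hz : z = x
      · subst hz
        simp only [Pi.single_eq_same]
        omega
      · have h2 := Finset.single_le_sum (f := k) (fun _ _ => Nat.zero_le _)
          (Finset.mem_erase.2 ⟨hz, Finset.mem_univ z⟩)
        simp only [Pi.single_eq_of_ne hz]
        omega
    rw [hk, integral_bulkDual_single hσ, Finset.prod_eq_single x]
    · simp
    · intro z _ hz; simp [hz]
    · simp
  · push Not at h0
    have hk : k = 0 := funext h0
    rw [hk, integral_bulkDual_zero]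
    simp

end BoundaryDriven

/-! ### Proof of the theorem -/

open BoundaryDriven in
theorem mainTheorem5 (P : BoundaryDriven) (hN : 2 ≤ P.N) (hσ : P.σ = -1 ∨ P.σ = 1)
    (hωL : 0 < P.ωL) (hωR : 0 < P.ωR) (hθ : P.θL ≠ P.θR) :
    ∃ μ : Measure P.State,
      -- `μ` is the unique stationary probability measure
      IsProbabilityMeasure μ ∧ P.IsStationary μ ∧
      (∀ μ' : Measure P.State, IsProbabilityMeasure μ' → P.IsStationary μ' → μ' = μ) ∧
      -- the stationary profile is well defined
      (∀ x, Integrable (fun η : P.State => (η.1 x : ℝ) / P.α x) μ) ∧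
      -- sign of the time derivative, started from the local equilibrium product measure
      (∀ ξ : P.DualState, 2 ≤ ∑ x, ξ.bulk.1 x →
        (0 < ξ.left → 0 < P.θL) → (0 < ξ.right → 0 < P.θR) →
        (∀ t : ℝ, 0 ≤ t →
          Integrable (P.Dcl ξ) (P.law (P.productMeasure (P.profile μ)) t)) ∧
        ∀ t : ℝ, 0 < t →
          DifferentiableAt ℝ (P.localEquilibriumExpectation μ ξ) t ∧
          (P.σ = -1 → deriv (P.localEquilibriumExpectation μ ξ) t < 0) ∧
          (P.σ = 1 → 0 < deriv (P.localEquilibriumExpectation μ ξ) t)) ∧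
      -- sign of the stationary two-point correlations
      (∀ x y, x ≠ y →
        Integrable (fun η : P.State =>
          ((η.1 x : ℝ) / P.α x - P.profile μ x) * ((η.1 y : ℝ) / P.α y - P.profile μ y)) μ ∧
        (P.σ = -1 → P.correlation μ x y < 0) ∧
        (P.σ = 1 → 0 < P.correlation μ x y)) := by
  have hω : ∀ b, 0 < P.resω b := fun b => by cases b <;> assumption
  obtain ⟨μ, hμ, hst, huniq, hfin⟩ := exists_stationary hσ hω hθ
  have hint : ∀ (n : ℕ) (ζ : P.DualLevel n), Integrable (P.Dcl ζ.1) μ :=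
    fun n ζ => integrable_Dcl (hfin n ζ)
  set θ := P.profile μ
  have hharm : P.IsHarmonic θ P.resθ := isHarmonic_profile hσ hst (hint 1)
  -- The maximum principle for -θ with bound 0; strictness covers the case of a reservoir with
  -- parameter 0.
  have hpos : ∀ x, 0 < θ x := fun x => by
    have := hharm.neg.lt hω (fun h => hθ (neg_injective h)) (K := 0)
      (fun b => neg_nonpos.2 (resθ_nonneg b)) x
    linarith
  have hdens : ∀ x, P.IsDensity (θ x) := fun x =>
    ⟨hpos x, fun h => hharm.lt hω hθ (fun b => resθ_le_one h b) x⟩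
  obtain ⟨a, b, hab, hne⟩ := hharm.exists_ne hN hω hθ
  have hprof : ∀ x, Integrable (fun η : P.State => (η.1 x : ℝ) / P.α x) μ := fun x =>
    (hint 1 (DualLevel.single P x)).congr (Filter.Eventually.of_forall fun η => Dcl_single hσ x η)
  refine ⟨μ, hμ, hst, huniq, hprof, fun ξ h2 hl hr => ?_, fun x y hxy => ?_⟩
  · set n := ∑ x, ξ.bulk.1 x + ξ.left + ξ.right
    let ξ' : P.DualLevel n := ⟨ξ, rfl⟩
    have hprod : ∀ ζ : P.DualLevel n, Integrable (P.Dcl ζ.1) (P.productMeasure θ) := fun ζ =>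
      integrable_Dcl (by rw [lintegral_productMeasure_Dcl hσ hdens]; exact ENNReal.ofReal_ne_top)
    have hmom : (fun ζ : P.DualLevel n => ∫ η, P.Dcl ζ.1 η ∂(P.productMeasure θ)) =
        fun ζ => equilibriumMoment θ ζ.1 :=
      funext fun ζ => integral_productMeasure_Dcl hσ hdens ζ.1
    have hval : ∀ t, 0 ≤ t → P.localEquilibriumExpectation μ ξ t =
        P.dualHeat n t (fun ζ => equilibriumMoment θ ζ.1) ξ' := fun t ht => by
      rw [← hmom]
      exact (integral_law_Dcl hσ hprod ht ξ').2
    refine ⟨fun t ht => (integral_law_Dcl hσ hprod ht ξ').1, fun t ht => ?_⟩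
    have hgen : FellerChain.gen dualRate dualMove
        (fun ζ : P.DualLevel n => equilibriumMoment θ ζ.1) =
        (P.σ : ℝ) • fun ζ : P.DualLevel n => equilibriumMoment θ ζ.1 * interaction θ ζ.1 :=
      funext fun ζ => gen_equilibriumMoment hpos hharm ζ
    -- The derivative is taken with the generator inside the dual semigroup. The duality formula
    -- holds for nonnegative times, hence near any t > 0.
    have hder : HasDerivAt (P.localEquilibriumExpectation μ ξ) ((P.σ : ℝ) * P.dualHeat n t
        (fun ζ => equilibriumMoment θ ζ.1 * interaction θ ζ.1) ξ') t := by
      have h1 := FellerChain.hasDerivAt_heat' dualRate dualMove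
        (fun ζ : P.DualLevel n => equilibriumMoment θ ζ.1) t ξ'
      rw [hgen, map_smul] at h1
      refine h1.congr_of_eventuallyEq ?_
      filter_upwards [eventually_gt_nhds ht] with s hs
      exact hval s hs.le
    have hstrict := dualHeat_interaction_pos hσ hpos hab hne ξ' h2 hl hr ht
    refine ⟨hder.differentiableAt, fun h => ?_, fun h => ?_⟩ <;> rw [hder.deriv]
    · have hs : (P.σ : ℝ) = -1 := by simp [h]
      rw [hs]
      linarith
    · have hs : (P.σ : ℝ) = 1 := by simp [h]
      rwa [hs, one_mul]
  · have hpair : Integrable (fun η : P.State => (η.1 x / P.α x : ℝ) * (η.1 y / P.α y)) μ :=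
      (hint 2 (DualLevel.pair P hxy)).congr
        (Filter.Eventually.of_forall fun η => Dcl_pair hσ hxy η)
    have hexp : (fun η : P.State => ((η.1 x : ℝ) / P.α x - θ x) * ((η.1 y : ℝ) / P.α y - θ y)) =
        fun η => (η.1 x / P.α x : ℝ) * (η.1 y / P.α y) - θ y * (η.1 x / P.α x) -
          θ x * (η.1 y / P.α y) + θ x * θ y := by
      ext η
      ring
    have hx1 := (hprof x).const_mul (θ y)
    have hy1 := (hprof y).const_mul (θ x)
    have hi1 : Integrable (fun η : P.State =>
        (η.1 x / P.α x : ℝ) * (η.1 y / P.α y) - θ y * (η.1 x / P.α x)) μ := hpair.sub hx1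
    have hi2 : Integrable (fun η : P.State => (η.1 x / P.α x : ℝ) * (η.1 y / P.α y) -
        θ y * (η.1 x / P.α x) - θ x * (η.1 y / P.α y)) μ := hi1.sub hy1
    have hi : Integrable (fun η : P.State =>
        ((η.1 x : ℝ) / P.α x - θ x) * ((η.1 y : ℝ) / P.α y - θ y)) μ := by
      rw [hexp]
      exact hi2.add (integrable_const _)
    have hcorr : P.correlation μ x y = ∫ η, P.Dcl (DualLevel.pair P hxy).1 η ∂μ -
        equilibriumMoment θ (DualLevel.pair P hxy).1 := by
      have e1 : ∫ η : P.State, (η.1 x : ℝ) / P.α x ∂μ = θ x := rfl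
      have e2 : ∫ η : P.State, (η.1 y : ℝ) / P.α y ∂μ = θ y := rfl
      rw [equilibriumMoment_pair]
      simp_rw [Dcl_pair hσ hxy]
      change ∫ η : P.State, ((η.1 x : ℝ) / P.α x - θ x) * ((η.1 y : ℝ) / P.α y - θ y) ∂μ = _
      rw [hexp, integral_add hi2 (integrable_const _), integral_sub hi1 hy1,
        integral_sub hpair hx1, integral_const_mul,
        integral_const_mul, e1, e2]
      simp
      ring
    -- The factor σ treats both cases at once: the dual generator maps K to -σ² G I = -G I.
    have hKpos := pos_of_superharmonic hσ
      (K := fun ζ => (P.σ : ℝ) * (∫ η, P.Dcl ζ.1 η ∂μ - equilibriumMoment θ ζ.1))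
      (g := fun ζ => equilibriumMoment θ ζ.1 * interaction θ ζ.1)
      (fun ζ => mul_nonneg (equilibriumMoment_nonneg hpos _) (interaction_nonneg hpos _))
      (fun ζ => by
        have h1 := gen_stationary hσ hst (hint 2) ζ
        have h2 := gen_equilibriumMoment hpos hharm ζ
        have h3 : FellerChain.gen dualRate dualMove (fun ζ : P.DualLevel 2 =>
            (P.σ : ℝ) * (∫ η, P.Dcl ζ.1 η ∂μ - equilibriumMoment θ ζ.1)) ζ =
            (P.σ : ℝ) * (FellerChain.gen dualRate dualMove
              (fun ζ : P.DualLevel 2 => ∫ η, P.Dcl ζ.1 η ∂μ) ζ -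
              FellerChain.gen dualRate dualMove
                (fun ζ : P.DualLevel 2 => equilibriumMoment θ ζ.1) ζ) := by
          simp only [FellerChain.gen, ← Finset.sum_sub_distrib, Finset.mul_sum]
          exact Finset.sum_congr rfl fun m _ => by ring
        have h4 : (P.σ : ℝ) * P.σ = 1 := by
          rcases sigma_eq hσ with ⟨-, h⟩ | ⟨-, h⟩ <;> rw [h] <;> norm_num
        rw [h3, h1, h2]
        linear_combination (-(equilibriumMoment θ ζ.1 * interaction θ ζ.1)) * h4)
      (fun ζ hζ => by rw [integral_Dcl_of_sum_lt_two hσ μ ζ.1 hζ, sub_self, mul_zero]) hab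
      (fun ζ ha hb => by
        have h1 := ζ.2
        have h3 : 2 ≤ ∑ z, ζ.at_ z := by
          have h4 := Finset.add_sum_erase Finset.univ ζ.1.bulk.1 (Finset.mem_univ a)
          have h5 := Finset.single_le_sum (f := ζ.1.bulk.1) (fun _ _ => Nat.zero_le _)
            (Finset.mem_erase.2 ⟨(State.ne_of_conductance hab).symm, Finset.mem_univ b⟩)
          simp only [DualLevel.at_] at ha hb ⊢
          omega
        simp only [DualLevel.at_] at h3
        -- On level 2 two bulk particles leave none absorbed, so a vanishing θ_L or θ_R does no
        -- harm.
        exact mul_pos (equilibriumMoment_pos hpos (fun h => by omega) (fun h => by omega))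
          (interaction_pos hpos hab hne ha hb))
      (DualLevel.pair P hxy) (by
        change 2 ≤ ∑ z, (Pi.single x 1 + Pi.single y 1 : Fin P.N → ℕ) z
        simp [Finset.sum_add_distrib])
    rw [← hcorr] at hKpos
    refine ⟨hi, fun h => ?_, fun h => ?_⟩
    · have hs : (P.σ : ℝ) = -1 := by simp [h]
      rw [hs] at hKpos
      linarith
    · have hs : (P.σ : ℝ) = 1 := by simp [h]
      rwa [hs, one_mul] at hKpos
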